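/- **Setting.** Let $A$ be an alphabet, $\mathcal W$ the set of words over $A$ (with the empty word $\emptyset$), $d\ge 0$, and $\nu_{j,\ell}\in\mathbb C$ for $1\le j\le d$, $\ell\in A$. On $\mathbb C^{\mathcal W}$ consider the convolution product $(\delta\star\delta')_{w}=\sum_{w=w'w''}\delta_{w'}\delta'_{w''}$, whose unit is denoted by $1\!\!1$. Let $\mathcal G$ be the group (for $\star$) of all $\gamma\in\mathbb C^{\mathcal W}$ with $\gamma_\emptyset=1$ and $\gamma_w\gamma_{w'}=\sum_j\gamma_{w_j}$ whenever the shuffle product of $w$ and $w'$ is $\sum_j w_j$. Let $\mathfrak g$ be the set of all $\beta\in\mathbb C^{\mathcal W}$ with $\beta_\emptyset=0$ and $\sum_j\beta_{w_j}=0$ whenever $w,w'$ are nonempty with shuffle product $\sum_j w_j$. Write $\exp_\star(\beta)=\sum_{n\ge 0}\beta^{\star n}/n!$. For $v\in\mathbb C^d$ and $w=\ell_1\cdots\ell_n$ put $\nu^v_w=\sum_{i=1}^n\sum_{j=1}^d v_j\nu_{j,\ell_i}$, $(\xi_v\delta)_w=\nu^v_w\delta_w$, $(\Xi_v\delta)_w=e^{\nu^v_w}\delta_w$,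 and let $\mathcal V(v)$ be the set of all $u\in\mathbb C^d$ such that, for every word $w$, $\nu^v_w=0$ implies $\nu^u_w=0$. Put $\overline{\mathfrak g}=\mathbb C^d\times\mathfrak g$ with the bracket $[(v,\beta),(u,\eta)]=(0,\xi_v\eta-\xi_u\beta+\beta\star\eta-\eta\star\beta)$, and $(u,\gamma)\bigstar(v,\delta)=(v+\delta_\emptyset u,\gamma\star\Xi_u\delta)$. Let $g_1,\dots,g_d$ and $f_\ell$ ($\ell\in A$) be smooth (that is, holomorphic) vector fields on $\mathbb C^D$ with $[g_j,g_k]=0$ and $[g_j,f_\ell]=\nu_{j,\ell}f_\ell$, where $[g,f]=f'g-g'f$. Put $g^v=\sum_j v_jg_j$ and assume that the flows of all the fields $g^v$ are globally defined smooth maps, $\varphi_{tv}$ being the flow of $g^v$ at the real time $t$. Put $f_\emptyset(x)=x$, $f_{\ell_1\cdots\ell_n}(x)=f_{\ell_2\cdots\ell_n}'(x)f_{\ell_1}(x)$, and let $W_\delta(x)=\sum_w\delta_wf_w(x)$ and $\overline W_{(v,\delta)}(x)=\varphi_v(W_\delta(x))$ be the word series and the extended word series. All series are formal: one commuting formal parameter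 $\varepsilon_\ell$ is attached to each letter, the words containing each letter $\ell$ exactly $m_\ell$ times form the term of degree $m$, and formal series of points are substituted into series of smooth maps by Taylor expansion. Points, initial values and solutions may be formal series in these parameters. **Theorem.** Given $(v,\beta)\in\overline{\mathfrak g}$, there is $\kappa\in\mathcal G$, depending only on $v$, $\beta$ and the $\nu_{j,\ell}$, such that the element $$\widehat\beta=\kappa\star\beta\star\kappa^{-1}-(\xi_v\kappa)\star\kappa^{-1}$$ belongs to $\mathfrak g$ and satisfies $[(v,0),(0,\widehat\beta)]=(0,\xi_v\widehat\beta)=0$. In addition, $(0,\widehat\beta)$ commutes with all $(u,0)$, $u\in\mathcal V(v)$. Moreover, for all fields $g_j$, $f_\ell$ as above: 1. $x=W_\kappa(X)$ is an invertible formal change of variables, and it transforms the system $\frac{d}{dt}x=g^v(x)+W_\beta(x)$ into the normal form $\frac{d}{dt}X=g^v(X)+W_{\widehat\beta}(X)$, that is, $W_\kappa'(X)\,(g^v(X)+W_{\widehat\beta}(X))=g^v(W_\kappa(X))+W_\beta(W_\kappa(X))$. 2. The vector fields $g^v$ and $W_{\widehat\beta}$ commute, and $W_{\widehat\beta}$ commutes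 with $g^u$ for all $u\in\mathcal V(v)$. 3. The formal system $\frac{d}{dt}X=W_{\widehat\beta}(X)$ has a solution flow $\widehat\varphi_t$, and every solution of the normal form, on any open interval containing $0$, satisfies $X(t)=\varphi_{tv}(\widehat\varphi_t(X(0)))=\widehat\varphi_t(\varphi_{tv}(X(0)))$. 4. The solutions of the normal form on an open interval containing $0$ are exactly the curves with $X(t)=\overline W_{(tv,\exp_\star(t\widehat\beta))}(X(0))$, where, for each real $t$, $\exp_\star(t\widehat\beta)\in\mathcal G$ and $$(tv,\exp_\star(t\widehat\beta))=(0,\exp_\star(t\widehat\beta))\bigstar(tv,1\!\!1)=(tv,1\!\!1)\bigstar(0,\exp_\star(t\widehat\beta)).$$ -/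

import Mathlib

noncomputable section

namespace WordSeries

/-! ### Families of coefficients indexed by words, and the convolution product -/

/-- Families `δ = (δ_w)` of complex numbers indexed by the words with letters in `A`
(a word is a list of letters, `[]` is the empty word). -/
def Coeff (A : Type*) : Type _ := List A → ℂ

namespace Coeff

variable {A : Type*}

instance : AddCommGroup (Coeff A) := inferInstanceAs (AddCommGroup (List A → ℂ))
instance : Module ℂ (Coeff A) := inferInstanceAs (Module ℂ (List A → ℂ))

@[ext] theorem ext {δ δ' : Coeff A} (h : ∀ w : List A, δ w = δ' w) : δ = δ' := funext h

@[simp] theorem add_apply (δ δ' : Coeff A) (w : List A) : (δ + δ') w = δ w + δ' w := rfl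
@[simp] theorem sub_apply (δ δ' : Coeff A) (w : List A) : (δ - δ') w = δ w - δ' w := rfl
@[simp] theorem neg_apply (δ : Coeff A) (w : List A) : (-δ) w = -δ w := rfl
@[simp] theorem zero_apply (w : List A) : (0 : Coeff A) w = 0 := rfl
@[simp] theorem smul_apply (c : ℂ) (δ : Coeff A) (w : List A) : (c • δ) w = c * δ w := rfl

/-- The convolution product `⋆`: the sum over all ways of cutting the word in two. -/
instance : Mul (Coeff A) :=
  ⟨fun δ δ' w => ∑ j ∈ Finset.range (w.length + 1), δ (w.take j) * δ' (w.drop j)⟩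

/-- The unit for the convolution product. -/
instance : One (Coeff A) := ⟨fun w => if w.isEmpty then 1 else 0⟩

theorem mul_apply (δ δ' : Coeff A) (w : List A) :
    (δ * δ') w = ∑ j ∈ Finset.range (w.length + 1), δ (w.take j) * δ' (w.drop j) := rfl

@[simp] theorem one_nil : (1 : Coeff A) [] = 1 := rfl
@[simp] theorem one_cons (a : A) (w : List A) : (1 : Coeff A) (a :: w) = 0 := rfl

@[simp] theorem mul_nil (δ δ' : Coeff A) : (δ * δ') [] = δ [] * δ' [] := by
  simp [mul_apply]

/-- The family `w ↦ δ_{aw}`. -/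
def shift (a : A) (δ : Coeff A) : Coeff A := fun w => δ (a :: w)

theorem mul_cons (δ δ' : Coeff A) (a : A) (w : List A) :
    (δ * δ') (a :: w) = δ [] * δ' (a :: w) + (shift a δ * δ') w := by
  rw [mul_apply, List.length_cons, Finset.sum_range_succ', add_comm]
  rfl

protected theorem right_distrib' (δ δ' δ'' : Coeff A) : (δ + δ') * δ'' = δ * δ'' + δ' * δ'' := by
  ext w; simp [mul_apply, add_mul, Finset.sum_add_distrib]

protected theorem left_distrib' (δ δ' δ'' : Coeff A) : δ * (δ' + δ'') = δ * δ' + δ * δ'' := by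
  ext w; simp [mul_apply, mul_add, Finset.sum_add_distrib]

protected theorem smul_mul' (c : ℂ) (δ δ' : Coeff A) : (c • δ) * δ' = c • (δ * δ') := by
  ext w; simp [mul_apply, mul_assoc, Finset.mul_sum]

protected theorem zero_mul' (δ : Coeff A) : 0 * δ = 0 := by
  ext w; simp [mul_apply]

protected theorem mul_zero' (δ : Coeff A) : δ * 0 = 0 := by
  ext w; simp [mul_apply]

theorem shift_mul (a : A) (δ δ' : Coeff A) :
    shift a (δ * δ') = δ [] • shift a δ' + shift a δ * δ' := by
  ext w; exact mul_cons δ δ' a w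

protected theorem mul_assoc' (δ δ' δ'' : Coeff A) : δ * δ' * δ'' = δ * (δ' * δ'') := by
  ext w
  induction w generalizing δ with
  | nil => simp [mul_assoc]
  | cons a w ih =>
    rw [mul_cons, mul_cons, shift_mul, Coeff.right_distrib', add_apply, ih, Coeff.smul_mul',
      smul_apply, mul_cons, mul_nil]
    ring

protected theorem one_mul' (δ : Coeff A) : 1 * δ = δ := by
  ext w
  cases w with
  | nil => simp
  | cons a w =>
    have h : shift a (1 : Coeff A) = 0 := rfl
    rw [mul_cons, h, Coeff.zero_mul']; simp

protected theorem mul_one' (δ : Coeff A) : δ * 1 = δ := by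
  ext w
  induction w generalizing δ with
  | nil => simp
  | cons a w ih => rw [mul_cons, ih]; simp [shift]

instance : Ring (Coeff A) :=
  { (inferInstance : AddCommGroup (Coeff A)) with
    mul := (· * ·)
    one := 1
    mul_assoc := Coeff.mul_assoc'
    one_mul := Coeff.one_mul'
    mul_one := Coeff.mul_one'
    left_distrib := Coeff.left_distrib'
    right_distrib := Coeff.right_distrib'
    zero_mul := Coeff.zero_mul'
    mul_zero := Coeff.mul_zero' }

end Coeff

/-- The exponential `∑ βⁿ / n!` for the convolution product, computed word by word.
(If `β_∅ = 0`, only the terms with `n` at most the length of the word contribute.) -/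
def expStar {A : Type*} (β : Coeff A) : Coeff A :=
  fun w => ∑' n : ℕ, ((n.factorial : ℂ))⁻¹ * (β ^ n) w

/-! ### The shuffle group and its Lie algebra -/

/-- The shuffle product of two words, as a multiset of words. -/
def shuffle {A : Type*} : List A → List A → Multiset (List A)
  | [], w => {w}
  | a :: u, [] => {a :: u}
  | a :: u, b :: w =>
      (shuffle u (b :: w)).map (fun s => a :: s) + (shuffle (a :: u) w).map (fun s => b :: s)
  termination_by u w => u.length + w.length

/-- The group `𝒢` of the families that satisfy the shuffle relations. -/
def groupG (A : Type*) : Set (Coeff A) :=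
  {γ | γ [] = 1 ∧ ∀ w w' : List A, γ w * γ w' = ((shuffle w w').map fun s => γ s).sum}

/-- The Lie algebra `𝔤` of `𝒢`. -/
def lieG (A : Type*) : Set (Coeff A) :=
  {β | β [] = 0 ∧ ∀ w w' : List A, w ≠ [] → w' ≠ [] → ((shuffle w w').map fun s => β s).sum = 0}

/-! ### The operators attached to the eigenvalues `ν` -/

section Eigenvalues

variable {A : Type*} {d : ℕ} (ν : Fin d → A → ℂ)

/-- `ν^v_w = ∑_{ℓ in w} ∑_j v_j ν_{j,ℓ}`. -/
def nuWord (v : Fin d → ℂ) (w : List A) : ℂ :=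
  (w.map fun ℓ => ∑ j, v j * ν j ℓ).sum

/-- The diagonal operator `Ξ_v`. -/
def bigXi (v : Fin d → ℂ) (δ : Coeff A) : Coeff A := fun w => Complex.exp (nuWord ν v w) * δ w

/-- The diagonal operator `ξ_v`. -/
def xi (v : Fin d → ℂ) (δ : Coeff A) : Coeff A := fun w => nuWord ν v w * δ w

/-- The set `𝒱(v)` of the vectors `u` such that `ν^u_w = 0` whenever `ν^v_w = 0`. -/
def resonanceSpace (v : Fin d → ℂ) : Set (Fin d → ℂ) :=
  {u | ∀ w : List A, nuWord ν v w = 0 → nuWord ν u w = 0}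

/-- The product `(u, γ) ★ (v, δ) = (v + δ_∅ u, γ ⋆ Ξ_u δ)`. -/
def bigStar (p q : (Fin d → ℂ) × Coeff A) : (Fin d → ℂ) × Coeff A :=
  (q.1 + q.2 [] • p.1, p.2 * bigXi ν p.1 q.2)

/-- The bracket `[(v, β), (u, η)] = (0, ξ_v η - ξ_u β + [β, η])` of the extended Lie algebra,
whose elements are the pairs `(v, β)` with `v ∈ ℂ^d`, `β ∈ 𝔤`. -/
def extBracket (p q : (Fin d → ℂ) × Coeff A) : (Fin d → ℂ) × Coeff A :=
  (0, xi ν p.1 q.2 - xi ν q.1 p.2 + (p.2 * q.2 - q.2 * p.2))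

end Eigenvalues

/-! ### Formal series of smooth maps

A formal series of maps carries one commuting formal parameter `ε_ℓ` for each letter, which marks
the occurrences of `f_ℓ`. Hence a word series is graded by the number of occurrences of each letter
in a word; each homogeneous component is a finite sum, even for an infinite alphabet. -/

/-- Formal series `∑_m ε^m p_m` of points `p_m` of `ℂ^D`. -/
abbrev FormalPoint (A : Type*) (D : ℕ) := (A →₀ ℕ) → (Fin D → ℂ)

/-- Formal series `∑_m ε^m Φ_m(x)` of maps from `ℂ^D` to itself, with `Φ_m(x) = Φ x m`.
They serve as formal transformations and as formal vector fields. -/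
abbrev FormalMap (A : Type*) (D : ℕ) := (Fin D → ℂ) → FormalPoint A D

section Formal

variable {A : Type*} {D : ℕ}

/-- All the terms of the series are smooth. -/
def IsSmooth (Φ : FormalMap A D) : Prop := ∀ m, ContDiff ℂ (⊤ : ℕ∞) fun x => Φ x m

variable [DecidableEq A]

/-- A point of `ℂ^D`, seen as a formal series (with only the term of degree `0`). -/
def pointSeries (x : Fin D → ℂ) : FormalPoint A D := fun m => if m = 0 then x else 0

/-- A map, seen as a formal series of maps (with only the term of degree `0`). -/
def mapSeries (F : (Fin D → ℂ) → (Fin D → ℂ)) : FormalMap A D := fun x => pointSeries (F x)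

/-- The degree `b` term of the Taylor expansion of `F(p)`, `p = p_0 + ∑_{m ≠ 0} ε^m p_m`,
i.e. of `∑_k F^{(k)}(p_0)[h, …, h] / k!` with `h = ∑_{m ≠ 0} ε^m p_m`. -/
def taylorTerm (F : (Fin D → ℂ) → (Fin D → ℂ)) (p : FormalPoint A D) (b : A →₀ ℕ) : Fin D → ℂ :=
  ∑ k ∈ Finset.range (b.degree + 1), ((k.factorial : ℂ))⁻¹ •
    ∑ r ∈ (Finset.piAntidiag (Finset.univ : Finset (Fin k)) b).filter (fun r => ∀ i, r i ≠ 0),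
      iteratedFDeriv ℂ k F (p 0) (fun i => p (r i))

/-- Substitution of a formal point into a formal series of maps, `Φ(p) = ∑_a ε^a Φ_a(p)`. -/
def subst (Φ : FormalMap A D) (p : FormalPoint A D) : FormalPoint A D := fun m =>
  ∑ ab ∈ Finset.HasAntidiagonal.antidiagonal m, taylorTerm (fun x => Φ x ab.1) p ab.2

/-- The product `Φ'(x) V(x)` of the Jacobian matrix of `Φ` and the formal vector field `V`. -/
def jacobianMul (Φ V : FormalMap A D) : FormalMap A D := fun x m =>
  ∑ ab ∈ Finset.HasAntidiagonal.antidiagonal m, fderiv ℂ (fun y => Φ y ab.1) x (V x ab.2)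

/-- The Lie–Jacobi bracket `[V, W] = W' V - V' W` of formal vector fields. -/
def formalBracket (V W : FormalMap A D) : FormalMap A D := jacobianMul W V - jacobianMul V W

/-- `x = Φ(X)` is a formal change of variables: it is smooth and has a smooth formal inverse. -/
def IsChangeOfVariables (Φ : FormalMap A D) : Prop :=
  IsSmooth Φ ∧ ∃ Ψ : FormalMap A D, IsSmooth Ψ ∧
    ∀ p : FormalPoint A D, subst Ψ (subst Φ p) = p ∧ subst Φ (subst Ψ p) = p

/-- The change of variables `x = Φ(X)` turns the system `dx/dt = F(x)` into `dX/dt = G(X)`: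
`Φ'(X) G(X) = F(Φ(X))`. -/
def TransformsInto (Φ F G : FormalMap A D) : Prop :=
  IsChangeOfVariables Φ ∧ ∀ X, jacobianMul Φ G X = subst F (Φ X)

/-- The curve `X(t)` of formal points satisfies `dX/dt = F(X)` for `t ∈ J`. -/
def IsFormalSolution (F : FormalMap A D) (J : Set ℝ) (X : ℝ → FormalPoint A D) : Prop :=
  ∀ t ∈ J, ∀ m, HasDerivAt (fun s => X s m) (subst F (X t) m) t

/-- `Φ_t` is the solution flow of the formal system `dX/dt = F(X)`. -/
def IsFormalFlow (F : FormalMap A D) (Φ : ℝ → FormalMap A D) : Prop :=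
  (∀ t, IsSmooth (Φ t)) ∧ (∀ x, Φ 0 x = pointSeries x) ∧
    ∀ x, IsFormalSolution F Set.univ fun t => Φ t x

end Formal

/-! ### The perturbed systems, word series and extended word series -/

section Systems

variable {A : Type*} {d D : ℕ}

/-- `g^v = ∑_j v_j g_j`. -/
def gField (g : Fin d → (Fin D → ℂ) → (Fin D → ℂ)) (v : Fin d → ℂ) :
    (Fin D → ℂ) → (Fin D → ℂ) := fun x => ∑ j, v j • g j x

/-- The `g_j` are commuting smooth vector fields in `ℂ^D` and the `f_ℓ` are smooth vector fields
such that `[g_j, f_ℓ] = ν_{j,ℓ} f_ℓ`, where `[g, f] = f' g - g' f`. -/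
structure IsPerturbedSystem (ν : Fin d → A → ℂ) (g : Fin d → (Fin D → ℂ) → (Fin D → ℂ))
    (f : A → (Fin D → ℂ) → (Fin D → ℂ)) : Prop where
  smooth_g : ∀ j, ContDiff ℂ (⊤ : ℕ∞) (g j)
  smooth_f : ∀ ℓ, ContDiff ℂ (⊤ : ℕ∞) (f ℓ)
  commute : ∀ j k x, VectorField.lieBracket ℂ (g j) (g k) x = 0
  eigen : ∀ j ℓ x, VectorField.lieBracket ℂ (g j) (f ℓ) x = ν j ℓ • f ℓ x

/-- For each `v`, the maps `φ_{tv}`, `t` real, are the flow of `g^v`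
(so that `φ_v` is the flow at time `1`); the flows are smooth maps. -/
structure IsFlow (g : Fin d → (Fin D → ℂ) → (Fin D → ℂ))
    (φ : (Fin d → ℂ) → (Fin D → ℂ) → (Fin D → ℂ)) : Prop where
  smooth : ContDiff ℂ (⊤ : ℕ∞) fun p : (Fin d → ℂ) × (Fin D → ℂ) => φ p.1 p.2
  zero : ∀ x, φ 0 x = x
  deriv : ∀ v x (t : ℝ),
    HasDerivAt (fun s : ℝ => φ ((s : ℂ) • v) x) (gField g v (φ ((t : ℂ) • v) x)) t

/-- The word basis functions: `f_∅` is the identity and `f_{ℓw}(x) = f_w'(x) f_ℓ(x)`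
(in particular, `f_w` is the given `f_ℓ` if `w` consists of the single letter `ℓ`). -/
def wordFun (f : A → (Fin D → ℂ) → (Fin D → ℂ)) : List A → (Fin D → ℂ) → (Fin D → ℂ)
  | [] => fun x => x
  | ℓ :: w => fun x => fderiv ℂ (wordFun f w) x (f ℓ x)

variable [DecidableEq A]

/-- The word series `W_δ(x) = ∑_w δ_w f_w(x)`: its term of degree `m` is the sum over the words
in which each letter `ℓ` occurs exactly `m ℓ` times. -/
def wordSeries (f : A → (Fin D → ℂ) → (Fin D → ℂ)) (δ : Coeff A) : FormalMap A D := fun x m =>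
  ∑ w ∈ (Multiset.lists (Finsupp.toMultiset m)).toFinset, δ w • wordFun f w x

/-- The extended word series `φ_v(W_δ(x))`. -/
def extWordSeries (f : A → (Fin D → ℂ) → (Fin D → ℂ))
    (φ : (Fin d → ℂ) → (Fin D → ℂ) → (Fin D → ℂ)) (p : (Fin d → ℂ) × Coeff A) : FormalMap A D :=
  fun x => subst (mapSeries (φ p.1)) (wordSeries f p.2 x)

/-- The formal vector field `g^v(x) + W_β(x)`. -/
def extField (g : Fin d → (Fin D → ℂ) → (Fin D → ℂ)) (f : A → (Fin D → ℂ) → (Fin D → ℂ))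
    (p : (Fin d → ℂ) × Coeff A) : FormalMap A D :=
  mapSeries (gField g p.1) + wordSeries f p.2

end Systems

end WordSeries

end

noncomputable section

namespace WordSeries

/-! ### Noncommutative series with coefficients in a ring -/

/-! The proof has an algebraic half and an analytic half.

Algebra. The operator `ξ_v` is a diagonal derivation of `⋆`, and `κ · β = κ ⋆ β ⋆ κ⁻¹ - (ξ_v κ) ⋆
κ⁻¹` is the gauge action attached to it (`gaugeAction_mul`). Normalization proceeds by word length.
If `ξ_v β` vanishes up to length `N`, put `η_w = β_w / ν^v_w` on the nonresonant words (`ν^v_w ≠ 0`)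
of length `N + 1`. To this order, acting by `exp η` only subtracts `ξ_v η`, which cancels exactly
the nonresonant coefficients of that length (`exists_gauge_step`). Later steps leave shorter words
alone, so the products stabilize word by word and define `κ` (`exists_gauge`). Then `β̂` is
supported on resonant words, which gives all the commutation statements in the extended algebra. To
stay inside `𝒢` and `𝔤`, the shuffle product is dualized to a coproduct that is multiplicative for
`⋆` (`coprod_mul`): `𝒢` consists of its group-like elements and `𝔤` of its primitive ones
(`mem_groupG_iff`, `mem_lieG_iff`).

Analysis. Attach to each word the operator `E_w` with `E_{ℓw} F = (E_w F)' f_ℓ`, and put `E_δ = ∑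
δ_w E_w`. The Leibniz rule for `E_w` runs over the deshuffles of `w`, so `E_γ` is an algebra
homomorphism for `γ ∈ 𝒢` and `E_β` is a derivation for `β ∈ 𝔤`. By Hadamard's lemma a homomorphism
from smooth functions to power series is evaluation at a formal point (`eq_ev_of_hom`). Hence `E_γ F
= F ∘ W_γ` (`ev_wordSeries`), `W_δ ∘ W_γ = W_{γ⋆δ}` (`subst_wordSeries`), and `E_β` is
differentiation along `W_β` (`opSeries_eq_sum_pd`). Evaluation itself is controlled by its Euler
recursion on the degree (`euler_ev`), which replaces the combinatorics of Taylor expansions.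

The derivative along `g^v` satisfies `[g^v, E_w] = ν^v_w E_w` (`gDeriv_opWord`). Therefore `W_κ' g^v
= g^v ∘ W_κ + W_{ξ_v κ}`, and the conjugacy of the two systems reduces to `ξ_v κ + β̂ ⋆ κ = κ ⋆ β`,
the definition of `β̂`. Integrated along the flow, the commutator gives `E_w (F ∘ φ_{tv}) = exp(-t
ν^v_w) (E_w F) ∘ φ_{tv}` (`opWord_comp_flow`), so word series supported on resonant words commute
with `φ_{tv}`. Passing to the variable `φ_{-tv}(X)` then removes `g^v` from the normal form, and
what remains is solved by `W_{exp(tβ̂)}`. -/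

/-- Families indexed by words with values in `K`, with the convolution product. -/
def NCSeries (A K : Type*) : Type _ := List A → K

namespace NCSeries

variable {A K : Type*}

@[ext] theorem ext {P Q : NCSeries A K} (h : ∀ w, P w = Q w) : P = Q := funext h

variable [Ring K]

instance : AddCommGroup (NCSeries A K) := inferInstanceAs (AddCommGroup (List A → K))

@[simp] theorem add_apply (P Q : NCSeries A K) (w : List A) : (P + Q) w = P w + Q w := rfl
@[simp] theorem zero_apply (w : List A) : (0 : NCSeries A K) w = 0 := rfl

instance : Mul (NCSeries A K) :=
  ⟨fun P Q w => ∑ j ∈ Finset.range (w.length + 1), P (w.take j) * Q (w.drop j)⟩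

instance : One (NCSeries A K) := ⟨fun w => if w.isEmpty then 1 else 0⟩

theorem mul_apply (P Q : NCSeries A K) (w : List A) :
    (P * Q) w = ∑ j ∈ Finset.range (w.length + 1), P (w.take j) * Q (w.drop j) := rfl

@[simp] theorem one_nil : (1 : NCSeries A K) [] = 1 := rfl
@[simp] theorem one_cons (a : A) (w : List A) : (1 : NCSeries A K) (a :: w) = 0 := rfl

theorem mul_nil (P Q : NCSeries A K) : (P * Q) [] = P [] * Q [] := by
  simp [mul_apply]

/-- The family `w ↦ P_{aw}`. -/
def shift (a : A) (P : NCSeries A K) : NCSeries A K := fun w => P (a :: w)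

/-- Multiplication of all the coefficients by a constant, from the left. -/
def lmul (c : K) (P : NCSeries A K) : NCSeries A K := fun w => c * P w

theorem mul_cons (P Q : NCSeries A K) (a : A) (w : List A) :
    (P * Q) (a :: w) = P [] * Q (a :: w) + (shift a P * Q) w := by
  rw [mul_apply, List.length_cons, Finset.sum_range_succ', add_comm]
  rfl

protected theorem right_distrib' (P Q S : NCSeries A K) : (P + Q) * S = P * S + Q * S := by
  ext w; simp [mul_apply, add_mul, Finset.sum_add_distrib]

protected theorem left_distrib' (P Q S : NCSeries A K) : P * (Q + S) = P * Q + P * S := by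
  ext w; simp [mul_apply, mul_add, Finset.sum_add_distrib]

theorem lmul_mul (c : K) (P Q : NCSeries A K) : lmul c P * Q = lmul c (P * Q) := by
  ext w; simp [lmul, mul_apply, mul_assoc, Finset.mul_sum]

protected theorem zero_mul' (P : NCSeries A K) : 0 * P = 0 := by
  ext w; simp [mul_apply]

protected theorem mul_zero' (P : NCSeries A K) : P * 0 = 0 := by
  ext w; simp [mul_apply]

theorem shift_mul (a : A) (P Q : NCSeries A K) :
    shift a (P * Q) = lmul (P []) (shift a Q) + shift a P * Q := by
  ext w; exact mul_cons P Q a w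

protected theorem mul_assoc' (P Q S : NCSeries A K) : P * Q * S = P * (Q * S) := by
  ext w
  induction w generalizing P with
  | nil => simp [mul_nil, mul_assoc]
  | cons a w ih =>
    rw [mul_cons, mul_cons, shift_mul, NCSeries.right_distrib', add_apply, ih, lmul_mul,
      mul_cons, mul_nil, lmul, mul_add, mul_assoc, add_assoc]

protected theorem one_mul' (P : NCSeries A K) : 1 * P = P := by
  ext w
  cases w with
  | nil => simp [mul_nil]
  | cons a w =>
    have h : shift a (1 : NCSeries A K) = 0 := rfl
    rw [mul_cons, h, NCSeries.zero_mul']; simp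

protected theorem mul_one' (P : NCSeries A K) : P * 1 = P := by
  ext w
  induction w generalizing P with
  | nil => simp [mul_nil]
  | cons a w ih => rw [mul_cons, ih]; simp [shift]

instance : Ring (NCSeries A K) :=
  { (inferInstance : AddCommGroup (NCSeries A K)) with
    mul := (· * ·)
    one := 1
    mul_assoc := NCSeries.mul_assoc'
    one_mul := NCSeries.one_mul'
    mul_one := NCSeries.mul_one'
    left_distrib := NCSeries.left_distrib'
    right_distrib := NCSeries.right_distrib'
    zero_mul := NCSeries.zero_mul'
    mul_zero := NCSeries.mul_zero' }

end NCSeries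

/-! ### The coproduct dual to the shuffle product -/

section Coproduct

variable {A : Type*}

theorem shuffle_nil_left (w : List A) : shuffle [] w = {w} := by rw [shuffle]

theorem shuffle_nil_right (w : List A) : shuffle w [] = {w} := by
  cases w <;> rw [shuffle]

theorem shuffle_cons_cons (a b : A) (u w : List A) :
    shuffle (a :: u) (b :: w) = (shuffle u (b :: w)).map (fun s => a :: s) +
      (shuffle (a :: u) w).map (fun s => b :: s) := by rw [shuffle]

theorem perm_of_mem_shuffle : ∀ {w w' s : List A}, s ∈ shuffle w w' → s.Perm (w ++ w')
  | [], w', s, h => by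
    rw [shuffle_nil_left, Multiset.mem_singleton] at h
    simp [h]
  | a :: u, [], s, h => by
    rw [shuffle_nil_right, Multiset.mem_singleton] at h
    simp [h]
  | a :: u, b :: w, s, h => by
    rw [shuffle_cons_cons, Multiset.mem_add, Multiset.mem_map, Multiset.mem_map] at h
    rcases h with ⟨t, ht, rfl⟩ | ⟨t, ht, rfl⟩
    · exact (perm_of_mem_shuffle ht).cons a
    · exact ((perm_of_mem_shuffle ht).cons b).trans List.perm_middle.symm
  termination_by w w' => w.length + w'.length

theorem length_of_mem_shuffle {w w' s : List A} (h : s ∈ shuffle w w') :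
    s.length = w.length + w'.length := by
  simpa using (perm_of_mem_shuffle h).length_eq

/-- The family `(w, w') ↦ ∑_j δ_{w_j}`, where `∑_j w_j` is the shuffle product of `w`, `w'`. -/
def coprod (δ : Coeff A) : NCSeries A (Coeff A) :=
  fun w w' => ((shuffle w w').map fun s => δ s).sum

theorem coprod_nil_left (δ : Coeff A) (w : List A) : coprod δ [] w = δ w := by
  simp [coprod, shuffle_nil_left]

theorem coprod_nil_right (δ : Coeff A) (w : List A) : coprod δ w [] = δ w := by
  simp [coprod, shuffle_nil_right]

theorem coprod_cons_cons (δ : Coeff A) (a b : A) (u w : List A) :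
    coprod δ (a :: u) (b :: w) =
      coprod (Coeff.shift a δ) u (b :: w) + coprod (Coeff.shift b δ) (a :: u) w := by
  simp only [coprod, shuffle_cons_cons, Multiset.map_add, Multiset.map_map, Multiset.sum_add]
  rfl

theorem coprod_add (δ δ' : Coeff A) : coprod (δ + δ') = coprod δ + coprod δ' := by
  ext w w'
  exact Multiset.sum_map_add

theorem coprod_smul (c : ℂ) (δ : Coeff A) (w w' : List A) :
    coprod (c • δ) w w' = c * coprod δ w w' :=
  Multiset.sum_map_mul_left

/-- With `K = Coeff A` the ring `NCSeries A K` plays the role of a completed tensor square: families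
on pairs of words, where both words are cut independently. This is why `NCSeries` allows
noncommutative coefficients. -/
theorem NCSeries.mul_apply_apply (P Q : NCSeries A (Coeff A)) (w w' : List A) :
    (P * Q) w w' = ∑ i ∈ Finset.range (w.length + 1), ∑ j ∈ Finset.range (w'.length + 1),
      P (w.take i) (w'.take j) * Q (w.drop i) (w'.drop j) := by
  rw [NCSeries.mul_apply]
  have h : ∀ (s : Finset ℕ) (F : ℕ → Coeff A), (∑ i ∈ s, F i) w' = ∑ i ∈ s, F i w' := by
    intro s F
    induction s using Finset.cons_induction with
    | empty => rfl
    | cons a s ha ih => rw [Finset.sum_cons, Finset.sum_cons, Coeff.add_apply, ih]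
  rw [h]
  rfl

/-- Cutting a shuffle of `w` and `w'` in two amounts to cutting `w` and `w'` separately and
shuffling the left pieces and the right pieces. The recursion follows the first letter of the
shuffle. -/
theorem coprod_mul_apply : ∀ (w w' : List A) (δ δ' : Coeff A),
    coprod (δ * δ') w w' = (coprod δ * coprod δ') w w'
  | [], w', δ, δ' => by
    simp [NCSeries.mul_apply_apply, coprod_nil_left, Coeff.mul_apply]
  | a :: u, [], δ, δ' => by
    simp [NCSeries.mul_apply_apply, coprod_nil_right, Coeff.mul_apply]
  | a :: u, b :: w, δ, δ' => by
    have h1 := coprod_mul_apply u (b :: w) (Coeff.shift a δ) δ'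
    have h2 := coprod_mul_apply (a :: u) w (Coeff.shift b δ) δ'
    rw [coprod_cons_cons, Coeff.shift_mul, Coeff.shift_mul, coprod_add, coprod_add,
      NCSeries.add_apply, NCSeries.add_apply, Coeff.add_apply, Coeff.add_apply, h1, h2,
      coprod_smul, coprod_smul]
    -- The shuffles of the left pieces are sorted by their first letter: none if both pieces are
    -- empty, otherwise `a` (needs `i > 0`) or `b` (needs `j > 0`).
    have h3 : ∀ i j, coprod δ ((a :: u).take i) ((b :: w).take j) =
        (if i = 0 ∧ j = 0 then δ [] else 0) +
        (match i with
          | 0 => 0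
          | i + 1 => coprod (Coeff.shift a δ) (u.take i) ((b :: w).take j)) +
        (match j with
          | 0 => 0
          | j + 1 => coprod (Coeff.shift b δ) ((a :: u).take i) (w.take j)) := by
      intro i j
      rcases i with _ | i <;> rcases j with _ | j <;>
        simp [coprod_nil_left, coprod_nil_right, coprod_cons_cons, Coeff.shift]
    rw [NCSeries.mul_apply_apply (coprod δ)]
    simp only [h3, add_mul, Finset.sum_add_distrib]
    have e0 : ∑ i ∈ Finset.range ((a :: u).length + 1), ∑ j ∈ Finset.range ((b :: w).length + 1),
        (if i = 0 ∧ j = 0 then δ [] else 0) *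
          coprod δ' ((a :: u).drop i) ((b :: w).drop j) = δ [] * coprod δ' (a :: u) (b :: w) := by
      rw [Finset.sum_eq_single 0, Finset.sum_eq_single 0] <;> simp +contextual
    rw [e0, coprod_cons_cons, NCSeries.mul_apply_apply, NCSeries.mul_apply_apply]
    have e1 : ∀ (F : ℕ → ℕ → ℂ) (G : ℕ → ℕ → ℂ),
        ∑ i ∈ Finset.range ((a :: u).length + 1), ∑ j ∈ Finset.range ((b :: w).length + 1),
          (match i with
            | 0 => 0
            | i + 1 => F i j) * G i j =
        ∑ i ∈ Finset.range (u.length + 1), ∑ j ∈ Finset.range ((b :: w).length + 1),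
          F i j * G (i + 1) j := by
      intro F G
      rw [List.length_cons, Finset.sum_range_succ' _ (u.length + 1)]
      simp
    have e2 : ∀ (F : ℕ → ℕ → ℂ) (G : ℕ → ℕ → ℂ),
        ∑ i ∈ Finset.range ((a :: u).length + 1), ∑ j ∈ Finset.range ((b :: w).length + 1),
          (match j with
            | 0 => 0
            | j + 1 => F i j) * G i j =
        ∑ i ∈ Finset.range ((a :: u).length + 1), ∑ j ∈ Finset.range (w.length + 1),
          F i j * G i (j + 1) := by
      intro F G
      refine Finset.sum_congr rfl fun i _ => ?_
      rw [List.length_cons, Finset.sum_range_succ' _ (w.length + 1)]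
      simp
    have e1' := e1 (fun i j => coprod (Coeff.shift a δ) (u.take i) ((b :: w).take j))
      (fun i j => coprod δ' ((a :: u).drop i) ((b :: w).drop j))
    have e2' := e2 (fun i j => coprod (Coeff.shift b δ) ((a :: u).take i) (w.take j))
      (fun i j => coprod δ' ((a :: u).drop i) ((b :: w).drop j))
    simp only [List.drop_succ_cons] at e1' e2'
    linear_combination -e1' - e2'
  termination_by w w' => w.length + w'.length

end Coproduct

end WordSeries

end

noncomputable section

namespace WordSeries

/-! ### Group-like and primitive elements of the coproduct -/

section TensorFamilies

variable {A : Type*}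

theorem coprod_apply (δ : Coeff A) (w w' : List A) :
    coprod δ w w' = ((shuffle w w').map fun s => δ s).sum := rfl

theorem coprod_mul (δ δ' : Coeff A) : coprod (δ * δ') = coprod δ * coprod δ' := by
  ext w w'
  exact coprod_mul_apply w w' _ _

/-- The family `(w, w') ↦ δ_w δ'_{w'}`. -/
def tens (δ δ' : Coeff A) : NCSeries A (Coeff A) := fun w w' => δ w * δ' w'

theorem tens_mul_tens (α β γ δ : Coeff A) : tens α β * tens γ δ = tens (α * γ) (β * δ) := by
  ext w w'
  rw [NCSeries.mul_apply_apply, tens, Coeff.mul_apply, Coeff.mul_apply, Finset.sum_mul_sum]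
  refine Finset.sum_congr rfl fun i _ => Finset.sum_congr rfl fun j _ => ?_
  simp only [tens]
  ring

theorem tens_one_one : tens (1 : Coeff A) 1 = 1 := by
  ext w w'
  cases w with
  | nil => exact one_mul _
  | cons a w => exact zero_mul _

theorem tens_pow (α β : Coeff A) (n : ℕ) : tens α β ^ n = tens (α ^ n) (β ^ n) := by
  induction n with
  | zero => simp [tens_one_one]
  | succ n ih => rw [pow_succ, ih, tens_mul_tens, pow_succ, pow_succ]

theorem coprod_one : coprod (1 : Coeff A) = 1 := by
  ext w w'
  rcases w with _ | ⟨a, w⟩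
  · rw [coprod_nil_left]; rfl
  · rcases w' with _ | ⟨b, w'⟩
    · rw [coprod_nil_right]; rfl
    · have h : ∀ a : A, coprod (Coeff.shift a (1 : Coeff A)) = 0 := by
        intro a
        ext w w'
        simp only [coprod, Coeff.shift, Coeff.one_cons, Multiset.map_const', Multiset.sum_replicate,
          smul_zero]
        rfl
      rw [coprod_cons_cons, h, h]
      exact add_zero _

theorem coprod_pow (δ : Coeff A) (n : ℕ) : coprod (δ ^ n) = coprod δ ^ n := by
  induction n with
  | zero => simp [coprod_one]
  | succ n ih => rw [pow_succ, coprod_mul, ih, pow_succ]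

theorem mem_groupG_iff {γ : Coeff A} : γ ∈ groupG A ↔ γ [] = 1 ∧ coprod γ = tens γ γ := by
  refine and_congr_right fun _ => ⟨fun h => ?_, fun h w w' => ?_⟩
  · ext w w'
    exact (h w w').symm
  · exact (congrFun (congrFun h w) w').symm

/-- The relations for two nonempty words and the condition on the empty word merge into primitivity,
which can be handled by ring identities between `coprod` and `tens`. -/
theorem mem_lieG_iff {β : Coeff A} : β ∈ lieG A ↔ coprod β = tens β 1 + tens 1 β := by
  constructor
  · rintro ⟨h0, h⟩
    ext w w'
    show coprod β w w' = β w * (1 : Coeff A) w' + (1 : Coeff A) w * β w'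
    rcases w with _ | ⟨a, w⟩
    · rw [coprod_nil_left, h0]; simp
    · rcases w' with _ | ⟨b, w'⟩
      · rw [coprod_nil_right, h0]; simp
      · have := h (a :: w) (b :: w') (by simp) (by simp)
        rw [← coprod_apply] at this
        simp [this]
  · intro h
    have h' : ∀ w w', coprod β w w' = β w * (1 : Coeff A) w' + (1 : Coeff A) w * β w' :=
      fun w w' => congrFun (congrFun h w) w'
    refine ⟨?_, fun w w' hw hw' => ?_⟩
    -- At the pair of empty words primitivity reads `β_∅ = 2 β_∅`.
    · have := h' [] []
      rw [coprod_nil_left] at this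
      simpa using this
    · obtain ⟨a, w, rfl⟩ := List.exists_cons_of_ne_nil hw
      obtain ⟨b, w', rfl⟩ := List.exists_cons_of_ne_nil hw'
      rw [← coprod_apply, h']
      simp

theorem one_mem_groupG : (1 : Coeff A) ∈ groupG A :=
  mem_groupG_iff.2 ⟨rfl, by rw [coprod_one, tens_one_one]⟩

theorem mul_mem_groupG {γ γ' : Coeff A} (h : γ ∈ groupG A) (h' : γ' ∈ groupG A) :
    γ * γ' ∈ groupG A := by
  rw [mem_groupG_iff] at *
  exact ⟨by simp [h.1, h'.1], by rw [coprod_mul, h.2, h'.2, tens_mul_tens]⟩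

theorem inv_mem_groupG {κ : (Coeff A)ˣ} (h : (κ : Coeff A) ∈ groupG A) :
    ((κ⁻¹ : (Coeff A)ˣ) : Coeff A) ∈ groupG A := by
  rw [mem_groupG_iff] at *
  constructor
  · have := congrFun κ.mul_inv []
    rw [Coeff.mul_nil, h.1, one_mul] at this
    exact this
  -- Both `coprod κ⁻¹` and `tens κ⁻¹ κ⁻¹` invert `coprod κ = tens κ κ`, one from each side.
  · refine left_inv_eq_right_inv (a := coprod (κ : Coeff A)) ?_ ?_
    · rw [← coprod_mul, κ.inv_mul, coprod_one]
    · rw [h.2, tens_mul_tens, κ.mul_inv, tens_one_one]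

theorem conj_mem_lieG {κ : (Coeff A)ˣ} {β : Coeff A} (h : (κ : Coeff A) ∈ groupG A)
    (hβ : β ∈ lieG A) : κ * β * (κ⁻¹ : (Coeff A)ˣ) ∈ lieG A := by
  have h' := (mem_groupG_iff.1 (inv_mem_groupG h)).2
  rw [mem_groupG_iff] at h
  rw [mem_lieG_iff] at *
  rw [coprod_mul, coprod_mul, h.2, h', hβ, mul_add, add_mul]
  simp only [tens_mul_tens, mul_one, κ.mul_inv]

theorem sub_mem_lieG {β η : Coeff A} (hβ : β ∈ lieG A) (hη : η ∈ lieG A) : β - η ∈ lieG A := by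
  refine ⟨by simp [hβ.1, hη.1], fun w w' hw hw' => ?_⟩
  exact (Multiset.sum_map_sub (m := shuffle w w')).trans
    ((congrArg₂ _ (hβ.2 w w' hw hw') (hη.2 w w' hw hw')).trans (sub_zero 0))

theorem smul_mem_lieG {β : Coeff A} (c : ℂ) (hβ : β ∈ lieG A) : c • β ∈ lieG A := by
  refine ⟨by simp [hβ.1], fun w w' hw hw' => ?_⟩
  exact (Multiset.sum_map_mul_left (s := shuffle w w')).trans
    ((congrArg _ (hβ.2 w w' hw hw')).trans (mul_zero c))

end TensorFamilies

/-! ### The diagonal operators -/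

section Diagonal

variable {A : Type*} {d : ℕ} (ν : Fin d → A → ℂ)

theorem nuWord_append (v : Fin d → ℂ) (w w' : List A) :
    nuWord ν v (w ++ w') = nuWord ν v w + nuWord ν v w' := by
  simp [nuWord]

theorem nuWord_perm (v : Fin d → ℂ) {w w' : List A} (h : w.Perm w') :
    nuWord ν v w = nuWord ν v w' :=
  (h.map _).sum_eq

theorem xi_mul (v : Fin d → ℂ) (δ δ' : Coeff A) :
    xi ν v (δ * δ') = xi ν v δ * δ' + δ * xi ν v δ' := by
  ext w
  simp only [xi, Coeff.mul_apply, Coeff.add_apply, Finset.mul_sum, ← Finset.sum_add_distrib]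
  refine Finset.sum_congr rfl fun j _ => ?_
  conv_lhs => rw [← List.take_append_drop j w, nuWord_append, List.take_append_drop]
  ring

theorem xi_one (v : Fin d → ℂ) : xi ν v (1 : Coeff A) = 0 := by
  ext w
  cases w <;> simp [xi, nuWord]

theorem xi_pow_eq_zero {v : Fin d → ℂ} {β : Coeff A} (h : xi ν v β = 0) (n : ℕ) :
    xi ν v (β ^ n) = 0 := by
  induction n with
  | zero => simp [xi_one]
  | succ n ih => rw [pow_succ, xi_mul, ih, h, zero_mul, mul_zero, add_zero]

/-- All the words in a shuffle of `w` and `w'` are rearrangements of `w ++ w'`, so a multiplier that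
ignores the order of the letters comes out of the sum. -/
theorem coprod_diag (c : List A → ℂ) (hc : ∀ {w w'}, w.Perm w' → c w = c w') (δ : Coeff A)
    (w w' : List A) : coprod (fun s => c s * δ s) w w' = c (w ++ w') * coprod δ w w' := by
  refine Eq.trans (congrArg Multiset.sum (Multiset.map_congr rfl fun s hs => ?_))
    (Multiset.sum_map_mul_left (s := shuffle w w'))
  exact congrArg (· * δ s) (hc (perm_of_mem_shuffle hs))

theorem diag_mem_lieG (c : List A → ℂ) (hc : ∀ {w w'}, w.Perm w' → c w = c w') {β : Coeff A}
    (hβ : β ∈ lieG A) : (fun s => c s * β s : Coeff A) ∈ lieG A := by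
  refine ⟨by simp [hβ.1], fun w w' hw hw' => ?_⟩
  refine (coprod_diag c hc β w w').trans ?_
  rw [coprod_apply, hβ.2 w w' hw hw', mul_zero]

/-- A logarithmic derivative: since `ν^v` is additive under concatenation, `ξ_v` acts on the
group-like `κ` by the Leibniz rule `ξ_v κ ⊗ κ + κ ⊗ ξ_v κ`, and multiplying by `κ⁻¹ ⊗ κ⁻¹` leaves a
primitive element. -/
theorem xi_mul_inv_mem_lieG (v : Fin d → ℂ) {κ : (Coeff A)ˣ} (h : (κ : Coeff A) ∈ groupG A) :
    xi ν v κ * (κ⁻¹ : (Coeff A)ˣ) ∈ lieG A := by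
  have h' := (mem_groupG_iff.1 (inv_mem_groupG h)).2
  rw [mem_groupG_iff] at h
  rw [mem_lieG_iff] at *
  have e : coprod (xi ν v κ) = tens (xi ν v κ) κ + tens κ (xi ν v κ) := by
    ext w w'
    show coprod (fun s => nuWord ν v s * (κ : Coeff A) s) w w' =
      nuWord ν v w * (κ : Coeff A) w * (κ : Coeff A) w' +
        (κ : Coeff A) w * (nuWord ν v w' * (κ : Coeff A) w')
    rw [coprod_diag _ (nuWord_perm ν v), h.2, nuWord_append, tens]
    ring
  rw [coprod_mul, e, h', add_mul]
  simp only [tens_mul_tens, κ.mul_inv]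

end Diagonal

/-! ### Truncation at a given word length -/

section Truncation

variable {A : Type*}

/-- The two families agree on all the words of length at most `N`. -/
def EqUpTo (N : ℕ) (δ δ' : Coeff A) : Prop := ∀ w : List A, w.length ≤ N → δ w = δ' w

theorem EqUpTo.refl (N : ℕ) (δ : Coeff A) : EqUpTo N δ δ := fun _ _ => rfl

theorem EqUpTo.symm {N : ℕ} {δ δ' : Coeff A} (h : EqUpTo N δ δ') : EqUpTo N δ' δ :=
  fun w hw => (h w hw).symm

theorem EqUpTo.trans {N : ℕ} {δ δ' δ'' : Coeff A} (h : EqUpTo N δ δ') (h' : EqUpTo N δ' δ'') :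
    EqUpTo N δ δ'' := fun w hw => (h w hw).trans (h' w hw)

theorem EqUpTo.mono {M N : ℕ} (hMN : M ≤ N) {δ δ' : Coeff A} (h : EqUpTo N δ δ') :
    EqUpTo M δ δ' := fun w hw => h w (hw.trans hMN)

theorem EqUpTo.mul {N : ℕ} {α β γ δ : Coeff A} (h : EqUpTo N α β) (h' : EqUpTo N γ δ) :
    EqUpTo N (α * γ) (β * δ) := by
  intro w hw
  rw [Coeff.mul_apply, Coeff.mul_apply]
  refine Finset.sum_congr rfl fun j _ => ?_
  rw [h _ (by simp; omega), h' _ (by simp; omega)]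

theorem EqUpTo.sub {N : ℕ} {α β γ δ : Coeff A} (h : EqUpTo N α β) (h' : EqUpTo N γ δ) :
    EqUpTo N (α - γ) (β - δ) := fun w hw => by
  rw [Coeff.sub_apply, Coeff.sub_apply, h w hw, h' w hw]

theorem EqUpTo.inv {N : ℕ} {κ κ' : (Coeff A)ˣ} (h : EqUpTo N (κ : Coeff A) κ') :
    EqUpTo N ((κ⁻¹ : (Coeff A)ˣ) : Coeff A) (κ'⁻¹ : (Coeff A)ˣ) := by
  have h1 := ((EqUpTo.refl N ((κ⁻¹ : (Coeff A)ˣ) : Coeff A)).mul h).mul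
    (EqUpTo.refl N ((κ'⁻¹ : (Coeff A)ˣ) : Coeff A))
  rw [κ.inv_mul, one_mul, mul_assoc, κ'.mul_inv, mul_one] at h1
  exact h1.symm

theorem eq_of_forall_eqUpTo {δ δ' : Coeff A} (h : ∀ N, EqUpTo N δ δ') : δ = δ' := by
  ext w
  exact h w.length w le_rfl

/-- Each of the `n` factors must take at least one letter of the word. All infinite sums of powers
below are finite on each word for this reason. -/
theorem pow_apply_eq_zero {δ : Coeff A} (h : δ [] = 0) {n : ℕ} :
    ∀ {w : List A}, w.length < n → (δ ^ n) w = 0 := by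
  induction n with
  | zero => intro w hw; omega
  | succ n ih =>
    intro w hw
    rw [pow_succ', Coeff.mul_apply]
    refine Finset.sum_eq_zero fun j hj => ?_
    rcases j with _ | j
    · simp [h]
    · rcases w with _ | ⟨a, w⟩
      · simp [h]
      · rw [ih (by simp at hw ⊢; omega), mul_zero]

theorem Coeff.sum_apply {ι : Type*} (s : Finset ι) (F : ι → Coeff A) (w : List A) :
    (∑ i ∈ s, F i) w = ∑ i ∈ s, F i w := by
  induction s using Finset.cons_induction with
  | empty => rfl
  | cons a s ha ih => rw [Finset.sum_cons, Finset.sum_cons, Coeff.add_apply, ih]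

/-- A family with `δ_∅ = 1` is invertible for the convolution product. -/
theorem exists_unit {δ : Coeff A} (h : δ [] = 1) : ∃ κ : (Coeff A)ˣ, (κ : Coeff A) = δ := by
  have h0 : (1 - δ) [] = 0 := by simp [h]
  -- The inverse is the geometric series in `1 - δ`; on a word only the powers up to its length
  -- contribute.
  let S : ℕ → Coeff A := fun N => ∑ n ∈ Finset.range (N + 1), (1 - δ) ^ n
  let η : Coeff A := fun w => S w.length w
  have hS : ∀ N, EqUpTo N η (S N) := by
    intro N w hw
    simp only [η, S, Coeff.sum_apply]
    refine Finset.sum_subset (fun n hn => ?_) fun n _ hn => ?_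
    · simp at hn ⊢; omega
    · exact pow_apply_eq_zero h0 (by simp at hn; omega)
  have hpow : ∀ N, EqUpTo N (1 - (1 - δ) ^ (N + 1)) 1 := fun N w hw => by
    rw [Coeff.sub_apply, pow_apply_eq_zero h0 (by omega), sub_zero]
  have e1 : δ * η = 1 := eq_of_forall_eqUpTo fun N => by
    refine ((EqUpTo.refl N δ).mul (hS N)).trans ?_
    have := mul_neg_geom_sum (1 - δ) (N + 1)
    rw [sub_sub_cancel] at this
    simpa only [S, this] using hpow N
  have e2 : η * δ = 1 := eq_of_forall_eqUpTo fun N => by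
    refine ((hS N).mul (EqUpTo.refl N δ)).trans ?_
    have := geom_sum_mul_neg (1 - δ) (N + 1)
    rw [sub_sub_cancel] at this
    simpa only [S, this] using hpow N
  exact ⟨⟨δ, η, e1, e2⟩, rfl⟩

/-! ### The exponential -/

theorem expStar_eqUpTo {β : Coeff A} (h : β [] = 0) (N : ℕ) :
    EqUpTo N (expStar β) (∑ n ∈ Finset.range (N + 1), ((n.factorial : ℂ))⁻¹ • β ^ n) := by
  intro w hw
  rw [Coeff.sum_apply, expStar]
  refine tsum_eq_sum fun n hn => ?_
  rw [pow_apply_eq_zero h (by simp at hn; omega), mul_zero]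

theorem expStar_nil {β : Coeff A} (h : β [] = 0) : expStar β [] = 1 := by
  rw [expStar_eqUpTo h 0 [] le_rfl]
  simp [Coeff.sum_apply]

theorem summable_expStar {β : Coeff A} (h : β [] = 0) (w : List A) :
    Summable fun n : ℕ => ‖((n.factorial : ℂ))⁻¹ * (β ^ n) w‖ :=
  summable_of_ne_finset_zero (s := Finset.range (w.length + 1)) fun n hn => by
    rw [pow_apply_eq_zero h (by simp at hn; omega), mul_zero, norm_zero]

theorem NCSeries.sum_apply {K ι : Type*} [Ring K] (s : Finset ι) (F : ι → NCSeries A K)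
    (w : List A) : (∑ i ∈ s, F i) w = ∑ i ∈ s, F i w := by
  induction s using Finset.cons_induction with
  | empty => rfl
  | cons a s ha ih => rw [Finset.sum_cons, Finset.sum_cons, NCSeries.add_apply, ih]

/-- The binomial theorem for the commuting elements `β ⊗ 1` and `1 ⊗ β`, whose sum is the coproduct
of `β`. -/
theorem coprod_pow_of_mem_lieG {β : Coeff A} (h : β ∈ lieG A) (n : ℕ) (w w' : List A) :
    ((n.factorial : ℂ))⁻¹ * coprod (β ^ n) w w' = ∑ kl ∈ Finset.HasAntidiagonal.antidiagonal n,
      (((kl.1.factorial : ℂ))⁻¹ * (β ^ kl.1) w) * (((kl.2.factorial : ℂ))⁻¹ * (β ^ kl.2) w') := by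
  have hc : Commute (tens β 1) (tens 1 β) := by
    show _ = _
    rw [tens_mul_tens, tens_mul_tens, one_mul, mul_one]
  rw [coprod_pow, mem_lieG_iff.1 h, hc.add_pow', NCSeries.sum_apply, Coeff.sum_apply,
    Finset.mul_sum]
  refine Finset.sum_congr rfl fun kl hkl => ?_
  have e : ∀ (k : ℕ) (P : NCSeries A (Coeff A)), (k • P) w w' = k * P w w' := by
    intro k P
    induction k with
    | zero => simp
    | succ k ih =>
      rw [succ_nsmul, NCSeries.add_apply, Coeff.add_apply, ih]
      push_cast
      ring
  rw [tens_pow, tens_pow, tens_mul_tens, one_pow, one_pow, mul_one, one_mul, e, tens]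
  have hn : (n.factorial : ℂ) = n.choose kl.1 * kl.1.factorial * kl.2.factorial := by
    have := Finset.HasAntidiagonal.mem_antidiagonal.1 hkl
    rw [← this]
    rw [Nat.choose_symm_add]
    exact_mod_cast (Nat.add_choose_mul_factorial_mul_factorial kl.1 kl.2).symm
  have h0 : (n.choose kl.1 : ℂ) ≠ 0 := by
    have := Finset.HasAntidiagonal.mem_antidiagonal.1 hkl
    exact_mod_cast (Nat.choose_pos (by omega)).ne'
  have h1 : (kl.1.factorial : ℂ) ≠ 0 := by exact_mod_cast kl.1.factorial_ne_zero
  have h2 : (kl.2.factorial : ℂ) ≠ 0 := by exact_mod_cast kl.2.factorial_ne_zero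
  rw [hn]
  field_simp

/-- This is `exp(β ⊗ 1 + 1 ⊗ β) = exp β ⊗ exp β`, obtained by comparing the binomial formula with
the Cauchy product of the two exponential series. -/
theorem expStar_mem_groupG {β : Coeff A} (h : β ∈ lieG A) : expStar β ∈ groupG A := by
  refine ⟨expStar_nil h.1, fun w w' => ?_⟩
  have hs : ∀ w : List A, Summable fun n : ℕ => ((n.factorial : ℂ))⁻¹ * (β ^ n) w :=
    fun w => (summable_expStar h.1 w).of_norm
  have e : ∀ M : Multiset (List A), (M.map fun s => expStar β s).sum =
      ∑' n : ℕ, ((n.factorial : ℂ))⁻¹ * (M.map fun s => (β ^ n) s).sum ∧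
      Summable fun n : ℕ => ((n.factorial : ℂ))⁻¹ * (M.map fun s => (β ^ n) s).sum := by
    intro M
    induction M using Multiset.induction with
    | empty => simp [summable_zero]
    | cons s M ih =>
      simp only [Multiset.map_cons, Multiset.sum_cons, mul_add]
      exact ⟨by rw [ih.1, (hs s).tsum_add ih.2]; rfl, (hs s).add ih.2⟩
  rw [(e _).1]
  have := tsum_mul_tsum_eq_tsum_sum_antidiagonal_of_summable_norm
    (summable_expStar h.1 w) (summable_expStar h.1 w')
  refine this.trans (tsum_congr fun n => ?_)
  exact (coprod_pow_of_mem_lieG h n w w').symm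

theorem xi_expStar {d : ℕ} (ν : Fin d → A → ℂ) {v : Fin d → ℂ} {β : Coeff A}
    (h : xi ν v β = 0) : xi ν v (expStar β) = 0 := by
  ext w
  show nuWord ν v w * expStar β w = 0
  rw [expStar, ← tsum_mul_left]
  convert tsum_zero with n
  have : nuWord ν v w * (β ^ n) w = 0 := congrFun (xi_pow_eq_zero ν h n) w
  linear_combination ((n.factorial : ℂ))⁻¹ * this

theorem smul_pow_coeff (c : ℂ) (β : Coeff A) (n : ℕ) : (c • β) ^ n = c ^ n • β ^ n := by
  induction n with
  | zero => simp
  | succ n ih =>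
    rw [pow_succ, ih]
    ext w
    simp only [Coeff.mul_apply, Coeff.smul_apply, pow_succ, Finset.mul_sum]
    exact Finset.sum_congr rfl fun j _ => by ring

theorem hasDerivAt_expStar {β : Coeff A} (h : β [] = 0) (w : List A) (t : ℝ) :
    HasDerivAt (fun s : ℝ => expStar ((s : ℂ) • β) w) ((β * expStar ((t : ℂ) • β)) w) t := by
  have h0 : ∀ c : ℂ, (c • β) [] = 0 := fun c => by simp [h]
  have e1 : (fun s : ℝ => expStar ((s : ℂ) • β) w) = fun s : ℝ =>
      ∑ n ∈ Finset.range (w.length + 1), ((n.factorial : ℂ))⁻¹ * ((s : ℂ) ^ n * (β ^ n) w) := by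
    funext s
    rw [expStar_eqUpTo (h0 s) w.length w le_rfl, Coeff.sum_apply]
    simp only [smul_pow_coeff, Coeff.smul_apply]
  have e2 : (β * expStar ((t : ℂ) • β)) w = ∑ n ∈ Finset.range (w.length + 1),
      ((n.factorial : ℂ))⁻¹ * ((n * (t : ℂ) ^ (n - 1) * 1) * (β ^ n) w) := by
    rw [((EqUpTo.refl w.length β).mul (expStar_eqUpTo (h0 t) w.length)) w le_rfl, Finset.mul_sum,
      Coeff.sum_apply, Finset.sum_range_succ, Finset.sum_range_succ']
    have hm : ∀ (c c' : ℂ) (δ : Coeff A), (β * (c • c' • δ)) w = c * (c' * (β * δ) w) := by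
      intro c c' δ
      simp only [Coeff.mul_apply, Coeff.smul_apply, Finset.mul_sum]
      exact Finset.sum_congr rfl fun j _ => by ring
    simp only [smul_pow_coeff, hm, ← pow_succ']
    -- The two sums match after a shift: on the left the top term is a multiple of `β ^ (w.length +
    -- 1)`, which vanishes on `w`; on the right the term `n = 0` has derivative `0`.
    rw [pow_apply_eq_zero h (Nat.lt_succ_self _)]
    simp only [mul_zero, add_zero, Nat.cast_zero, zero_mul]
    refine Finset.sum_congr rfl fun n _ => ?_
    have h1 : (n.factorial : ℂ) ≠ 0 := by exact_mod_cast n.factorial_ne_zero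
    have h2 : ((n : ℂ) + 1) ≠ 0 := by exact_mod_cast n.succ_ne_zero
    rw [Nat.factorial_succ, Nat.add_sub_cancel]
    push_cast
    field_simp
  rw [e1, e2]
  refine HasDerivAt.fun_sum fun n _ => ?_
  exact (((Complex.ofRealCLM.hasDerivAt (x := t)).pow n).mul_const _).const_mul _

theorem commute_expStar {β : Coeff A} (h : β [] = 0) (c : ℂ) :
    β * expStar (c • β) = expStar (c • β) * β := by
  have h0 : (c • β) [] = 0 := by simp [h]
  refine eq_of_forall_eqUpTo fun N => ((EqUpTo.refl N β).mul (expStar_eqUpTo h0 N)).trans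
    (EqUpTo.trans ?_ ((expStar_eqUpTo h0 N).mul (EqUpTo.refl N β)).symm)
  rw [Finset.mul_sum, Finset.sum_mul]
  have e : ∀ (n : ℕ) (c' : ℂ), β * (c' • (c • β) ^ n) = (c' • (c • β) ^ n) * β := by
    intro n c'
    rw [smul_pow_coeff, Coeff.smul_mul', Coeff.smul_mul', ← pow_succ, pow_succ']
    ext w
    simp only [Coeff.mul_apply, Coeff.smul_apply, Finset.mul_sum]
    exact Finset.sum_congr rfl fun j _ => by ring
  simp only [e]
  exact EqUpTo.refl _ _

theorem expStar_zero_smul (β : Coeff A) : expStar ((0 : ℂ) • β) = 1 := by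
  rw [zero_smul]
  ext w
  rw [expStar, tsum_eq_single 0]
  · simp
  · intro n hn
    simp [zero_pow hn]

theorem hasDerivAt_expStar_neg {β : Coeff A} (h : β [] = 0) (w : List A) (t : ℝ) :
    HasDerivAt (fun s : ℝ => expStar (((-s : ℝ) : ℂ) • β) w)
      (-(β * expStar (((-t : ℝ) : ℂ) • β)) w) t := by
  have := (hasDerivAt_expStar h w (-t)).scomp t (hasDerivAt_neg t)
  rw [neg_one_smul] at this
  exact this

/-- The product has derivative `0` in `t`, because `β` commutes with its exponentials, and it equals
`1` at `t = 0`. -/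
theorem expStar_mul_expStar_neg {β : Coeff A} (h : β [] = 0) (t : ℝ) :
    expStar (((-t : ℝ) : ℂ) • β) * expStar ((t : ℂ) • β) = 1 := by
  ext w
  have hd : ∀ s : ℝ, HasDerivAt (fun s : ℝ =>
      (expStar (((-s : ℝ) : ℂ) • β) * expStar ((s : ℂ) • β)) w) 0 s := by
    intro s
    have e : (0 : ℂ) = ∑ j ∈ Finset.range (w.length + 1),
        (-(β * expStar (((-s : ℝ) : ℂ) • β)) (w.take j) * expStar ((s : ℂ) • β) (w.drop j) +
        expStar (((-s : ℝ) : ℂ) • β) (w.take j) * (β * expStar ((s : ℂ) • β)) (w.drop j)) := by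
      rw [Finset.sum_add_distrib]
      simp only [neg_mul, Finset.sum_neg_distrib]
      rw [← Coeff.mul_apply, ← Coeff.mul_apply, commute_expStar h, mul_assoc, neg_add_cancel]
    rw [e]
    simp only [Coeff.mul_apply _ _ w]
    exact HasDerivAt.fun_sum fun j _ =>
      (hasDerivAt_expStar_neg h _ s).mul (hasDerivAt_expStar h _ s)
  have := is_const_of_deriv_eq_zero (fun s => (hd s).differentiableAt) (fun s => (hd s).deriv) t 0
  rw [this, neg_zero, Complex.ofReal_zero, expStar_zero_smul, one_mul]

end Truncation

end WordSeries

end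

noncomputable section

namespace WordSeries

/-! ### The normal form in the extended Lie algebra -/

section NormalForm

variable {A : Type*} {d : ℕ} (ν : Fin d → A → ℂ)

/-- The family `κ ⋆ β ⋆ κ⁻¹ - (ξ_v κ) ⋆ κ⁻¹`. -/
def gaugeAction (v : Fin d → ℂ) (κ : (Coeff A)ˣ) (β : Coeff A) : Coeff A :=
  κ * β * (κ⁻¹ : (Coeff A)ˣ) - xi ν v κ * (κ⁻¹ : (Coeff A)ˣ)

theorem gaugeAction_mem_lieG (v : Fin d → ℂ) {κ : (Coeff A)ˣ} {β : Coeff A}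
    (hκ : (κ : Coeff A) ∈ groupG A) (hβ : β ∈ lieG A) : gaugeAction ν v κ β ∈ lieG A :=
  sub_mem_lieG (conj_mem_lieG hκ hβ) (xi_mul_inv_mem_lieG ν v hκ)

/-- Successive normalizations compose to one gauge transformation; the derivation rule for `ξ_v (e ⋆
κ)` is what makes the inhomogeneous terms agree. -/
theorem gaugeAction_mul (v : Fin d → ℂ) (e κ : (Coeff A)ˣ) (β : Coeff A) :
    gaugeAction ν v (e * κ) β = gaugeAction ν v e (gaugeAction ν v κ β) := by
  have h := e.mul_inv
  have h' := κ.mul_inv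
  simp only [gaugeAction, mul_inv_rev, Units.val_mul, xi_mul, add_mul, mul_sub, sub_mul]
  rw [show xi ν v ↑e * ↑κ * (↑κ⁻¹ * ↑e⁻¹) = xi ν v ↑e * (↑κ * ↑κ⁻¹) * (↑e⁻¹ : Coeff A) by
    simp only [mul_assoc], h', mul_one]
  simp only [mul_assoc]
  abel

theorem EqUpTo.xi {N : ℕ} (v : Fin d → ℂ) {δ δ' : Coeff A} (h : EqUpTo N δ δ') :
    EqUpTo N (xi ν v δ) (xi ν v δ') := fun w hw => by
  simp only [WordSeries.xi, h w hw]

theorem EqUpTo.gaugeAction {N : ℕ} (v : Fin d → ℂ) {κ κ' : (Coeff A)ˣ} (β : Coeff A)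
    (h : EqUpTo N (κ : Coeff A) κ') :
    EqUpTo N (gaugeAction ν v κ β) (gaugeAction ν v κ' β) :=
  ((h.mul (EqUpTo.refl N β)).mul h.inv).sub ((h.xi ν v).mul h.inv)

/-- A nonzero term needs more than `N` letters for `α` and at least one for `γ`, hence at least `N +
2` letters in all. -/
theorem mul_eqUpTo_zero_left {N : ℕ} {α γ : Coeff A} (h : EqUpTo N α 0) (h' : γ [] = 0) :
    EqUpTo (N + 1) (α * γ) 0 := by
  intro w hw
  rw [Coeff.mul_apply]
  refine Finset.sum_eq_zero fun j hj => ?_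
  rcases lt_or_ge j w.length with hj' | hj'
  · rw [h _ (by simp; omega), Coeff.zero_apply, zero_mul]
  · rw [List.drop_eq_nil_of_le hj', h', mul_zero]

theorem mul_eqUpTo_zero_right {N : ℕ} {α γ : Coeff A} (h : EqUpTo N α 0) (h' : γ [] = 0) :
    EqUpTo (N + 1) (γ * α) 0 := by
  intro w hw
  rw [Coeff.mul_apply]
  refine Finset.sum_eq_zero fun j hj => ?_
  rcases j with _ | j
  · rw [List.take_zero, h', zero_mul]
  · rw [h _ (by simp; omega), Coeff.zero_apply, mul_zero]

theorem EqUpTo.add {N : ℕ} {α β γ δ : Coeff A} (h : EqUpTo N α β) (h' : EqUpTo N γ δ) :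
    EqUpTo N (α + γ) (β + δ) := fun w hw => by
  rw [Coeff.add_apply, Coeff.add_apply, h w hw, h' w hw]

theorem expStar_eqUpTo_one_add {N : ℕ} {η : Coeff A} (h : EqUpTo N η 0) :
    EqUpTo (N + 1) (expStar η) (1 + η) := by
  have h0 : η [] = 0 := h [] (by simp)
  intro w hw
  rw [expStar, tsum_eq_sum (s := Finset.range 2)]
  · simp [Finset.sum_range_succ]
  · intro n hn
    obtain ⟨k, rfl⟩ : ∃ k, n = (k + 1) + 1 := ⟨n - 2, by simp at hn; omega⟩
    rw [pow_succ, mul_eqUpTo_zero_right h (pow_apply_eq_zero h0 (by simp)) w hw,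
      Coeff.zero_apply, mul_zero]

/-- One step of the normalization, solving the homological equation on words of length `N + 1`.
Since `e` is `1` up to length `N`, the work already done is not disturbed. -/
theorem exists_gauge_step (v : Fin d → ℂ) (N : ℕ) {β : Coeff A} (hβ : β ∈ lieG A)
    (hN : EqUpTo N (xi ν v β) 0) :
    ∃ e : (Coeff A)ˣ, (e : Coeff A) ∈ groupG A ∧ EqUpTo N (e : Coeff A) 1 ∧
      EqUpTo (N + 1) (xi ν v (gaugeAction ν v e β)) 0 := by
  -- For resonant words the inverse is `0⁻¹ = 0`, so no correction is made there. The multiplier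
  -- ignores the order of the letters, which keeps `η` in `𝔤`.
  let c : List A → ℂ := fun w => if w.length = N + 1 then (nuWord ν v w)⁻¹ else 0
  let η : Coeff A := fun w => c w * β w
  have hη : η ∈ lieG A := diag_mem_lieG c (fun h => by
    simp only [c, h.length_eq, nuWord_perm ν v h]) hβ
  have hη0 : EqUpTo N η 0 := fun w hw => by
    simp only [η, c, if_neg (show ¬ w.length = N + 1 by omega), zero_mul, Coeff.zero_apply]
  obtain ⟨e, he⟩ := exists_unit (expStar_nil hη.1)
  have h1 : EqUpTo (N + 1) (e : Coeff A) (1 + η) := he ▸ expStar_eqUpTo_one_add hη0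
  have h2 : EqUpTo N (e : Coeff A) 1 := (h1.mono (Nat.le_succ N)).trans (by
    simpa using (EqUpTo.refl N 1).add hη0)
  refine ⟨e, he ▸ expStar_mem_groupG hη, h2, ?_⟩
  have h3 : EqUpTo N ((e⁻¹ : (Coeff A)ˣ) : Coeff A) 1 := by
    simpa using EqUpTo.inv (κ' := 1) (by simpa using h2)
  have h4 : EqUpTo (N + 1) ((e : Coeff A) * β - xi ν v e) (β - xi ν v η) := by
    refine ((h1.mul (EqUpTo.refl _ β)).sub (h1.xi ν v)).trans ?_
    have e1 : xi ν v (1 + η) = xi ν v η := by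
      ext w
      have : nuWord ν v w * (1 : Coeff A) w = 0 := congrFun (xi_one (A := A) ν v) w
      simp [xi, mul_add, this]
    rw [e1, add_mul, one_mul]
    simpa using ((EqUpTo.refl _ β).add (mul_eqUpTo_zero_left hη0 hβ.1)).sub
      (EqUpTo.refl _ (xi ν v η))
  -- Multiplying by `e⁻¹` changes nothing up to length `N + 1`: `e⁻¹ - 1` vanishes up to length `N`
  -- and the other factor vanishes on the empty word.
  have h5 : EqUpTo (N + 1) (gaugeAction ν v e β) (β - xi ν v η) := by
    rw [gaugeAction, ← sub_mul]
    refine EqUpTo.trans (h4.mul (EqUpTo.refl _ _)) ?_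
    have h6 : (β - xi ν v η) [] = 0 := by simp [hβ.1, xi, hη.1]
    have h7 : EqUpTo N (((e⁻¹ : (Coeff A)ˣ) : Coeff A) - 1) 0 := by
      simpa using h3.sub (EqUpTo.refl N 1)
    have h8 := (mul_eqUpTo_zero_right h7 h6).add (EqUpTo.refl _ (β - xi ν v η))
    rwa [mul_sub, mul_one, sub_add_cancel, zero_add] at h8
  refine (h5.xi ν v).trans fun w hw => ?_
  show nuWord ν v w * (β w - nuWord ν v w * (c w * β w)) = 0
  rcases eq_or_ne (nuWord ν v w) 0 with h0 | h0
  · rw [h0, zero_mul]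
  -- On shorter nonresonant words `β` already vanishes; on those of length `N + 1` the two terms
  -- cancel.
  · rcases Nat.lt_or_ge w.length (N + 1) with hw' | hw'
    · have := hN w (by omega)
      have h9 : β w = 0 := (mul_eq_zero.1 this).resolve_left h0
      simp [h9]
    · simp only [c, if_pos (show w.length = N + 1 by omega)]
      field_simp
      simp

theorem exists_gauge (v : Fin d → ℂ) {β : Coeff A} (hβ : β ∈ lieG A) :
    ∃ κ : (Coeff A)ˣ, (κ : Coeff A) ∈ groupG A ∧ xi ν v (gaugeAction ν v κ β) = 0 := by
  let P : ℕ → (Coeff A)ˣ → Prop := fun N κ =>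
    (κ : Coeff A) ∈ groupG A ∧ EqUpTo N (xi ν v (gaugeAction ν v κ β)) 0
  have step : ∀ N κ, P N κ → ∃ κ', P (N + 1) κ' ∧ EqUpTo N (κ' : Coeff A) κ := by
    intro N κ h
    obtain ⟨e, he, he1, he2⟩ := exists_gauge_step ν v N (gaugeAction_mem_lieG ν v h.1 hβ) h.2
    refine ⟨e * κ, ⟨mul_mem_groupG he h.1, by rwa [gaugeAction_mul]⟩, ?_⟩
    simpa using he1.mul (EqUpTo.refl N (κ : Coeff A))
  choose! F hF hF' using step
  let K : ℕ → (Coeff A)ˣ := fun n => Nat.rec 1 F n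
  have hK : ∀ n, P n (K n) := by
    intro n
    induction n with
    | zero =>
      -- The induction starts with no condition, because `ν^v` is zero on the empty word.
      refine ⟨one_mem_groupG, fun w hw => ?_⟩
      rw [List.length_eq_zero_iff.1 (Nat.le_zero.1 hw)]
      simp [xi, nuWord]
    | succ n ih => exact hF n (K n) ih
  have hKE : ∀ n k, EqUpTo n (K (n + k)).val (K n).val := by
    intro n k
    induction k with
    | zero => exact EqUpTo.refl _ _
    | succ k ih => exact ((hF' (n + k) _ (hK _)).mono (Nat.le_add_right n k)).trans ih
  -- The limit of the `K n`: its coefficient on `w` is already final at stage `w.length`. A shuffle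
  -- relation involves words of bounded length, so it is inherited from a single `K n`.
  let k : Coeff A := fun w => (K w.length).val w
  have hk : ∀ n, EqUpTo n k (K n).val := fun n w hw => by
    obtain ⟨j, rfl⟩ := Nat.exists_eq_add_of_le hw
    exact (hKE w.length j w le_rfl).symm
  have hkG : k ∈ groupG A := by
    refine ⟨(hK 0).1.1, fun w w' => ?_⟩
    have e := hk (w.length + w'.length)
    rw [e w (by omega), e w' (by omega), (hK _).1.2]
    refine congrArg Multiset.sum (Multiset.map_congr rfl fun s hs => ?_)
    exact (e s (length_of_mem_shuffle hs).le).symm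
  obtain ⟨κ, hκ⟩ := exists_unit hkG.1
  refine ⟨κ, hκ ▸ hkG, eq_of_forall_eqUpTo fun n => ?_⟩
  exact (EqUpTo.xi ν v (EqUpTo.gaugeAction ν v β (hκ ▸ hk n))).trans (hK n).2

end NormalForm

end WordSeries

end

noncomputable section

namespace WordSeries

/-! ### Symmetry of higher derivatives of smooth functions -/

section Symmetry

variable {E : Type*} [NormedAddCommGroup E] [NormedSpace ℂ E]

/-- Iterated directional derivatives. -/
def dirDeriv (l : List E) (F : E → ℂ) : E → ℂ := l.foldr (fun v G x => fderiv ℂ G x v) F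

theorem contDiff_fderiv_apply {F : E → ℂ} (hF : ContDiff ℂ (⊤ : ℕ∞) F) (v : E) :
    ContDiff ℂ (⊤ : ℕ∞) fun x => fderiv ℂ F x v :=
  (hF.fderiv_right (m := (⊤ : ℕ∞)) (by simp)).clm_apply contDiff_const

theorem contDiff_dirDeriv (l : List E) {F : E → ℂ} (hF : ContDiff ℂ (⊤ : ℕ∞) F) :
    ContDiff ℂ (⊤ : ℕ∞) (dirDeriv l F) := by
  induction l with
  | nil => exact hF
  | cons v l ih => exact contDiff_fderiv_apply ih v

theorem fderiv_fderiv_apply {F : E → ℂ} (hF : ContDiff ℂ (⊤ : ℕ∞) F) (u v x : E) :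
    fderiv ℂ (fun y => fderiv ℂ F y v) x u = fderiv ℂ (fderiv ℂ F) x u v := by
  have h : DifferentiableAt ℂ (fderiv ℂ F) x :=
    ((hF.fderiv_right (m := (⊤ : ℕ∞)) (by simp)).differentiable (by simp)) x
  rw [fderiv_clm_apply h (differentiableAt_const v)]
  simp

theorem fderiv_fderiv_comm {F : E → ℂ} (hF : ContDiff ℂ (⊤ : ℕ∞) F) (u v x : E) :
    fderiv ℂ (fun y => fderiv ℂ F y v) x u = fderiv ℂ (fun y => fderiv ℂ F y u) x v := by
  rw [fderiv_fderiv_apply hF, fderiv_fderiv_apply hF]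
  refine (hF.contDiffAt.isSymmSndFDerivAt ?_) u v
  rw [minSmoothness_of_isRCLikeNormedField]
  exact WithTop.coe_le_coe.2 (le_top : (2 : ℕ∞) ≤ ⊤)

theorem dirDeriv_perm {l l' : List E} (h : l.Perm l') {F : E → ℂ} (hF : ContDiff ℂ (⊤ : ℕ∞) F) :
    dirDeriv l F = dirDeriv l' F := by
  induction h with
  | nil => rfl
  | cons v _ ih =>
    show (fun x => fderiv ℂ (dirDeriv _ F) x v) = fun x => fderiv ℂ (dirDeriv _ F) x v
    rw [ih]
  | swap u v l =>
    funext x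
    exact fderiv_fderiv_comm (contDiff_dirDeriv l hF) v u x
  | trans _ _ ih ih' => exact ih.trans ih'

theorem iteratedFDeriv_eq_dirDeriv {F : E → ℂ} (hF : ContDiff ℂ (⊤ : ℕ∞) F) (k : ℕ) (x : E)
    (v : Fin k → E) : iteratedFDeriv ℂ k F x v = dirDeriv (List.ofFn v) F x := by
  induction k generalizing x with
  | zero => simp [dirDeriv]
  | succ k ih =>
    rw [iteratedFDeriv_succ_apply_left, List.ofFn_succ]
    show _ = fderiv ℂ (dirDeriv (List.ofFn fun i => v i.succ) F) x (v 0)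
    have e : dirDeriv (List.ofFn fun i => v i.succ) F =
        fun y => iteratedFDeriv ℂ k F y (Fin.tail v) := by
      funext y
      exact (ih y _).symm
    have hd : DifferentiableAt ℂ (iteratedFDeriv ℂ k F) x :=
      (hF.differentiable_iteratedFDeriv (by exact_mod_cast ENat.natCast_lt_top k)) x
    rw [e]
    have := (hd.hasFDerivAt.continuousMultilinear_apply_const (Fin.tail v)).fderiv
    rw [this]
    rfl

/-- Writing the iterated derivative as a chain of directional derivatives reduces its symmetry to
that of second derivatives, one transposition of neighbours at a time. -/
theorem iteratedFDeriv_comp_perm {F : E → ℂ} (hF : ContDiff ℂ (⊤ : ℕ∞) F) (k : ℕ) (x : E)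
    (v : Fin k → E) (σ : Equiv.Perm (Fin k)) :
    iteratedFDeriv ℂ k F x (v ∘ σ) = iteratedFDeriv ℂ k F x v := by
  rw [iteratedFDeriv_eq_dirDeriv hF, iteratedFDeriv_eq_dirDeriv hF]
  exact congrFun (dirDeriv_perm (σ.ofFn_comp_perm v) hF) x

end Symmetry

end WordSeries

end

noncomputable section

namespace WordSeries

/-! ### Evaluation of a smooth function at a formal point -/

section Evaluation

variable {A : Type*} {D : ℕ}

/-- A coordinate of a formal point, as a power series. -/
def coordSeries (p : FormalPoint A D) (i : Fin D) : MvPowerSeries A ℂ := fun m => p m i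

/-- The Euler operator: the term of degree `b` is multiplied by `|b|`. -/
def euler (f : MvPowerSeries A ℂ) : MvPowerSeries A ℂ := fun b => (b.degree : ℂ) * f b

/-- Partial derivatives. -/
def pd (i : Fin D) (F : (Fin D → ℂ) → ℂ) : (Fin D → ℂ) → ℂ := fun x => fderiv ℂ F x (Pi.single i 1)

theorem contDiff_pd (i : Fin D) {F : (Fin D → ℂ) → ℂ} (hF : ContDiff ℂ (⊤ : ℕ∞) F) :
    ContDiff ℂ (⊤ : ℕ∞) (pd i F) := contDiff_fderiv_apply hF _

theorem fderiv_eq_sum_pd (F : (Fin D → ℂ) → ℂ) (x u : Fin D → ℂ) :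
    fderiv ℂ F x u = ∑ i, pd i F x * u i := by
  conv_lhs => rw [← Finset.univ_sum_single u]
  rw [map_sum]
  refine Finset.sum_congr rfl fun i _ => ?_
  have : Pi.single i (u i) = u i • (Pi.single i 1 : Fin D → ℂ) := by
    rw [← Pi.single_smul, smul_eq_mul, mul_one]
  rw [this, map_smul, smul_eq_mul, mul_comm]
  rfl

variable [DecidableEq A]

/-- The tuples of `k` nonzero exponents with sum `b`. -/
def nonzeroTuples (k : ℕ) (b : A →₀ ℕ) : Finset (Fin k → A →₀ ℕ) :=
  (Finset.piAntidiag (Finset.univ : Finset (Fin k)) b).filter (fun r => ∀ i, r i ≠ 0)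

theorem mem_nonzeroTuples {k : ℕ} {b : A →₀ ℕ} {r : Fin k → A →₀ ℕ} :
    r ∈ nonzeroTuples k b ↔ ∑ i, r i = b ∧ ∀ i, r i ≠ 0 := by
  simp [nonzeroTuples]

/-- The part of order `k` of the Taylor expansion of `F(p)` in degree `b`, without the `1/k!`. -/
def taylorPart (k : ℕ) (p : FormalPoint A D) (F : (Fin D → ℂ) → ℂ) (b : A →₀ ℕ) : ℂ :=
  ∑ r ∈ nonzeroTuples k b, iteratedFDeriv ℂ k F (p 0) (fun i => p (r i))

/-- The value `F(p)` of a smooth function at a formal point. -/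
def ev (p : FormalPoint A D) (F : (Fin D → ℂ) → ℂ) : MvPowerSeries A ℂ := fun b =>
  ∑ k ∈ Finset.range (b.degree + 1), ((k.factorial : ℂ))⁻¹ * taylorPart k p F b

/-- Each nonzero exponent has degree at least `1`. Hence the truncation in `ev` loses nothing and
may be replaced by any longer one. -/
theorem le_degree_of_mem_nonzeroTuples {k : ℕ} {b : A →₀ ℕ} {r : Fin k → A →₀ ℕ}
    (h : r ∈ nonzeroTuples k b) : k ≤ b.degree := by
  rw [mem_nonzeroTuples] at h
  rw [← h.1, map_sum]
  calc k = ∑ _i : Fin k, 1 := by simp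
    _ ≤ _ := Finset.sum_le_sum fun i _ =>
      Nat.one_le_iff_ne_zero.2 fun h0 => h.2 i ((Finsupp.degree_eq_zero_iff _).1 h0)

theorem taylorPart_eq_zero {k : ℕ} {b : A →₀ ℕ} (h : b.degree < k) (p : FormalPoint A D)
    (F : (Fin D → ℂ) → ℂ) : taylorPart k p F b = 0 := by
  refine Finset.sum_eq_zero fun r hr => ?_
  exact absurd (le_degree_of_mem_nonzeroTuples hr) (by omega)

theorem ev_apply_of_le {M : ℕ} {b : A →₀ ℕ} (h : b.degree < M) (p : FormalPoint A D)
    (F : (Fin D → ℂ) → ℂ) :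
    ev p F b = ∑ k ∈ Finset.range M, ((k.factorial : ℂ))⁻¹ * taylorPart k p F b := by
  refine Finset.sum_subset (fun k hk => ?_) fun k _ hk => ?_
  · simp at hk ⊢; omega
  · rw [taylorPart_eq_zero (by simpa using hk), mul_zero]

theorem ev_zero (p : FormalPoint A D) (F : (Fin D → ℂ) → ℂ) : ev p F 0 = F (p 0) := by
  have : nonzeroTuples 0 (0 : A →₀ ℕ) = {Fin.elim0} := by
    ext r
    simp [mem_nonzeroTuples, Subsingleton.elim r Fin.elim0]
  simp [ev, taylorPart, this]

/-- Splits off the last exponent of the tuple. It may be allowed to vanish on the right because `hG`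
kills that term, so the full antidiagonal can be used. -/
theorem sum_nonzeroTuples_succ (n : ℕ) (b : A →₀ ℕ) (G : (Fin n → A →₀ ℕ) → (A →₀ ℕ) → ℂ)
    (hG : ∀ r, G r 0 = 0) :
    ∑ r ∈ nonzeroTuples (n + 1) b, G (Fin.init r) (r (Fin.last n)) =
      ∑ ac ∈ Finset.HasAntidiagonal.antidiagonal b, ∑ r ∈ nonzeroTuples n ac.1, G r ac.2 := by
  rw [Finset.sum_sigma']
  symm
  refine Finset.sum_bij_ne_zero (fun s _ _ => Fin.snoc s.2 s.1.2) ?_ ?_ ?_ ?_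
  · rintro ⟨⟨a, c⟩, r⟩ h1 h2
    simp only [Finset.mem_sigma, Finset.HasAntidiagonal.mem_antidiagonal, mem_nonzeroTuples] at h1
    rw [mem_nonzeroTuples, Fin.sum_univ_castSucc, Fin.forall_fin_succ']
    simp only [Fin.snoc_castSucc, Fin.snoc_last]
    refine ⟨by rw [h1.2.1, h1.1], h1.2.2, ?_⟩
    rintro rfl
    exact h2 (hG r)
  · rintro ⟨⟨a, c⟩, r⟩ h1 _ ⟨⟨a', c'⟩, r'⟩ h1' _ h
    simp only [Finset.mem_sigma, Finset.HasAntidiagonal.mem_antidiagonal, mem_nonzeroTuples]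
      at h1 h1'
    have hc : c = c' := by simpa using congrFun h (Fin.last n)
    have hr : r = r' := by
      funext i
      simpa using congrFun h i.castSucc
    subst hc hr
    obtain rfl : a = a' := h1.2.1.symm.trans h1'.2.1
    rfl
  · intro r h1 h2
    rw [mem_nonzeroTuples, Fin.sum_univ_castSucc, Fin.forall_fin_succ'] at h1
    refine ⟨⟨(∑ i : Fin n, r i.castSucc, r (Fin.last n)), Fin.init r⟩, ?_, h2, ?_⟩
    · simp only [Finset.mem_sigma, Finset.HasAntidiagonal.mem_antidiagonal, mem_nonzeroTuples]
      exact ⟨h1.1, rfl, h1.2.1⟩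
    · simp
  · rintro ⟨⟨a, c⟩, r⟩ h1 h2
    simp

/-- As `|b|` is the sum of the degrees of the `n + 1` exponents, symmetry of the derivative lets
every position be exchanged with the last one. The factor `n + 1` then turns `1/(n+1)!` into `1/n!`.
-/
theorem sum_degree_mul_taylor (n : ℕ) (p : FormalPoint A D) {F : (Fin D → ℂ) → ℂ}
    (hF : ContDiff ℂ (⊤ : ℕ∞) F) (b : A →₀ ℕ) :
    (b.degree : ℂ) * taylorPart (n + 1) p F b = (n + 1) *
      ∑ r ∈ nonzeroTuples (n + 1) b, ((r (Fin.last n)).degree : ℂ) *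
        iteratedFDeriv ℂ (n + 1) F (p 0) (fun i => p (r i)) := by
  have key : ∀ i : Fin (n + 1), ∑ r ∈ nonzeroTuples (n + 1) b, ((r i).degree : ℂ) *
        iteratedFDeriv ℂ (n + 1) F (p 0) (fun i => p (r i)) =
      ∑ r ∈ nonzeroTuples (n + 1) b, ((r (Fin.last n)).degree : ℂ) *
        iteratedFDeriv ℂ (n + 1) F (p 0) (fun i => p (r i)) := by
    intro i
    let σ : Equiv.Perm (Fin (n + 1)) := Equiv.swap i (Fin.last n)
    refine Finset.sum_nbij' (fun r => r ∘ σ) (fun r => r ∘ σ) ?_ ?_ ?_ ?_ ?_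
    · intro r hr
      rw [mem_nonzeroTuples] at hr ⊢
      exact ⟨(Equiv.sum_comp σ r).trans hr.1, fun j => hr.2 _⟩
    · intro r hr
      rw [mem_nonzeroTuples] at hr ⊢
      exact ⟨(Equiv.sum_comp σ r).trans hr.1, fun j => hr.2 _⟩
    · intro r _
      funext j
      simp [σ]
    · intro r _
      funext j
      simp [σ]
    · intro r _
      have := iteratedFDeriv_comp_perm hF (n + 1) (p 0) (fun i => p (r i)) σ
      rw [← this]
      simp [σ, Function.comp_def]
  calc (b.degree : ℂ) * taylorPart (n + 1) p F b
      = ∑ r ∈ nonzeroTuples (n + 1) b, ∑ i, ((r i).degree : ℂ) *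
        iteratedFDeriv ℂ (n + 1) F (p 0) (fun i => p (r i)) := by
        rw [taylorPart, Finset.mul_sum]
        refine Finset.sum_congr rfl fun r hr => ?_
        rw [← Finset.sum_mul, ← (mem_nonzeroTuples.1 hr).1, map_sum]
        push_cast
        rfl
    _ = _ := by
        rw [Finset.sum_comm, Finset.sum_congr rfl fun i _ => key i]
        simp

theorem iteratedFDeriv_pd (n : ℕ) {F : (Fin D → ℂ) → ℂ} (hF : ContDiff ℂ (⊤ : ℕ∞) F)
    (x : Fin D → ℂ) (m : Fin (n + 1) → Fin D → ℂ) :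
    iteratedFDeriv ℂ (n + 1) F x m =
      ∑ i, iteratedFDeriv ℂ n (pd i F) x (Fin.init m) * m (Fin.last n) i := by
  have h1 : ContDiff ℂ (⊤ : ℕ∞) (fderiv ℂ F) := hF.fderiv_right (m := (⊤ : ℕ∞)) (by simp)
  rw [iteratedFDeriv_succ_apply_right]
  have h2 : ∀ u : Fin D → ℂ, iteratedFDeriv ℂ n (fun y => fderiv ℂ F y u) x (Fin.init m) =
      iteratedFDeriv ℂ n (fun y => fderiv ℂ F y) x (Fin.init m) u := by
    intro u
    have := (ContinuousLinearMap.apply ℂ ℂ u).iteratedFDeriv_comp_left (h1.contDiffAt (x := x))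
      (i := n) (by exact_mod_cast le_top)
    exact DFunLike.congr_fun this (Fin.init m)
  rw [← h2, ← Finset.univ_sum_single (m (Fin.last n)), h2, map_sum]
  refine Finset.sum_congr rfl fun i _ => ?_
  have : Pi.single i (m (Fin.last n) i) = m (Fin.last n) i • (Pi.single i 1 : Fin D → ℂ) := by
    rw [← Pi.single_smul, smul_eq_mul, mul_one]
  rw [this, map_smul, ← h2, smul_eq_mul, mul_comm]
  simp only [Finset.univ_sum_single]
  rfl

/-- The Euler operator and the chain rule: this recursion on the degree characterizes `F(p)`. -/
theorem euler_ev (p : FormalPoint A D) {F : (Fin D → ℂ) → ℂ} (hF : ContDiff ℂ (⊤ : ℕ∞) F) :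
    euler (ev p F) = ∑ i, ev p (pd i F) * euler (coordSeries p i) := by
  ext b
  rw [map_sum]
  have e1 : ∀ n, ((n + 1).factorial : ℂ)⁻¹ * ((b.degree : ℂ) * taylorPart (n + 1) p F b) =
      ∑ ac ∈ Finset.HasAntidiagonal.antidiagonal b, ∑ i, ((n.factorial : ℂ))⁻¹ *
        taylorPart n p (pd i F) ac.1 * ((ac.2.degree : ℂ) * p ac.2 i) := by
    intro n
    rw [sum_degree_mul_taylor n p hF]
    have h := sum_nonzeroTuples_succ n b (fun r c => (c.degree : ℂ) *
      ∑ i, iteratedFDeriv ℂ n (pd i F) (p 0) (fun j => p (r j)) * p c i) (by simp)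
    have h' : ∑ r ∈ nonzeroTuples (n + 1) b, ((r (Fin.last n)).degree : ℂ) *
        iteratedFDeriv ℂ (n + 1) F (p 0) (fun i => p (r i)) =
        ∑ ac ∈ Finset.HasAntidiagonal.antidiagonal b, ∑ r ∈ nonzeroTuples n ac.1,
          ((ac.2.degree : ℂ) *
          ∑ i, iteratedFDeriv ℂ n (pd i F) (p 0) (fun j => p (r j)) * p ac.2 i) := by
      rw [← h]
      refine Finset.sum_congr rfl fun r _ => ?_
      rw [iteratedFDeriv_pd n hF]
      rfl
    have hn : ((n + 1).factorial : ℂ)⁻¹ * (n + 1) = ((n.factorial : ℂ))⁻¹ := by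
      have h1 : (n.factorial : ℂ) ≠ 0 := by exact_mod_cast n.factorial_ne_zero
      have h2 : ((n : ℂ) + 1) ≠ 0 := by exact_mod_cast n.succ_ne_zero
      rw [Nat.factorial_succ]
      push_cast
      field_simp
    rw [← mul_assoc, hn, h', Finset.mul_sum]
    refine Finset.sum_congr rfl fun ac _ => ?_
    simp only [taylorPart, Finset.mul_sum, Finset.sum_mul]
    rw [Finset.sum_comm]
    exact Finset.sum_congr rfl fun i _ => Finset.sum_congr rfl fun r _ => by ring
  have e2 : ∀ i, MvPowerSeries.coeff b (ev p (pd i F) * euler (coordSeries p i)) =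
      ∑ ac ∈ Finset.HasAntidiagonal.antidiagonal b, ∑ n ∈ Finset.range b.degree,
        ((n.factorial : ℂ))⁻¹ * taylorPart n p (pd i F) ac.1 * ((ac.2.degree : ℂ) * p ac.2 i) := by
    intro i
    rw [MvPowerSeries.coeff_mul]
    refine Finset.sum_congr rfl fun ac hac => ?_
    rw [Finset.HasAntidiagonal.mem_antidiagonal] at hac
    show ev p (pd i F) ac.1 * ((ac.2.degree : ℂ) * p ac.2 i) = _
    rcases Nat.eq_zero_or_pos ac.2.degree with h0 | h0
    · simp [h0]
    -- When the second exponent is nonzero the first has smaller degree, so the sum in `ev` may be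
    -- cut at `b.degree`.
    · have : ac.1.degree < b.degree := by
        rw [← hac, map_add]; omega
      rw [ev_apply_of_le this, Finset.sum_mul]
  simp only [e2]
  show (b.degree : ℂ) * ev p F b = _
  rw [ev, Finset.mul_sum, Finset.sum_range_succ']
  -- The term of order `0` occurs only in degree `0`, where the Euler factor vanishes.
  have e0 : (b.degree : ℂ) * (((0 : ℕ).factorial : ℂ)⁻¹ * taylorPart 0 p F b) = 0 := by
    rcases Nat.eq_zero_or_pos b.degree with h0 | h0
    · simp [h0]
    · have : nonzeroTuples 0 b = ∅ := by
        ext r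
        simp only [mem_nonzeroTuples, Finset.univ_eq_empty, Finset.sum_empty, Finset.notMem_empty,
          iff_false, not_and]
        rintro rfl
        simp at h0
      simp [taylorPart, this]
  rw [e0, add_zero]
  simp only [mul_left_comm (b.degree : ℂ), e1]
  rw [Finset.sum_comm, Finset.sum_comm (s := Finset.univ)]
  refine Finset.sum_congr rfl fun ac _ => ?_
  rw [Finset.sum_comm]

end Evaluation

end WordSeries

end

noncomputable section

namespace WordSeries

/-! ### Evaluation at a formal point: algebra, smooth dependence, derivative along curves -/

section EvaluationHom

variable {A : Type*} {D : ℕ}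

/-! ### The Euler operator -/

theorem coeff_euler (f : MvPowerSeries A ℂ) (b : A →₀ ℕ) :
    MvPowerSeries.coeff b (euler f) = (b.degree : ℂ) * MvPowerSeries.coeff b f := rfl

theorem euler_add (f g : MvPowerSeries A ℂ) : euler (f + g) = euler f + euler g := by
  ext b
  simp only [map_add, coeff_euler, mul_add]

theorem euler_sum {ι : Type*} (s : Finset ι) (f : ι → MvPowerSeries A ℂ) :
    euler (∑ i ∈ s, f i) = ∑ i ∈ s, euler (f i) := by
  ext b
  simp only [map_sum, coeff_euler, Finset.mul_sum]

theorem euler_mul (f g : MvPowerSeries A ℂ) : euler (f * g) = euler f * g + f * euler g := by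
  classical
  ext b
  simp only [map_add, coeff_euler, MvPowerSeries.coeff_mul, Finset.mul_sum,
    ← Finset.sum_add_distrib]
  refine Finset.sum_congr rfl fun ac hac => ?_
  rw [← Finset.HasAntidiagonal.mem_antidiagonal.1 hac, map_add]
  push_cast
  ring

theorem coeff_eq_of_euler {f g : MvPowerSeries A ℂ} {b : A →₀ ℕ} (hb : b ≠ 0)
    (h : MvPowerSeries.coeff b (euler f) = MvPowerSeries.coeff b (euler g)) :
    MvPowerSeries.coeff b f = MvPowerSeries.coeff b g := by
  rw [coeff_euler, coeff_euler] at h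
  refine mul_left_cancel₀ ?_ h
  rw [Nat.cast_ne_zero]
  exact fun h0 => hb ((Finsupp.degree_eq_zero_iff _).1 h0)

theorem eq_of_euler {f g : MvPowerSeries A ℂ}
    (h0 : MvPowerSeries.coeff 0 f = MvPowerSeries.coeff 0 g) (h : euler f = euler g) : f = g := by
  ext b
  rcases eq_or_ne b 0 with rfl | hb
  · exact h0
  · exact coeff_eq_of_euler hb (by rw [h])

/-- Because `euler q` has no term of degree `0`, only coefficients of `U` of lower degree enter.
Together with `coeff_eq_of_euler`, this turns `euler_ev` into a recursion on the degree. -/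
theorem coeff_mul_euler_congr {U V : MvPowerSeries A ℂ} {b : A →₀ ℕ}
    (h : ∀ a : A →₀ ℕ, a.degree < b.degree →
      MvPowerSeries.coeff a U = MvPowerSeries.coeff a V) (q : MvPowerSeries A ℂ) :
    MvPowerSeries.coeff b (U * euler q) = MvPowerSeries.coeff b (V * euler q) := by
  classical
  rw [MvPowerSeries.coeff_mul, MvPowerSeries.coeff_mul]
  refine Finset.sum_congr rfl fun ac hac => ?_
  rw [Finset.HasAntidiagonal.mem_antidiagonal] at hac
  rw [coeff_euler]
  rcases Nat.eq_zero_or_pos ac.2.degree with h0 | h0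
  · simp [h0]
  · rw [h ac.1 (by rw [← hac, map_add]; omega)]

theorem coeff_zero_mul (f g : MvPowerSeries A ℂ) : MvPowerSeries.coeff 0 (f * g) =
    MvPowerSeries.coeff 0 f * MvPowerSeries.coeff 0 g := by
  rw [MvPowerSeries.coeff_zero_eq_constantCoeff, map_mul]

/-! ### Partial derivatives -/

theorem pd_add (i : Fin D) {F G : (Fin D → ℂ) → ℂ} (hF : ContDiff ℂ (⊤ : ℕ∞) F)
    (hG : ContDiff ℂ (⊤ : ℕ∞) G) :
    pd i (fun x => F x + G x) = fun x => pd i F x + pd i G x := by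
  funext x
  simp only [pd]
  rw [fderiv_fun_add (hF.differentiable (by simp) x) (hG.differentiable (by simp) x)]
  rfl

theorem pd_mul (i : Fin D) {F G : (Fin D → ℂ) → ℂ} (hF : ContDiff ℂ (⊤ : ℕ∞) F)
    (hG : ContDiff ℂ (⊤ : ℕ∞) G) :
    pd i (fun x => F x * G x) = fun x => pd i F x * G x + F x * pd i G x := by
  funext x
  simp only [pd]
  rw [fderiv_fun_mul (hF.differentiable (by simp) x) (hG.differentiable (by simp) x)]
  simp only [add_apply, smul_apply, smul_eq_mul]
  ring

theorem pd_const (i : Fin D) (c : ℂ) : pd i (fun _ => c) = fun _ => 0 := by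
  funext x
  simp [pd]

theorem pd_coord (i j : Fin D) : pd i (fun x => x j) = fun _ => if j = i then 1 else 0 := by
  funext x
  have : fderiv ℂ (fun y : Fin D → ℂ => y j) x = ContinuousLinearMap.proj j :=
    (ContinuousLinearMap.proj (R := ℂ) (φ := fun _ : Fin D => ℂ) j).fderiv
  simp only [pd, this, ContinuousLinearMap.proj_apply, Pi.single_apply]

theorem contDiff_coord (i : Fin D) : ContDiff ℂ (⊤ : ℕ∞) fun x : Fin D → ℂ => x i :=
  contDiff_apply ℂ ℂ i

/-! ### Evaluation at a formal point is a homomorphism -/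

variable [DecidableEq A]

theorem coeff_zero_ev (p : FormalPoint A D) (F : (Fin D → ℂ) → ℂ) :
    MvPowerSeries.coeff 0 (ev p F) = F (p 0) := ev_zero p F

theorem ev_const_zero (p : FormalPoint A D) : ev p (fun _ => 0) = 0 := by
  ext b
  have : ∀ k, taylorPart k p (fun _ => 0) b = 0 := fun k =>
    Finset.sum_eq_zero fun r _ => by
      simp [show (fun _ : Fin D → ℂ => (0 : ℂ)) = 0 from rfl]
  show ev p (fun _ => 0) b = 0
  simp [ev, this]

theorem ev_const (p : FormalPoint A D) (c : ℂ) : ev p (fun _ => c) = MvPowerSeries.C c := by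
  refine eq_of_euler (by simp [coeff_zero_ev]) ?_
  rw [euler_ev p contDiff_const]
  simp only [pd_const, ev_const_zero, zero_mul, Finset.sum_const_zero]
  ext b
  rw [coeff_euler, MvPowerSeries.coeff_C]
  split_ifs with h <;> simp [h]

theorem ev_add (p : FormalPoint A D) {F G : (Fin D → ℂ) → ℂ} (hF : ContDiff ℂ (⊤ : ℕ∞) F)
    (hG : ContDiff ℂ (⊤ : ℕ∞) G) : ev p (fun x => F x + G x) = ev p F + ev p G := by
  suffices H : ∀ n, ∀ b : A →₀ ℕ, b.degree = n → ∀ F G : (Fin D → ℂ) → ℂ,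
      ContDiff ℂ (⊤ : ℕ∞) F → ContDiff ℂ (⊤ : ℕ∞) G →
      MvPowerSeries.coeff b (ev p (fun x => F x + G x)) =
        MvPowerSeries.coeff b (ev p F + ev p G) by
    ext b
    exact H _ b rfl F G hF hG
  intro n
  induction n using Nat.strong_induction_on with
  | _ n ih =>
    intro b hb F G hF hG
    rcases eq_or_ne b 0 with rfl | hb0
    · rw [map_add, coeff_zero_ev, coeff_zero_ev, coeff_zero_ev]
    · refine coeff_eq_of_euler hb0 ?_
      rw [euler_ev p (hF.add hG), euler_add, euler_ev p hF, euler_ev p hG,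
        ← Finset.sum_add_distrib, map_sum, map_sum]
      refine Finset.sum_congr rfl fun i _ => ?_
      rw [← add_mul, pd_add i hF hG]
      exact coeff_mul_euler_congr (fun a ha => ih a.degree (hb ▸ ha) a rfl _ _
        (contDiff_pd i hF) (contDiff_pd i hG)) _

/-- The product rule for the Euler operator and for partial derivatives gives both sides the same
recursion on the degree; no products of Taylor sums are expanded. -/
theorem ev_mul (p : FormalPoint A D) {F G : (Fin D → ℂ) → ℂ} (hF : ContDiff ℂ (⊤ : ℕ∞) F)
    (hG : ContDiff ℂ (⊤ : ℕ∞) G) : ev p (fun x => F x * G x) = ev p F * ev p G := by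
  suffices H : ∀ n, ∀ b : A →₀ ℕ, b.degree = n → ∀ F G : (Fin D → ℂ) → ℂ,
      ContDiff ℂ (⊤ : ℕ∞) F → ContDiff ℂ (⊤ : ℕ∞) G →
      MvPowerSeries.coeff b (ev p (fun x => F x * G x)) =
        MvPowerSeries.coeff b (ev p F * ev p G) by
    ext b
    exact H _ b rfl F G hF hG
  intro n
  induction n using Nat.strong_induction_on with
  | _ n ih =>
    intro b hb F G hF hG
    rcases eq_or_ne b 0 with rfl | hb0
    · rw [coeff_zero_mul, coeff_zero_ev, coeff_zero_ev, coeff_zero_ev]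
    · refine coeff_eq_of_euler hb0 ?_
      rw [euler_ev p (hF.mul hG), euler_mul, euler_ev p hF, euler_ev p hG, Finset.sum_mul,
        Finset.mul_sum, ← Finset.sum_add_distrib, map_sum, map_sum]
      refine Finset.sum_congr rfl fun i _ => ?_
      have e : ev p (pd i F) * euler (coordSeries p i) * ev p G +
          ev p F * (ev p (pd i G) * euler (coordSeries p i)) =
          (ev p (pd i F) * ev p G + ev p F * ev p (pd i G)) * euler (coordSeries p i) := by ring
      rw [e, pd_mul i hF hG, ev_add p ((contDiff_pd i hF).mul hG) (hF.mul (contDiff_pd i hG))]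
      refine coeff_mul_euler_congr (fun a ha => ?_) _
      rw [map_add, map_add, ih a.degree (hb ▸ ha) a rfl _ _ (contDiff_pd i hF) hG,
        ih a.degree (hb ▸ ha) a rfl _ _ hF (contDiff_pd i hG)]

theorem ev_const_mul (p : FormalPoint A D) (c : ℂ) {F : (Fin D → ℂ) → ℂ}
    (hF : ContDiff ℂ (⊤ : ℕ∞) F) :
    ev p (fun x => c * F x) = MvPowerSeries.C c * ev p F := by
  rw [ev_mul p contDiff_const hF, ev_const]

theorem ev_sum (p : FormalPoint A D) {ι : Type*} (s : Finset ι) {F : ι → (Fin D → ℂ) → ℂ}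
    (hF : ∀ j, ContDiff ℂ (⊤ : ℕ∞) (F j)) :
    ev p (fun x => ∑ j ∈ s, F j x) = ∑ j ∈ s, ev p (F j) := by
  induction s using Finset.cons_induction with
  | empty => simpa using ev_const_zero p
  | cons a s ha ih =>
    simp only [Finset.sum_cons]
    rw [ev_add p (hF a) (ContDiff.sum fun j _ => hF j), ih]

theorem ev_coord (p : FormalPoint A D) (i : Fin D) : ev p (fun x => x i) = coordSeries p i := by
  refine eq_of_euler (coeff_zero_ev p _) ?_
  rw [euler_ev p (contDiff_coord i)]
  simp only [pd_coord, ev_const]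
  rw [Finset.sum_eq_single i] <;> simp +contextual [eq_comm]

/-- Dividing the Euler recursion by `|b|` expresses the coefficient of degree `b` through
coefficients of lower degree. -/
theorem contDiff_ev {E : Type*} [NormedAddCommGroup E] [NormedSpace ℂ E]
    {Φ : E → FormalPoint A D} (hΦ : ∀ m, ContDiff ℂ (⊤ : ℕ∞) fun x => Φ x m)
    {F : (Fin D → ℂ) → ℂ} (hF : ContDiff ℂ (⊤ : ℕ∞) F) (b : A →₀ ℕ) :
    ContDiff ℂ (⊤ : ℕ∞) fun x => ev (Φ x) F b := by
  suffices H : ∀ n, ∀ b : A →₀ ℕ, b.degree = n → ∀ F : (Fin D → ℂ) → ℂ,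
      ContDiff ℂ (⊤ : ℕ∞) F → ContDiff ℂ (⊤ : ℕ∞) fun x => ev (Φ x) F b from H _ b rfl F hF
  intro n
  induction n using Nat.strong_induction_on with
  | _ n ih =>
    intro b hb F hF
    rcases eq_or_ne b 0 with rfl | hb0
    · simp only [ev_zero]
      exact hF.comp (hΦ 0)
    · have hb0' : (b.degree : ℂ) ≠ 0 := by
        rw [Nat.cast_ne_zero]
        exact fun h0 => hb0 ((Finsupp.degree_eq_zero_iff _).1 h0)
      have e : (fun x => ev (Φ x) F b) = fun x => (b.degree : ℂ)⁻¹ * ∑ i,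
          ∑ ac ∈ Finset.HasAntidiagonal.antidiagonal b,
            ev (Φ x) (pd i F) ac.1 * ((ac.2.degree : ℂ) * Φ x ac.2 i) := by
        funext x
        have h1 : (b.degree : ℂ) * ev (Φ x) F b =
            MvPowerSeries.coeff b (∑ i, ev (Φ x) (pd i F) * euler (coordSeries (Φ x) i)) := by
          rw [← euler_ev _ hF]; rfl
        rw [map_sum] at h1
        simp only [MvPowerSeries.coeff_mul] at h1
        rw [eq_inv_mul_iff_mul_eq₀ hb0', h1]
        rfl
      rw [e]
      refine contDiff_const.mul (ContDiff.sum fun i _ => ContDiff.sum fun ac hac => ?_)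
      rw [Finset.HasAntidiagonal.mem_antidiagonal] at hac
      rcases Nat.eq_zero_or_pos ac.2.degree with h0 | h0
      · simp only [h0, Nat.cast_zero, zero_mul, mul_zero]
        exact contDiff_const
      · refine (ih ac.1.degree ?_ ac.1 rfl _ (contDiff_pd i hF)).mul
          (contDiff_const.mul ((contDiff_coord i).comp (hΦ _)))
        rw [← hb, ← hac, map_add]
        omega

/-! ### Differentiation along a curve of formal points -/

/-- The partial derivatives of a function that depends on a parameter. -/
def paramPd (i : Fin D) (H : ℂ × (Fin D → ℂ) → ℂ) : ℂ × (Fin D → ℂ) → ℂ :=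
  fun z => fderiv ℂ H z (0, Pi.single i 1)

/-- The derivative with respect to the parameter. -/
def paramDt (H : ℂ × (Fin D → ℂ) → ℂ) : ℂ × (Fin D → ℂ) → ℂ := fun z => fderiv ℂ H z (1, 0)

theorem pd_param {H : ℂ × (Fin D → ℂ) → ℂ} (hH : ContDiff ℂ (⊤ : ℕ∞) H) (i : Fin D) (c : ℂ) :
    pd i (fun x => H (c, x)) = fun x => paramPd i H (c, x) := by
  funext x
  have h1 : HasFDerivAt H (fderiv ℂ H (c, x)) (c, x) :=
    (hH.differentiable (by simp) _).hasFDerivAt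
  have h2 : HasFDerivAt (fun y : Fin D → ℂ => (c, y)) (ContinuousLinearMap.inr ℂ ℂ (Fin D → ℂ)) x :=
    hasFDerivAt_prodMk_right c x
  have h3 : HasFDerivAt (fun y => H (c, y)) _ x := h1.comp x h2
  simp only [pd, paramPd]
  rw [h3.fderiv]
  simp

theorem contDiff_slice {H : ℂ × (Fin D → ℂ) → ℂ} (hH : ContDiff ℂ (⊤ : ℕ∞) H) (c : ℂ) :
    ContDiff ℂ (⊤ : ℕ∞) fun x => H (c, x) := hH.comp (contDiff_const.prodMk contDiff_id)

theorem paramPd_comm {H : ℂ × (Fin D → ℂ) → ℂ} (hH : ContDiff ℂ (⊤ : ℕ∞) H) (i j : Fin D) :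
    paramPd i (paramPd j H) = paramPd j (paramPd i H) := by
  funext z
  exact fderiv_fderiv_comm hH (0, Pi.single i 1) (0, Pi.single j 1) z

theorem paramPd_paramDt {H : ℂ × (Fin D → ℂ) → ℂ} (hH : ContDiff ℂ (⊤ : ℕ∞) H) (i : Fin D) :
    paramPd i (paramDt H) = paramDt (paramPd i H) := by
  funext z
  exact fderiv_fderiv_comm hH (0, Pi.single i 1) (1, 0) z

/-- The derivative of `H(t, X(t))`, where `X(t)` is a curve with velocity `X'`. -/
def evDeriv (p p' : FormalPoint A D) (H : ℂ × (Fin D → ℂ) → ℂ) (t : ℂ) : MvPowerSeries A ℂ :=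
  ev p (fun x => paramDt H (t, x)) + ∑ i, ev p (fun x => paramPd i H (t, x)) * coordSeries p' i

/-- The candidate derivative satisfies the time derivative of the recursion `euler_ev`; this is what
allows an induction on the degree in `hasDerivAt_ev`. -/
theorem euler_evDeriv (p p' : FormalPoint A D) {H : ℂ × (Fin D → ℂ) → ℂ}
    (hH : ContDiff ℂ (⊤ : ℕ∞) H) (t : ℂ) :
    euler (evDeriv p p' H t) = ∑ i, (evDeriv p p' (paramPd i H) t * euler (coordSeries p i) +
      ev p (fun x => paramPd i H (t, x)) * euler (coordSeries p' i)) := by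
  have hpd : ∀ i, ContDiff ℂ (⊤ : ℕ∞) (paramPd i H) := fun i => contDiff_fderiv_apply hH _
  have hdt : ContDiff ℂ (⊤ : ℕ∞) (paramDt H) := contDiff_fderiv_apply hH _
  rw [evDeriv, euler_add, euler_sum, euler_ev _ (contDiff_slice hdt t)]
  have e1 : ∀ i, euler (ev p (fun x => paramPd i H (t, x)) * coordSeries p' i) =
      ∑ j, ev p (fun x => paramPd i (paramPd j H) (t, x)) * coordSeries p' i *
        euler (coordSeries p j) +
      ev p (fun x => paramPd i H (t, x)) * euler (coordSeries p' i) := by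
    intro i
    rw [euler_mul, euler_ev _ (contDiff_slice (hpd i) t), Finset.sum_mul]
    refine congrArg (· + _) (Finset.sum_congr rfl fun j _ => ?_)
    rw [pd_param (hpd i), paramPd_comm hH]
    exact mul_right_comm _ _ _
  simp only [e1, pd_param hdt, paramPd_paramDt hH, Finset.sum_add_distrib, evDeriv, add_mul,
    Finset.sum_mul]
  rw [Finset.sum_comm, ← add_assoc]

/-- The function depends on time as well, so that the lemma also covers `φ_{tv}(X(t))`. In positive
degree the coefficient is a combination of products of coefficients of lower degree with coordinates
of the curve, and these are differentiated by the induction hypothesis. -/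
theorem hasDerivAt_ev {X : ℝ → FormalPoint A D} {X' : FormalPoint A D} {t : ℝ}
    (hX : ∀ m, HasDerivAt (fun s => X s m) (X' m) t) {H : ℂ × (Fin D → ℂ) → ℂ}
    (hH : ContDiff ℂ (⊤ : ℕ∞) H) (b : A →₀ ℕ) :
    HasDerivAt (fun s : ℝ => ev (X s) (fun x => H (s, x)) b)
      (MvPowerSeries.coeff b (evDeriv (X t) X' H t)) t := by
  suffices G : ∀ n, ∀ b : A →₀ ℕ, b.degree = n → ∀ H : ℂ × (Fin D → ℂ) → ℂ,
      ContDiff ℂ (⊤ : ℕ∞) H → HasDerivAt (fun s : ℝ => ev (X s) (fun x => H (s, x)) b)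
      (MvPowerSeries.coeff b (evDeriv (X t) X' H t)) t from G _ b rfl H hH
  have hXc : ∀ m i, HasDerivAt (fun s => X s m i) (X' m i) t := fun m i =>
    hasDerivAt_pi.1 (hX m) i
  intro n
  induction n using Nat.strong_induction_on with
  | _ n ih =>
    intro b hb H hH
    have hpd : ∀ i, ContDiff ℂ (⊤ : ℕ∞) (paramPd i H) := fun i => contDiff_fderiv_apply hH _
    have hdt : ContDiff ℂ (⊤ : ℕ∞) (paramDt H) := contDiff_fderiv_apply hH _
    rcases eq_or_ne b 0 with rfl | hb0
    · simp only [ev_zero]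
      have h1 : HasFDerivAt H ((fderiv ℂ H ((t : ℂ), X t 0)).restrictScalars ℝ) ((t : ℂ), X t 0) :=
        (hH.differentiable (by simp) _).hasFDerivAt.restrictScalars ℝ
      have h2 : HasDerivAt (fun s : ℝ => ((s : ℂ), X s 0)) ((1 : ℂ), X' 0) t :=
        (Complex.ofRealCLM.hasDerivAt (x := t)).prodMk (hX 0)
      have h3 := h1.comp_hasDerivAt t h2
      refine h3.congr_deriv ?_
      rw [evDeriv, map_add, map_sum, coeff_zero_ev]
      simp only [← pd_param hH]
      have e : ((1 : ℂ), X' 0) = ((1 : ℂ), (0 : Fin D → ℂ)) + ((0 : ℂ), X' 0) := by simp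
      rw [e, map_add]
      congr 1
      have h4 : fderiv ℂ H ((t : ℂ), X t 0) ((0 : ℂ), X' 0) =
          fderiv ℂ (fun x => H ((t : ℂ), x)) (X t 0) (X' 0) := by
        have h1 : HasFDerivAt H (fderiv ℂ H ((t : ℂ), X t 0)) ((t : ℂ), X t 0) :=
          (hH.differentiable (by simp) _).hasFDerivAt
        have h3 : HasFDerivAt (fun y => H ((t : ℂ), y)) _ (X t 0) :=
          h1.comp (X t 0) (hasFDerivAt_prodMk_right (t : ℂ) (X t 0))
        rw [h3.fderiv]
        simp
      refine h4.trans ((fderiv_eq_sum_pd _ _ _).trans ?_)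
      refine Finset.sum_congr rfl fun i _ => ?_
      rw [coeff_zero_mul, coeff_zero_ev]
      rfl
    · have hb0' : (b.degree : ℂ) ≠ 0 := by
        rw [Nat.cast_ne_zero]
        exact fun h0 => hb0 ((Finsupp.degree_eq_zero_iff _).1 h0)
      have e : (fun s : ℝ => ev (X s) (fun x => H (s, x)) b) = fun s : ℝ => (b.degree : ℂ)⁻¹ *
          ∑ i, ∑ ac ∈ Finset.HasAntidiagonal.antidiagonal b,
            ev (X s) (fun x => paramPd i H (s, x)) ac.1 * ((ac.2.degree : ℂ) * X s ac.2 i) := by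
        funext s
        have h1 : (b.degree : ℂ) * ev (X s) (fun x => H (s, x)) b =
            MvPowerSeries.coeff b (∑ i, ev (X s) (fun x => paramPd i H (s, x)) *
              euler (coordSeries (X s) i)) := by
          simp only [← pd_param hH]
          rw [← euler_ev _ (contDiff_slice hH s)]; rfl
        rw [map_sum] at h1
        simp only [MvPowerSeries.coeff_mul] at h1
        rw [eq_inv_mul_iff_mul_eq₀ hb0', h1]
        rfl
      have hd : HasDerivAt (fun s : ℝ => ev (X s) (fun x => H (s, x)) b) ((b.degree : ℂ)⁻¹ *
          ∑ i, ∑ ac ∈ Finset.HasAntidiagonal.antidiagonal b,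
            (evDeriv (X t) X' (paramPd i H) t ac.1 * ((ac.2.degree : ℂ) * X t ac.2 i) +
              ev (X t) (fun x => paramPd i H (t, x)) ac.1 *
                ((ac.2.degree : ℂ) * X' ac.2 i))) t := by
        rw [e]
        refine HasDerivAt.const_mul _ (HasDerivAt.fun_sum fun i _ =>
          HasDerivAt.fun_sum fun ac hac => ?_)
        rw [Finset.HasAntidiagonal.mem_antidiagonal] at hac
        rcases Nat.eq_zero_or_pos ac.2.degree with h0 | h0
        · simp only [h0, Nat.cast_zero, zero_mul, mul_zero, add_zero]
          exact hasDerivAt_const _ _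
        · refine (ih ac.1.degree ?_ ac.1 rfl _ (hpd i)).mul ((hXc _ i).const_mul _)
          rw [← hb, ← hac, map_add]
          omega
      refine hd.congr_deriv ?_
      rw [inv_mul_eq_iff_eq_mul₀ hb0', ← coeff_euler, euler_evDeriv _ _ hH, map_sum]
      refine Finset.sum_congr rfl fun i _ => ?_
      rw [map_add, MvPowerSeries.coeff_mul, MvPowerSeries.coeff_mul, ← Finset.sum_add_distrib]
      rfl

end EvaluationHom

end WordSeries

end

noncomputable section

namespace WordSeries

/-! ### Hadamard's lemma -/

section Hadamard

variable {D : ℕ}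

theorem hasFDerivAt_segment_integral {V : Type} [NormedAddCommGroup V] [NormedSpace ℂ V]
    [CompleteSpace V] {G : (Fin D → ℂ) → V} (hG : ContDiff ℂ (⊤ : ℕ∞) G) (c : Fin D → ℂ) (k : ℕ)
    (x : Fin D → ℂ) :
    HasFDerivAt (fun x => ∫ s in (0 : ℝ)..1, (s : ℂ) ^ k • G (c + (s : ℂ) • (x - c)))
      (∫ s in (0 : ℝ)..1, (s : ℂ) ^ (k + 1) • fderiv ℂ G (c + (s : ℂ) • (x - c))) x := by
  have hG' : ContDiff ℂ (⊤ : ℕ∞) (fderiv ℂ G) := hG.fderiv_right (m := (⊤ : ℕ∞)) (by simp)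
  have hc1 : Continuous fun z : (Fin D → ℂ) × ℝ =>
      (z.2 : ℂ) ^ k • G (c + (z.2 : ℂ) • (z.1 - c)) := by
    have := hG.continuous
    fun_prop
  have hc2 : Continuous fun z : (Fin D → ℂ) × ℝ =>
      (z.2 : ℂ) ^ (k + 1) • fderiv ℂ G (c + (z.2 : ℂ) • (z.1 - c)) := by
    have := hG'.continuous
    fun_prop
  obtain ⟨C, hC⟩ := ((isCompact_closedBall x (1 : ℝ)).prod
    (isCompact_Icc (a := (0 : ℝ)) (b := 1))).exists_bound_of_continuousOn hc2.continuousOn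
  refine intervalIntegral.hasFDerivAt_integral_of_dominated_of_fderiv_le
    (F := fun x s => (s : ℂ) ^ k • G (c + (s : ℂ) • (x - c)))
    (F' := fun x s => (s : ℂ) ^ (k + 1) • fderiv ℂ G (c + (s : ℂ) • (x - c)))
    (s := Metric.closedBall x 1) (bound := fun _ => C)
    (Metric.closedBall_mem_nhds x one_pos) ?_ ?_ ?_ ?_ ?_ ?_
  · exact Filter.Eventually.of_forall fun y =>
      (hc1.comp (Continuous.prodMk_right y)).aestronglyMeasurable
  · exact (hc1.comp (Continuous.prodMk_right x)).intervalIntegrable _ _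
  · exact (hc2.comp (Continuous.prodMk_right x)).aestronglyMeasurable
  · refine Filter.Eventually.of_forall fun s hs y hy => hC (y, s) ⟨hy, ?_⟩
    rw [Set.uIoc_of_le zero_le_one] at hs
    exact ⟨hs.1.le, hs.2⟩
  · exact intervalIntegrable_const
  · refine Filter.Eventually.of_forall fun s _ y _ => ?_
    have h1 : HasFDerivAt (fun y : Fin D → ℂ => c + (s : ℂ) • (y - c))
        ((s : ℂ) • ContinuousLinearMap.id ℂ (Fin D → ℂ)) y :=
      (((hasFDerivAt_id y).sub_const c).const_smul (s : ℂ)).const_add c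
    have h2 := ((hG.differentiable (by simp) (c + (s : ℂ) • (y - c))).hasFDerivAt.comp y
      h1).const_smul ((s : ℂ) ^ k)
    refine h2.congr_fderiv ?_
    ext1 u
    simp [pow_succ, mul_smul]

/-- Each differentiation replaces `G` by `fderiv ℂ G` and brings out one more factor `s`. The
induction therefore needs the target space and the power `k` to vary. -/
theorem contDiff_segment_integral (n : ℕ) : ∀ {V : Type} [NormedAddCommGroup V] [NormedSpace ℂ V]
    [CompleteSpace V] {G : (Fin D → ℂ) → V}, ContDiff ℂ (⊤ : ℕ∞) G → ∀ (c : Fin D → ℂ) (k : ℕ),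
    ContDiff ℂ n
      (fun x => ∫ s in (0 : ℝ)..1, (s : ℂ) ^ k • G (c + (s : ℂ) • (x - c))) := by
  induction n with
  | zero =>
    intro V _ _ _ G hG c k
    have hd : Differentiable ℂ
        (fun x => ∫ s in (0 : ℝ)..1, (s : ℂ) ^ k • G (c + (s : ℂ) • (x - c))) := fun x =>
      (hasFDerivAt_segment_integral hG c k x).differentiableAt
    exact contDiff_zero.2 hd.continuous
  | succ n ih =>
    intro V _ _ _ G hG c k
    have hG' : ContDiff ℂ (⊤ : ℕ∞) (fderiv ℂ G) := hG.fderiv_right (m := (⊤ : ℕ∞)) (by simp)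
    rw [Nat.cast_succ, contDiff_succ_iff_fderiv]
    refine ⟨fun x => (hasFDerivAt_segment_integral hG c k x).differentiableAt, by simp, ?_⟩
    have e : fderiv ℂ (fun x => ∫ s in (0 : ℝ)..1, (s : ℂ) ^ k • G (c + (s : ℂ) • (x - c))) =
        fun x => ∫ s in (0 : ℝ)..1, (s : ℂ) ^ (k + 1) • fderiv ℂ G (c + (s : ℂ) • (x - c)) :=
      funext fun x => (hasFDerivAt_segment_integral hG c k x).fderiv
    rw [e]
    exact ih hG' c (k + 1)

/-- The fundamental theorem of calculus along the segment from `c` to `x`: the function `h i` is the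
mean of the partial derivative over the segment. -/
theorem exists_hadamard {F : (Fin D → ℂ) → ℂ} (hF : ContDiff ℂ (⊤ : ℕ∞) F) (c : Fin D → ℂ) :
    ∃ h : Fin D → (Fin D → ℂ) → ℂ, (∀ i, ContDiff ℂ (⊤ : ℕ∞) (h i)) ∧
      (∀ x, F x = F c + ∑ i, (x i - c i) * h i x) ∧ ∀ i, h i c = pd i F c := by
  refine ⟨fun i x => ∫ s in (0 : ℝ)..1, (s : ℂ) ^ 0 • pd i F (c + (s : ℂ) • (x - c)),
    fun i => contDiff_infty.2 fun n => contDiff_segment_integral n (contDiff_pd i hF) c 0,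
    fun x => ?_, fun i => by simp⟩
  have hcont : ∀ i, Continuous fun s : ℝ => pd i F (c + (s : ℂ) • (x - c)) := fun i => by
    have := (contDiff_pd i hF).continuous
    fun_prop
  have hd : ∀ s : ℝ, HasDerivAt (fun s : ℝ => F (c + (s : ℂ) • (x - c)))
      (∑ i, pd i F (c + (s : ℂ) • (x - c)) * (x - c) i) s := by
    intro s
    have h1 : HasDerivAt (fun s : ℝ => c + (s : ℂ) • (x - c)) (x - c) s := by
      have := ((Complex.ofRealCLM.hasDerivAt (x := s)).smul_const (x - c)).const_add c
      simpa using this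
    have h2 := ((hF.differentiable (by simp)
      (c + (s : ℂ) • (x - c))).hasFDerivAt.restrictScalars ℝ).comp_hasDerivAt s h1
    rw [← fderiv_eq_sum_pd]
    exact h2
  have hftc := intervalIntegral.integral_eq_sub_of_hasDerivAt (a := 0) (b := 1)
    (fun s _ => hd s) (Continuous.intervalIntegrable (by fun_prop) _ _)
  rw [intervalIntegral.integral_finsetSum
    (f := fun i (s : ℝ) => pd i F (c + (s : ℂ) • (x - c)) * (x - c) i)
    fun i _ => ((hcont i).mul continuous_const).intervalIntegrable _ _] at hftc
  simp only [Complex.ofReal_one, one_smul, Complex.ofReal_zero, zero_smul, add_zero,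
    add_sub_cancel, intervalIntegral.integral_mul_const] at hftc
  rw [← sub_eq_iff_eq_add', ← hftc]
  refine Finset.sum_congr rfl fun i _ => ?_
  simp [mul_comm]

end Hadamard

/-! ### Homomorphisms and derivations are determined by the coordinates -/

section Uniqueness

variable {A : Type*} {D : ℕ} [DecidableEq A]

/-- By Hadamard's lemma at `p 0`, `T F` is a constant plus a combination of the `T (h i)` whose
factors `p_i - p_0` have no constant term. Each coefficient thus involves only lower degrees of `T
(h i)`, and `ev p` obeys the same recursion. -/
theorem eq_ev_of_hom {T : ((Fin D → ℂ) → ℂ) → MvPowerSeries A ℂ}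
    (hc : ∀ c : ℂ, T (fun _ => c) = MvPowerSeries.C c)
    (ha : ∀ {F G : (Fin D → ℂ) → ℂ}, ContDiff ℂ (⊤ : ℕ∞) F → ContDiff ℂ (⊤ : ℕ∞) G →
      T (fun x => F x + G x) = T F + T G)
    (hm : ∀ {F G : (Fin D → ℂ) → ℂ}, ContDiff ℂ (⊤ : ℕ∞) F → ContDiff ℂ (⊤ : ℕ∞) G →
      T (fun x => F x * G x) = T F * T G)
    {p : FormalPoint A D} (hp : ∀ i, T (fun x => x i) = coordSeries p i)
    {F : (Fin D → ℂ) → ℂ} (hF : ContDiff ℂ (⊤ : ℕ∞) F) : T F = ev p F := by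
  have hsum : ∀ (s : Finset (Fin D)) (G : Fin D → (Fin D → ℂ) → ℂ),
      (∀ i, ContDiff ℂ (⊤ : ℕ∞) (G i)) → T (fun x => ∑ i ∈ s, G i x) = ∑ i ∈ s, T (G i) := by
    intro s G hG
    induction s using Finset.cons_induction with
    | empty => simpa using hc 0
    | cons a s _ ih =>
      simp only [Finset.sum_cons]
      rw [ha (hG a) (ContDiff.sum fun j _ => hG j), ih]
  suffices H : ∀ n, ∀ b : A →₀ ℕ, b.degree = n → ∀ F : (Fin D → ℂ) → ℂ,
      ContDiff ℂ (⊤ : ℕ∞) F → MvPowerSeries.coeff b (T F) = MvPowerSeries.coeff b (ev p F) by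
    ext b
    exact H _ b rfl F hF
  intro n
  induction n using Nat.strong_induction_on with
  | _ n ih =>
    intro b hb F hF
    obtain ⟨h, hh, hFh, -⟩ := exists_hadamard hF (p 0)
    -- The difference is written as a sum because `T` is only assumed to respect sums, products and
    -- constants.
    have hlin : ∀ i, ContDiff ℂ (⊤ : ℕ∞) fun x : Fin D → ℂ => x i + (- p 0 i) := fun i =>
      (contDiff_coord i).add contDiff_const
    have e : F = fun x => F (p 0) + ∑ i, (x i + (- p 0 i)) * h i x := by
      funext x
      simpa [sub_eq_add_neg] using hFh x
    have eT : T F = MvPowerSeries.C (F (p 0)) +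
        ∑ i, (coordSeries p i + MvPowerSeries.C (- p 0 i)) * T (h i) := by
      conv_lhs => rw [e]
      rw [ha contDiff_const (ContDiff.sum fun i _ => (hlin i).mul (hh i)), hc,
        hsum _ _ fun i => (hlin i).mul (hh i)]
      refine congrArg _ (Finset.sum_congr rfl fun i _ => ?_)
      rw [hm (hlin i) (hh i), ha (contDiff_coord i) contDiff_const, hp, hc]
    have eE : ev p F = MvPowerSeries.C (F (p 0)) +
        ∑ i, (coordSeries p i + MvPowerSeries.C (- p 0 i)) * ev p (h i) := by
      conv_lhs => rw [e]
      rw [ev_add p contDiff_const (ContDiff.sum fun i _ => (hlin i).mul (hh i)), ev_const,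
        ev_sum p _ fun i => (hlin i).mul (hh i)]
      refine congrArg _ (Finset.sum_congr rfl fun i _ => ?_)
      rw [ev_mul p (hlin i) (hh i), ev_add p (contDiff_coord i) contDiff_const, ev_coord, ev_const]
    rw [eT, eE, map_add, map_add, map_sum, map_sum]
    refine congrArg _ (Finset.sum_congr rfl fun i _ => ?_)
    rw [MvPowerSeries.coeff_mul, MvPowerSeries.coeff_mul]
    refine Finset.sum_congr rfl fun ac hac => ?_
    rw [Finset.HasAntidiagonal.mem_antidiagonal] at hac
    rcases eq_or_ne ac.1 0 with h0 | h0
    · have : MvPowerSeries.coeff ac.1 (coordSeries p i + MvPowerSeries.C (- p 0 i)) = 0 := by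
        rw [h0, map_add, MvPowerSeries.coeff_C, if_pos rfl]
        exact add_neg_cancel (p 0 i)
      rw [this, zero_mul, zero_mul]
    · rw [ih ac.2.degree ?_ ac.2 rfl _ (hh i)]
      have : ac.1.degree ≠ 0 := fun h => h0 ((Finsupp.degree_eq_zero_iff _).1 h)
      rw [← hb, ← hac, map_add]
      omega

/-- In Hadamard's expansion at `x` the linear factors vanish at `x`, so the product rule keeps only
`h i x = ∂_i F(x)` times the value of `T` on the coordinate. -/
theorem eq_sum_pd_of_derivation {x : Fin D → ℂ} {T : ((Fin D → ℂ) → ℂ) → ℂ}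
    (ha : ∀ {F G : (Fin D → ℂ) → ℂ}, ContDiff ℂ (⊤ : ℕ∞) F → ContDiff ℂ (⊤ : ℕ∞) G →
      T (fun x => F x + G x) = T F + T G)
    (hm : ∀ {F G : (Fin D → ℂ) → ℂ}, ContDiff ℂ (⊤ : ℕ∞) F → ContDiff ℂ (⊤ : ℕ∞) G →
      T (fun x => F x * G x) = T F * G x + F x * T G)
    (hc : ∀ c : ℂ, T (fun _ => c) = 0)
    {F : (Fin D → ℂ) → ℂ} (hF : ContDiff ℂ (⊤ : ℕ∞) F) :
    T F = ∑ i, pd i F x * T (fun y => y i) := by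
  have hsum : ∀ (s : Finset (Fin D)) (G : Fin D → (Fin D → ℂ) → ℂ),
      (∀ i, ContDiff ℂ (⊤ : ℕ∞) (G i)) → T (fun x => ∑ i ∈ s, G i x) = ∑ i ∈ s, T (G i) := by
    intro s G hG
    induction s using Finset.cons_induction with
    | empty => simpa using hc 0
    | cons a s _ ih =>
      simp only [Finset.sum_cons]
      rw [ha (hG a) (ContDiff.sum fun j _ => hG j), ih]
  obtain ⟨h, hh, hFh, hhc⟩ := exists_hadamard hF x
  have hlin : ∀ i, ContDiff ℂ (⊤ : ℕ∞) fun y : Fin D → ℂ => y i + (- x i) := fun i =>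
    (contDiff_coord i).add contDiff_const
  have e : F = fun y => F x + ∑ i, (y i + (- x i)) * h i y := by
    funext y
    simpa [sub_eq_add_neg] using hFh y
  conv_lhs => rw [e]
  rw [ha contDiff_const (ContDiff.sum fun i _ => (hlin i).mul (hh i)), hc,
    hsum _ _ fun i => (hlin i).mul (hh i), zero_add]
  refine Finset.sum_congr rfl fun i _ => ?_
  rw [hm (hlin i) (hh i), ha (contDiff_coord i) contDiff_const, hc, hhc]
  ring

end Uniqueness

end WordSeries

end

noncomputable section

namespace WordSeries

/-! ### Substitution of formal points into formal series of functions -/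

section Substitution

variable {A : Type*} {D : ℕ}

/-- All the terms of a formal series of scalar functions are smooth. -/
def IsSmoothScalar (Φ : (Fin D → ℂ) → MvPowerSeries A ℂ) : Prop :=
  ∀ m, ContDiff ℂ (⊤ : ℕ∞) fun x => MvPowerSeries.coeff m (Φ x)

theorem IsSmooth.coordSeries {Φ : FormalMap A D} (h : IsSmooth Φ) (i : Fin D) :
    IsSmoothScalar fun x => coordSeries (Φ x) i := fun m => (contDiff_coord i).comp (h m)

theorem isSmooth_of_coordSeries {Φ : FormalMap A D}
    (h : ∀ i, IsSmoothScalar fun x => coordSeries (Φ x) i) : IsSmooth Φ := fun m =>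
  contDiff_pi.2 fun i => h i m

theorem formalPoint_ext {p q : FormalPoint A D} (h : ∀ i, coordSeries p i = coordSeries q i) :
    p = q := by
  funext m i
  exact congrFun (h i) m

theorem isSmooth_add {Φ Ψ : FormalMap A D} (hΦ : IsSmooth Φ) (hΨ : IsSmooth Ψ) :
    IsSmooth (Φ + Ψ) := fun m => (hΦ m).add (hΨ m)

theorem sum_antidiagonal_assoc {M V : Type*} [AddCommMonoid M] [Finset.HasAntidiagonal M]
    [AddCommMonoid V] (m : M) (g : M → M → M → V) :
    ∑ ab ∈ Finset.HasAntidiagonal.antidiagonal m,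
      ∑ cd ∈ Finset.HasAntidiagonal.antidiagonal ab.2, g ab.1 cd.1 cd.2 =
    ∑ ab ∈ Finset.HasAntidiagonal.antidiagonal m,
      ∑ cd ∈ Finset.HasAntidiagonal.antidiagonal ab.1, g cd.1 cd.2 ab.2 := by
  simp only [Finset.sum_sigma']
  refine Finset.sum_nbij' (fun ⟨⟨a, _⟩, c, d⟩ => ⟨(a + c, d), (a, c)⟩)
    (fun ⟨⟨_, b⟩, c, d⟩ => ⟨(c, d + b), (d, b)⟩) ?_ ?_ ?_ ?_ (fun _ _ => rfl) <;>
  · rintro ⟨⟨a, b⟩, c, d⟩ h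
    simp only [Finset.mem_sigma, Finset.HasAntidiagonal.mem_antidiagonal] at h ⊢
    obtain ⟨rfl, rfl⟩ := h
    simp [add_assoc]

theorem sum_antidiagonal_comm {M V : Type*} [AddCommMonoid M] [Finset.HasAntidiagonal M]
    [AddCommMonoid V] (m : M) (g : M → M → M → M → V) :
    ∑ ab ∈ Finset.HasAntidiagonal.antidiagonal m,
      ∑ cd ∈ Finset.HasAntidiagonal.antidiagonal ab.1,
        ∑ ef ∈ Finset.HasAntidiagonal.antidiagonal ab.2, g cd.1 cd.2 ef.1 ef.2 =
    ∑ ab ∈ Finset.HasAntidiagonal.antidiagonal m,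
      ∑ cd ∈ Finset.HasAntidiagonal.antidiagonal ab.1,
        ∑ ef ∈ Finset.HasAntidiagonal.antidiagonal ab.2, g cd.1 ef.1 cd.2 ef.2 := by
  simp only [Finset.sum_sigma']
  refine Finset.sum_nbij' (fun ⟨_, ⟨c, d⟩, e, f⟩ => ⟨(c + e, d + f), (c, e), (d, f)⟩)
    (fun ⟨_, ⟨c, d⟩, e, f⟩ => ⟨(c + e, d + f), (c, e), (d, f)⟩) ?_ ?_ ?_ ?_ (fun _ _ => rfl) <;>
  · rintro ⟨⟨a, b⟩, ⟨c, d⟩, e, f⟩ h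
    simp only [Finset.mem_sigma, Finset.HasAntidiagonal.mem_antidiagonal] at h ⊢
    obtain ⟨rfl, rfl, rfl⟩ := h
    simp [add_add_add_comm]

variable [DecidableEq A]

/-- The value `Φ(p)` of a formal series of scalar functions at a formal point. -/
def evSeries (p : FormalPoint A D) (Φ : (Fin D → ℂ) → MvPowerSeries A ℂ) : MvPowerSeries A ℂ :=
  fun m => ∑ ab ∈ Finset.HasAntidiagonal.antidiagonal m,
    ev p (fun x => MvPowerSeries.coeff ab.1 (Φ x)) ab.2

theorem coeff_evSeries (p : FormalPoint A D) (Φ : (Fin D → ℂ) → MvPowerSeries A ℂ)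
    (m : A →₀ ℕ) : MvPowerSeries.coeff m (evSeries p Φ) =
      ∑ ab ∈ Finset.HasAntidiagonal.antidiagonal m,
        MvPowerSeries.coeff ab.2 (ev p (fun x => MvPowerSeries.coeff ab.1 (Φ x))) := rfl

theorem taylorTerm_apply {F : (Fin D → ℂ) → (Fin D → ℂ)} (hF : ContDiff ℂ (⊤ : ℕ∞) F)
    (p : FormalPoint A D) (b : A →₀ ℕ) (i : Fin D) :
    taylorTerm F p b i = ev p (fun x => F x i) b := by
  simp only [taylorTerm, ev, Finset.sum_apply, Pi.smul_apply, smul_eq_mul]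
  refine Finset.sum_congr rfl fun k _ => congrArg _ (Finset.sum_congr rfl fun r _ => ?_)
  have := (ContinuousLinearMap.proj (R := ℂ) (φ := fun _ : Fin D => ℂ) i).iteratedFDeriv_comp_left
    (hF.contDiffAt (x := p 0)) (i := k) (by exact_mod_cast le_top)
  exact (DFunLike.congr_fun this fun i => p (r i)).symm

theorem coordSeries_subst {Φ : FormalMap A D} (hΦ : IsSmooth Φ) (p : FormalPoint A D)
    (i : Fin D) : coordSeries (subst Φ p) i = evSeries p fun x => coordSeries (Φ x) i := by
  ext m
  show subst Φ p m i = _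
  rw [coeff_evSeries, subst, Finset.sum_apply]
  exact Finset.sum_congr rfl fun ab _ => taylorTerm_apply (hΦ ab.1) p ab.2 i

theorem evSeries_add (p : FormalPoint A D) {Φ Ψ : (Fin D → ℂ) → MvPowerSeries A ℂ}
    (hΦ : IsSmoothScalar Φ) (hΨ : IsSmoothScalar Ψ) :
    evSeries p (fun x => Φ x + Ψ x) = evSeries p Φ + evSeries p Ψ := by
  ext m
  simp only [map_add, coeff_evSeries, ← Finset.sum_add_distrib]
  refine Finset.sum_congr rfl fun ab _ => ?_
  rw [ev_add p (hΦ _) (hΨ _), map_add]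

theorem evSeries_mul (p : FormalPoint A D) {Φ Ψ : (Fin D → ℂ) → MvPowerSeries A ℂ}
    (hΦ : IsSmoothScalar Φ) (hΨ : IsSmoothScalar Ψ) :
    evSeries p (fun x => Φ x * Ψ x) = evSeries p Φ * evSeries p Ψ := by
  ext m
  simp only [coeff_evSeries, MvPowerSeries.coeff_mul]
  have e : ∀ a : A →₀ ℕ, ev p (fun x => ∑ cd ∈ Finset.HasAntidiagonal.antidiagonal a,
      MvPowerSeries.coeff cd.1 (Φ x) * MvPowerSeries.coeff cd.2 (Ψ x)) =
      ∑ cd ∈ Finset.HasAntidiagonal.antidiagonal a,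
        ev p (fun x => MvPowerSeries.coeff cd.1 (Φ x)) *
        ev p (fun x => MvPowerSeries.coeff cd.2 (Ψ x)) := by
    intro a
    rw [ev_sum p _ fun cd => (hΦ _).mul (hΨ _)]
    exact Finset.sum_congr rfl fun cd _ => ev_mul p (hΦ _) (hΨ _)
  simp only [e, map_sum, MvPowerSeries.coeff_mul, Finset.sum_mul_sum]
  exact sum_antidiagonal_comm m fun c d e f =>
    MvPowerSeries.coeff e (ev p fun x => MvPowerSeries.coeff c (Φ x)) *
      MvPowerSeries.coeff f (ev p fun x => MvPowerSeries.coeff d (Ψ x))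

theorem evSeries_C (p : FormalPoint A D) (F : (Fin D → ℂ) → ℂ) :
    evSeries p (fun x => MvPowerSeries.C (F x)) = ev p F := by
  ext m
  rw [coeff_evSeries, Finset.sum_eq_single (0, m)]
  · simp
  · rintro ⟨a, b⟩ h hne
    rw [Finset.HasAntidiagonal.mem_antidiagonal] at h
    have ha : a ≠ 0 := by
      rintro rfl
      exact hne (by simpa using h)
    simp only [MvPowerSeries.coeff_C, if_neg ha]
    rw [ev_const_zero, map_zero]
  · intro h
    exact absurd (Finset.HasAntidiagonal.mem_antidiagonal.2 (zero_add m)) h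

theorem isSmoothScalar_ev {Φ : FormalMap A D} (hΦ : IsSmooth Φ) {F : (Fin D → ℂ) → ℂ}
    (hF : ContDiff ℂ (⊤ : ℕ∞) F) : IsSmoothScalar fun x => ev (Φ x) F :=
  fun m => contDiff_ev hΦ hF m

theorem isSmoothScalar_evSeries {Φ : FormalMap A D} (hΦ : IsSmooth Φ)
    {Ψ : (Fin D → ℂ) → MvPowerSeries A ℂ} (hΨ : IsSmoothScalar Ψ) :
    IsSmoothScalar fun x => evSeries (Φ x) Ψ := fun m => by
  simp only [coeff_evSeries]
  exact ContDiff.sum fun ab _ => contDiff_ev hΦ (hΨ _) _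

theorem isSmooth_subst {Φ Ψ : FormalMap A D} (hΦ : IsSmooth Φ) (hΨ : IsSmooth Ψ) :
    IsSmooth fun x => subst Ψ (Φ x) :=
  isSmooth_of_coordSeries fun i => by
    simp only [coordSeries_subst hΨ]
    exact isSmoothScalar_evSeries hΦ (hΨ.coordSeries i)

/-- Associativity of substitution without expanding any Taylor series: the right side is a
homomorphism in `F` with the correct values on the coordinates. -/
theorem ev_subst {Φ : FormalMap A D} (hΦ : IsSmooth Φ) (p : FormalPoint A D)
    {F : (Fin D → ℂ) → ℂ} (hF : ContDiff ℂ (⊤ : ℕ∞) F) :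
    ev (subst Φ p) F = evSeries p fun x => ev (Φ x) F := by
  symm
  refine eq_ev_of_hom (T := fun F => evSeries p fun x => ev (Φ x) F) ?_ ?_ ?_ ?_ hF
  · intro c
    simp only [ev_const]
    rw [evSeries_C, ev_const]
  · intro F G hF hG
    simp only [ev_add _ hF hG]
    exact evSeries_add p (isSmoothScalar_ev hΦ hF) (isSmoothScalar_ev hΦ hG)
  · intro F G hF hG
    simp only [ev_mul _ hF hG]
    exact evSeries_mul p (isSmoothScalar_ev hΦ hF) (isSmoothScalar_ev hΦ hG)
  · intro i
    simp only [ev_coord]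
    exact (coordSeries_subst hΦ p i).symm

theorem evSeries_subst {Φ : FormalMap A D} (hΦ : IsSmooth Φ) (p : FormalPoint A D)
    {Ψ : (Fin D → ℂ) → MvPowerSeries A ℂ} (hΨ : IsSmoothScalar Ψ) :
    evSeries (subst Φ p) Ψ = evSeries p fun x => evSeries (Φ x) Ψ := by
  ext m
  have e1 : ∀ a : A →₀ ℕ, ev p (fun x => MvPowerSeries.coeff a (evSeries (Φ x) Ψ)) =
      ∑ cd ∈ Finset.HasAntidiagonal.antidiagonal a,
        ev p fun x => MvPowerSeries.coeff cd.2 (ev (Φ x) fun y => MvPowerSeries.coeff cd.1 (Ψ y)) :=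
    fun a => by
      simp only [coeff_evSeries]
      exact ev_sum p _ fun cd => contDiff_ev hΦ (hΨ _) _
  rw [coeff_evSeries, coeff_evSeries]
  simp only [e1, ev_subst hΦ p (hΨ _), map_sum]
  exact sum_antidiagonal_assoc m fun a c d => MvPowerSeries.coeff d
    (ev p fun x => MvPowerSeries.coeff c (ev (Φ x) fun y => MvPowerSeries.coeff a (Ψ y)))

theorem subst_subst {Φ Ψ : FormalMap A D} (hΦ : IsSmooth Φ) (hΨ : IsSmooth Ψ)
    (p : FormalPoint A D) : subst Ψ (subst Φ p) = subst (fun x => subst Ψ (Φ x)) p :=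
  formalPoint_ext fun i => by
    rw [coordSeries_subst hΨ, coordSeries_subst (isSmooth_subst hΦ hΨ),
      evSeries_subst hΦ p (hΨ.coordSeries i)]
    simp only [coordSeries_subst hΨ]

theorem coordSeries_pointSeries (x : Fin D → ℂ) (i : Fin D) :
    coordSeries (pointSeries x : FormalPoint A D) i = MvPowerSeries.C (x i) := by
  ext m
  rw [MvPowerSeries.coeff_C]
  show (pointSeries x : FormalPoint A D) m i = _
  rw [pointSeries]
  split_ifs <;> rfl

theorem coordSeries_mapSeries (G : (Fin D → ℂ) → (Fin D → ℂ)) (x : Fin D → ℂ) (i : Fin D) :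
    coordSeries (mapSeries G x : FormalPoint A D) i = MvPowerSeries.C (G x i) :=
  coordSeries_pointSeries (G x) i

theorem isSmooth_mapSeries {G : (Fin D → ℂ) → (Fin D → ℂ)} (hG : ContDiff ℂ (⊤ : ℕ∞) G) :
    IsSmooth (mapSeries G : FormalMap A D) := fun m => by
  simp only [mapSeries, pointSeries]
  split_ifs
  · exact hG
  · exact contDiff_const

theorem isSmooth_pointSeries : IsSmooth (pointSeries : FormalMap A D) :=
  isSmooth_mapSeries (G := fun x => x) contDiff_id

theorem coordSeries_subst_mapSeries {G : (Fin D → ℂ) → (Fin D → ℂ)}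
    (hG : ContDiff ℂ (⊤ : ℕ∞) G) (p : FormalPoint A D) (i : Fin D) :
    coordSeries (subst (mapSeries G) p) i = ev p fun x => G x i := by
  rw [coordSeries_subst (isSmooth_mapSeries hG)]
  simp only [coordSeries_mapSeries]
  exact evSeries_C p _

theorem subst_pointSeries_left (p : FormalPoint A D) : subst pointSeries p = p :=
  formalPoint_ext fun i => by
    rw [coordSeries_subst isSmooth_pointSeries]
    simp only [coordSeries_pointSeries]
    rw [evSeries_C, ev_coord]

theorem ev_pointSeries (x : Fin D → ℂ) {F : (Fin D → ℂ) → ℂ} (hF : ContDiff ℂ (⊤ : ℕ∞) F) :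
    ev (pointSeries x : FormalPoint A D) F = MvPowerSeries.C (F x) := by
  have hC : ∀ c : ℂ, euler (MvPowerSeries.C c : MvPowerSeries A ℂ) = 0 := by
    intro c
    ext b
    rw [coeff_euler, MvPowerSeries.coeff_C]
    split_ifs with h <;> simp [h]
  refine eq_of_euler ?_ ?_
  · rw [coeff_zero_ev, MvPowerSeries.coeff_C, if_pos rfl, pointSeries, if_pos rfl]
  · rw [euler_ev _ hF, hC]
    simp [coordSeries_pointSeries, hC]

theorem evSeries_pointSeries (x : Fin D → ℂ) {Φ : (Fin D → ℂ) → MvPowerSeries A ℂ}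
    (hΦ : IsSmoothScalar Φ) : evSeries (pointSeries x) Φ = Φ x := by
  ext m
  rw [coeff_evSeries, Finset.sum_eq_single (m, 0)]
  · rw [ev_pointSeries x (hΦ m), MvPowerSeries.coeff_C, if_pos rfl]
  · rintro ⟨a, b⟩ h hne
    rw [Finset.HasAntidiagonal.mem_antidiagonal] at h
    have hb : b ≠ 0 := by
      rintro rfl
      exact hne (by simpa using h)
    rw [ev_pointSeries x (hΦ a), MvPowerSeries.coeff_C, if_neg hb]
  · intro h
    exact absurd (Finset.HasAntidiagonal.mem_antidiagonal.2 (add_zero m)) h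

theorem subst_pointSeries_right {Φ : FormalMap A D} (hΦ : IsSmooth Φ) (x : Fin D → ℂ) :
    subst Φ (pointSeries x) = Φ x :=
  formalPoint_ext fun i => by
    rw [coordSeries_subst hΦ, evSeries_pointSeries x (hΦ.coordSeries i)]

theorem subst_add {Φ Ψ : FormalMap A D} (hΦ : IsSmooth Φ) (hΨ : IsSmooth Ψ)
    (p : FormalPoint A D) : subst (Φ + Ψ) p = subst Φ p + subst Ψ p :=
  formalPoint_ext fun i => by
    rw [coordSeries_subst (isSmooth_add hΦ hΨ)]
    refine (evSeries_add p (hΦ.coordSeries i) (hΨ.coordSeries i)).trans ?_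
    rw [← coordSeries_subst hΦ, ← coordSeries_subst hΨ]
    rfl

end Substitution

end WordSeries

end

noncomputable section

namespace WordSeries

/-! ### Words of given content -/

section Content

variable {A : Type*} [DecidableEq A]

/-- The number of occurrences of each letter in a word. -/
def content (w : List A) : A →₀ ℕ := Multiset.toFinsupp (w : Multiset A)

theorem content_append (w w' : List A) : content (w ++ w') = content w + content w' := by
  rw [content, ← Multiset.coe_add, map_add]
  rfl

theorem content_perm {w w' : List A} (h : w.Perm w') : content w = content w' := by
  rw [content, Multiset.coe_eq_coe.2 h]
  rfl

/-- The words of given content. -/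
def wordsOf (m : A →₀ ℕ) : Finset (List A) := (Multiset.lists (Finsupp.toMultiset m)).toFinset

theorem mem_wordsOf {m : A →₀ ℕ} {w : List A} : w ∈ wordsOf m ↔ content w = m := by
  rw [wordsOf, Multiset.mem_toFinset, Multiset.mem_lists_iff, content, Multiset.toFinsupp_eq_iff,
    eq_comm]
  rfl

theorem wordsOf_zero : wordsOf (0 : A →₀ ℕ) = {[]} := by
  ext w
  rw [mem_wordsOf, Finset.mem_singleton, content, Multiset.toFinsupp_eq_iff]
  simp

/-- A word of content `m` with a marked cut is the same as a pair of words whose contents add up to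
`m`. -/
theorem sum_wordsOf_split {V : Type*} [AddCommMonoid V] (m : A →₀ ℕ) (g : List A → List A → V) :
    ∑ w ∈ wordsOf m, ∑ j ∈ Finset.range (w.length + 1), g (w.take j) (w.drop j) =
      ∑ ab ∈ Finset.HasAntidiagonal.antidiagonal m,
        ∑ u ∈ wordsOf ab.1, ∑ w ∈ wordsOf ab.2, g u w := by
  simp only [Finset.sum_sigma']
  refine Finset.sum_nbij' (fun ⟨w, j⟩ => ⟨(content (w.take j), content (w.drop j)), w.take j,
    w.drop j⟩) (fun ⟨_, u, w⟩ => ⟨u ++ w, u.length⟩) ?_ ?_ ?_ ?_ (fun _ _ => rfl)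
  · rintro ⟨w, j⟩ h
    simp only [Finset.mem_sigma, Finset.HasAntidiagonal.mem_antidiagonal, mem_wordsOf,
      Finset.mem_range] at h ⊢
    rw [← content_append, List.take_append_drop, h.1]
    simp
  · rintro ⟨⟨a, b⟩, u, w⟩ h
    simp only [Finset.mem_sigma, Finset.HasAntidiagonal.mem_antidiagonal, mem_wordsOf,
      Finset.mem_range] at h ⊢
    obtain ⟨rfl, rfl, rfl⟩ := h
    exact ⟨content_append u w, by simp⟩
  · rintro ⟨w, j⟩ h
    simp only [Finset.mem_sigma, Finset.mem_range] at h
    simp only [List.take_append_drop, List.length_take]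
    rw [min_eq_left (by omega)]
  · rintro ⟨⟨a, b⟩, u, w⟩ h
    simp only [Finset.mem_sigma, Finset.HasAntidiagonal.mem_antidiagonal, mem_wordsOf] at h
    obtain ⟨rfl, rfl, rfl⟩ := h
    simp

/-- The pairs of words that have a given word as a shuffle, with multiplicities. -/
def deshuffle : List A → Multiset (List A × List A)
  | [] => {([], [])}
  | a :: w => (deshuffle w).map (fun u => (a :: u.1, u.2)) +
      (deshuffle w).map (fun u => (u.1, a :: u.2))

theorem count_map_cons (a c : A) (w : List A) (M : Multiset (List A)) :
    Multiset.count (c :: w) (M.map fun s => a :: s) = if c = a then Multiset.count w M else 0 := by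
  split_ifs with h
  · subst h
    exact Multiset.count_map_eq_count' _ M (fun x y h => (List.cons.inj h).2) w
  · rw [Multiset.count_eq_zero]
    simp only [Multiset.mem_map, not_exists, not_and]
    rintro s _ h'
    exact h (List.cons.inj h').1.symm

theorem count_map_cons_fst (a c : A) (u u' : List A) (M : Multiset (List A × List A)) :
    Multiset.count (c :: u, u') (M.map fun s => (a :: s.1, s.2)) =
      if c = a then Multiset.count (u, u') M else 0 := by
  split_ifs with h
  · subst h
    refine Multiset.count_map_eq_count' (fun s : List A × List A => (c :: s.1, s.2)) M ?_ (u, u')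
    rintro ⟨x, x'⟩ ⟨y, y'⟩ h
    simpa using h
  · rw [Multiset.count_eq_zero]
    simp only [Multiset.mem_map, not_exists, not_and, Prod.mk.injEq, List.cons.injEq]
    rintro s _ ⟨h', -⟩
    exact absurd h'.symm h

theorem count_map_cons_snd (a c : A) (u u' : List A) (M : Multiset (List A × List A)) :
    Multiset.count (u, c :: u') (M.map fun s => (s.1, a :: s.2)) =
      if c = a then Multiset.count (u, u') M else 0 := by
  split_ifs with h
  · subst h
    refine Multiset.count_map_eq_count' (fun s : List A × List A => (s.1, c :: s.2)) M ?_ (u, u')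
    rintro ⟨x, x'⟩ ⟨y, y'⟩ h
    simpa using h
  · rw [Multiset.count_eq_zero]
    simp only [Multiset.mem_map, not_exists, not_and, Prod.mk.injEq, List.cons.injEq]
    rintro s _ - h'
    exact absurd h'.symm h

theorem count_map_cons_fst_nil (a : A) (u' : List A) (M : Multiset (List A × List A)) :
    Multiset.count ([], u') (M.map fun s => (a :: s.1, s.2)) = 0 := by
  rw [Multiset.count_eq_zero]
  simp

theorem count_map_cons_snd_nil (a : A) (u : List A) (M : Multiset (List A × List A)) :
    Multiset.count (u, []) (M.map fun s => (s.1, a :: s.2)) = 0 := by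
  rw [Multiset.count_eq_zero]
  simp

/-- The duality between deshuffling and shuffling, checked on the first letter of `w`. -/
theorem count_deshuffle (w : List A) : ∀ u u' : List A,
    Multiset.count (u, u') (deshuffle w) = Multiset.count w (shuffle u u') := by
  induction w with
  | nil =>
    intro u u'
    by_cases h : u = [] ∧ u' = []
    · obtain ⟨rfl, rfl⟩ := h
      simp [deshuffle, shuffle_nil_left]
    · rw [Multiset.count_eq_zero.2, Multiset.count_eq_zero.2]
      · intro hs
        have := length_of_mem_shuffle hs
        simp only [List.length_nil] at this
        exact h ⟨List.length_eq_zero_iff.1 (by omega), List.length_eq_zero_iff.1 (by omega)⟩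
      · simpa [deshuffle] using h
  | cons c w ih =>
    intro u u'
    rw [deshuffle, Multiset.count_add]
    rcases u with _ | ⟨a, u⟩
    · rw [count_map_cons_fst_nil, zero_add]
      rcases u' with _ | ⟨b, u'⟩
      · rw [count_map_cons_snd_nil, shuffle_nil_left]
        simp
      · rw [count_map_cons_snd, ih, shuffle_nil_left, shuffle_nil_left,
          Multiset.count_singleton, Multiset.count_singleton]
        rcases eq_or_ne b c with rfl | h
        · simp
        · simp [h, h.symm]
    · rcases u' with _ | ⟨b, u'⟩
      · rw [count_map_cons_snd_nil, add_zero, count_map_cons_fst, ih, shuffle_nil_right,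
          shuffle_nil_right, Multiset.count_singleton, Multiset.count_singleton]
        rcases eq_or_ne a c with rfl | h
        · simp
        · simp [h, h.symm]
      · rw [count_map_cons_fst, count_map_cons_snd, ih, ih, shuffle_cons_cons, Multiset.count_add,
          count_map_cons, count_map_cons]
        simp only [eq_comm]

theorem sum_deshuffle {w : List A} {m : A →₀ ℕ} (hw : content w = m)
    (h : List A → List A → ℂ) :
    ((deshuffle w).map fun u => h u.1 u.2).sum =
      ∑ ab ∈ Finset.HasAntidiagonal.antidiagonal m, ∑ u ∈ wordsOf ab.1, ∑ u' ∈ wordsOf ab.2,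
        (Multiset.count w (shuffle u u') : ℂ) * h u u' := by
  rw [Finset.sum_multiset_map_count]
  simp only [nsmul_eq_mul, Finset.sum_sigma']
  refine Finset.sum_bij_ne_zero (fun u _ _ => ⟨(content u.1, content u.2), u.1, u.2⟩) ?_ ?_ ?_ ?_
  · rintro ⟨u, u'⟩ hu -
    rw [Multiset.mem_toFinset, ← Multiset.count_pos, count_deshuffle, Multiset.count_pos] at hu
    simp only [Finset.mem_sigma, Finset.HasAntidiagonal.mem_antidiagonal, mem_wordsOf, and_true]
    rw [← content_append, ← content_perm (perm_of_mem_shuffle hu), hw]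
  · rintro ⟨u, u'⟩ _ _ ⟨v, v'⟩ _ _ h
    simp only [Sigma.mk.injEq] at h
    obtain ⟨-, h⟩ := h
    have h' := eq_of_heq h
    grind
  · rintro ⟨⟨a, b⟩, u, u'⟩ hu hne
    simp only [Finset.mem_sigma, Finset.HasAntidiagonal.mem_antidiagonal, mem_wordsOf] at hu
    obtain ⟨-, rfl, rfl⟩ := hu
    have hc : Multiset.count w (shuffle u u') ≠ 0 := fun h0 => hne (by simp [h0])
    refine ⟨(u, u'), ?_, ?_, rfl⟩
    · rw [Multiset.mem_toFinset, ← Multiset.count_pos, count_deshuffle]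
      exact Nat.pos_of_ne_zero hc
    · rwa [count_deshuffle]
  · rintro ⟨u, u'⟩ _ _
    rw [count_deshuffle]

theorem coprod_eq_sum_count (δ : Coeff A) {u u' : List A} {m : A →₀ ℕ}
    (h : content u + content u' = m) :
    coprod δ u u' = ∑ w ∈ wordsOf m, (Multiset.count w (shuffle u u') : ℂ) * δ w := by
  refine (Finset.sum_multiset_map_count _ _).trans ?_
  simp only [nsmul_eq_mul]
  refine Finset.sum_subset (fun w hw => ?_) fun w _ hw => ?_
  · rw [Multiset.mem_toFinset] at hw
    rw [mem_wordsOf, content_perm (perm_of_mem_shuffle hw), content_append, h]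
  · rw [Multiset.mem_toFinset] at hw
    rw [Multiset.count_eq_zero.2 hw, Nat.cast_zero, zero_mul]

/-- Transposes deshuffling into `coprod`. It carries the shuffle relations over to the Leibniz rule
of the operators `E_w`. -/
theorem sum_mul_deshuffle (δ : Coeff A) (m : A →₀ ℕ) (h : List A → List A → ℂ) :
    ∑ w ∈ wordsOf m, δ w * ((deshuffle w).map fun u => h u.1 u.2).sum =
      ∑ ab ∈ Finset.HasAntidiagonal.antidiagonal m, ∑ u ∈ wordsOf ab.1, ∑ u' ∈ wordsOf ab.2,
        coprod δ u u' * h u u' := by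
  rw [Finset.sum_congr rfl fun w hw => by rw [sum_deshuffle (mem_wordsOf.1 hw)]]
  simp only [Finset.mul_sum]
  rw [Finset.sum_comm]
  refine Finset.sum_congr rfl fun ab hab => ?_
  rw [Finset.sum_comm]
  refine Finset.sum_congr rfl fun u hu => ?_
  rw [Finset.sum_comm]
  refine Finset.sum_congr rfl fun u' hu' => ?_
  rw [mem_wordsOf] at hu hu'
  rw [coprod_eq_sum_count δ (m := m)
    (by rw [hu, hu', Finset.HasAntidiagonal.mem_antidiagonal.1 hab]), Finset.sum_mul]
  exact Finset.sum_congr rfl fun w _ => by ring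

end Content

end WordSeries

end

noncomputable section

namespace WordSeries

/-! ### The differential operators attached to words -/

section WordOperators

variable {A : Type*} {D : ℕ} {f : A → (Fin D → ℂ) → (Fin D → ℂ)}

/-- The operator `E_w`: `E_∅` is the identity and `E_{ℓw} F = (E_w F)' f_ℓ`. -/
def opWord (f : A → (Fin D → ℂ) → (Fin D → ℂ)) :
    List A → ((Fin D → ℂ) → ℂ) → (Fin D → ℂ) → ℂ
  | [], F => F
  | ℓ :: w, F => fun x => fderiv ℂ (opWord f w F) x (f ℓ x)

theorem contDiff_opWord (hf : ∀ ℓ, ContDiff ℂ (⊤ : ℕ∞) (f ℓ)) (w : List A)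
    {F : (Fin D → ℂ) → ℂ} (hF : ContDiff ℂ (⊤ : ℕ∞) F) : ContDiff ℂ (⊤ : ℕ∞) (opWord f w F) := by
  induction w with
  | nil => exact hF
  | cons ℓ w ih => exact (ih.fderiv_right (m := (⊤ : ℕ∞)) (by simp)).clm_apply (hf ℓ)

theorem opWord_append (w w' : List A) (F : (Fin D → ℂ) → ℂ) :
    opWord f (w ++ w') F = opWord f w (opWord f w' F) := by
  induction w with
  | nil => rfl
  | cons ℓ w ih =>
    funext x
    show fderiv ℂ (opWord f (w ++ w') F) x (f ℓ x) = _
    rw [ih]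
    rfl

theorem contDiff_wordFun (hf : ∀ ℓ, ContDiff ℂ (⊤ : ℕ∞) (f ℓ)) (w : List A) :
    ContDiff ℂ (⊤ : ℕ∞) (wordFun f w) := by
  induction w with
  | nil => exact contDiff_id
  | cons ℓ w ih => exact (ih.fderiv_right (m := (⊤ : ℕ∞)) (by simp)).clm_apply (hf ℓ)

theorem fderiv_apply_coord {G : (Fin D → ℂ) → (Fin D → ℂ)} (hG : ContDiff ℂ (⊤ : ℕ∞) G)
    (x u : Fin D → ℂ) (i : Fin D) :
    fderiv ℂ G x u i = fderiv ℂ (fun y => G y i) x u := by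
  have h := hasFDerivAt_pi'.1 (hG.differentiable (by simp) x).hasFDerivAt i
  rw [h.fderiv]
  rfl

/-- Word series are the values of operator series on the coordinate functions, so their identities
can be proved for operators acting on all smooth functions. -/
theorem wordFun_apply (hf : ∀ ℓ, ContDiff ℂ (⊤ : ℕ∞) (f ℓ)) (w : List A) (i : Fin D) :
    (fun x => wordFun f w x i) = opWord f w fun x => x i := by
  induction w with
  | nil => rfl
  | cons ℓ w ih =>
    funext x
    show fderiv ℂ (wordFun f w) x (f ℓ x) i = fderiv ℂ (opWord f w fun x => x i) x (f ℓ x)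
    rw [fderiv_apply_coord (contDiff_wordFun hf w), ih]

theorem opWord_add (hf : ∀ ℓ, ContDiff ℂ (⊤ : ℕ∞) (f ℓ)) (w : List A) {F G : (Fin D → ℂ) → ℂ}
    (hF : ContDiff ℂ (⊤ : ℕ∞) F) (hG : ContDiff ℂ (⊤ : ℕ∞) G) :
    opWord f w (fun x => F x + G x) = fun x => opWord f w F x + opWord f w G x := by
  induction w with
  | nil => rfl
  | cons ℓ w ih =>
    funext x
    simp only [opWord, ih]
    rw [fderiv_fun_add ((contDiff_opWord hf w hF).differentiable (by simp) x)
      ((contDiff_opWord hf w hG).differentiable (by simp) x)]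
    rfl

theorem opWord_const (ℓ : A) (w : List A) (c : ℂ) :
    opWord f (ℓ :: w) (fun _ => c) = fun _ => 0 := by
  induction w generalizing ℓ with
  | nil => funext x; simp [opWord]
  | cons ℓ' w ih =>
    funext x
    rw [opWord, ih ℓ']
    simp

theorem fderiv_multiset_sum {ι : Type*} (M : Multiset ι) {h : ι → (Fin D → ℂ) → ℂ}
    (hh : ∀ s, ContDiff ℂ (⊤ : ℕ∞) (h s)) (x u : Fin D → ℂ) :
    ContDiff ℂ (⊤ : ℕ∞) (fun y => (M.map fun s => h s y).sum) ∧
    fderiv ℂ (fun y => (M.map fun s => h s y).sum) x u =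
      (M.map fun s => fderiv ℂ (h s) x u).sum := by
  induction M using Multiset.induction with
  | empty => simp [contDiff_const]
  | cons s M ih =>
    simp only [Multiset.map_cons, Multiset.sum_cons]
    refine ⟨(hh s).add ih.1, ?_⟩
    rw [fderiv_fun_add ((hh s).differentiable (by simp) x) (ih.1.differentiable (by simp) x),
      ← ih.2]
    rfl

/-- Each letter of `w` differentiates either `F` or `G`; the letters falling on each factor keep
their order, which is a deshuffle of `w`. -/
theorem opWord_mul (hf : ∀ ℓ, ContDiff ℂ (⊤ : ℕ∞) (f ℓ)) (w : List A) {F G : (Fin D → ℂ) → ℂ}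
    (hF : ContDiff ℂ (⊤ : ℕ∞) F) (hG : ContDiff ℂ (⊤ : ℕ∞) G) :
    opWord f w (fun x => F x * G x) = fun x =>
      ((deshuffle w).map fun u => opWord f u.1 F x * opWord f u.2 G x).sum := by
  induction w with
  | nil => funext x; simp [opWord, deshuffle]
  | cons ℓ w ih =>
    funext x
    show fderiv ℂ (opWord f w fun x => F x * G x) x (f ℓ x) = _
    rw [ih, (fderiv_multiset_sum _ (fun u : List A × List A =>
      (contDiff_opWord hf u.1 hF).mul (contDiff_opWord hf u.2 hG)) x _).2, deshuffle,
      Multiset.map_add, Multiset.sum_add, Multiset.map_map, Multiset.map_map,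
      ← Multiset.sum_map_add]
    refine congrArg Multiset.sum (Multiset.map_congr rfl fun u _ => ?_)
    rw [fderiv_fun_mul ((contDiff_opWord hf u.1 hF).differentiable (by simp) x)
      ((contDiff_opWord hf u.2 hG).differentiable (by simp) x)]
    simp only [add_apply, smul_apply, smul_eq_mul, Function.comp, opWord]
    ring

theorem opWord_const_mul (hf : ∀ ℓ, ContDiff ℂ (⊤ : ℕ∞) (f ℓ)) (w : List A) (c : ℂ)
    {F : (Fin D → ℂ) → ℂ} (hF : ContDiff ℂ (⊤ : ℕ∞) F) :
    opWord f w (fun x => c * F x) = fun x => c * opWord f w F x := by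
  induction w with
  | nil => rfl
  | cons ℓ w ih =>
    funext x
    simp only [opWord, ih]
    rw [fderiv_const_mul ((contDiff_opWord hf w hF).differentiable (by simp) x)]
    rfl

theorem opWord_sum (hf : ∀ ℓ, ContDiff ℂ (⊤ : ℕ∞) (f ℓ)) (w : List A) {ι : Type*} (s : Finset ι)
    (c : ι → ℂ) {F : ι → (Fin D → ℂ) → ℂ} (hF : ∀ j, ContDiff ℂ (⊤ : ℕ∞) (F j)) (x : Fin D → ℂ) :
    opWord f w (fun x => ∑ j ∈ s, c j * F j x) x = ∑ j ∈ s, c j * opWord f w (F j) x := by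
  induction s using Finset.cons_induction generalizing x with
  | empty =>
    rcases w with _ | ⟨ℓ, w⟩
    · rfl
    · simp [opWord_const]
  | cons a s _ ih =>
    simp only [Finset.sum_cons]
    have e : opWord f w (fun x => c a * F a x + ∑ j ∈ s, c j * F j x) x =
        opWord f w (fun x => c a * F a x) x + opWord f w (fun x => ∑ j ∈ s, c j * F j x) x :=
      congrFun (opWord_add hf w (contDiff_const.mul (hF a))
        (ContDiff.sum fun j _ => contDiff_const.mul (hF j))) x
    rw [e, ih, opWord_const_mul hf w _ (hF a)]

/-! ### Series of operators -/

variable [DecidableEq A]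

/-- The series of operators `∑_w δ_w E_w`, applied to a function. -/
def opSeries (f : A → (Fin D → ℂ) → (Fin D → ℂ)) (δ : Coeff A) (F : (Fin D → ℂ) → ℂ)
    (x : Fin D → ℂ) : MvPowerSeries A ℂ := fun m => ∑ w ∈ wordsOf m, δ w * opWord f w F x

theorem coeff_opSeries (δ : Coeff A) (F : (Fin D → ℂ) → ℂ) (x : Fin D → ℂ) (m : A →₀ ℕ) :
    MvPowerSeries.coeff m (opSeries f δ F x) = ∑ w ∈ wordsOf m, δ w * opWord f w F x := rfl

theorem isSmoothScalar_opSeries (hf : ∀ ℓ, ContDiff ℂ (⊤ : ℕ∞) (f ℓ)) (δ : Coeff A)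
    {F : (Fin D → ℂ) → ℂ} (hF : ContDiff ℂ (⊤ : ℕ∞) F) : IsSmoothScalar (opSeries f δ F) :=
  fun m => by
    simp only [coeff_opSeries]
    exact ContDiff.sum fun w _ => contDiff_const.mul (contDiff_opWord hf w hF)

theorem coordSeries_wordSeries (hf : ∀ ℓ, ContDiff ℂ (⊤ : ℕ∞) (f ℓ)) (δ : Coeff A)
    (x : Fin D → ℂ) (i : Fin D) :
    coordSeries (wordSeries f δ x) i = opSeries f δ (fun y => y i) x := by
  ext m
  show wordSeries f δ x m i = _
  rw [coeff_opSeries, wordSeries, Finset.sum_apply]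
  refine Finset.sum_congr rfl fun w _ => ?_
  rw [← wordFun_apply hf]
  rfl

theorem isSmooth_wordSeries (hf : ∀ ℓ, ContDiff ℂ (⊤ : ℕ∞) (f ℓ)) (δ : Coeff A) :
    IsSmooth (wordSeries f δ) := isSmooth_of_coordSeries fun i => by
  simp only [coordSeries_wordSeries hf]
  exact isSmoothScalar_opSeries hf δ (contDiff_coord i)

theorem opSeries_add (hf : ∀ ℓ, ContDiff ℂ (⊤ : ℕ∞) (f ℓ)) (δ : Coeff A) {F G : (Fin D → ℂ) → ℂ}
    (hF : ContDiff ℂ (⊤ : ℕ∞) F) (hG : ContDiff ℂ (⊤ : ℕ∞) G) (x : Fin D → ℂ) :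
    opSeries f δ (fun x => F x + G x) x = opSeries f δ F x + opSeries f δ G x := by
  ext m
  simp only [map_add, coeff_opSeries, opWord_add hf _ hF hG, mul_add, Finset.sum_add_distrib]

theorem opSeries_const (δ : Coeff A) (c : ℂ) (x : Fin D → ℂ) :
    opSeries f δ (fun _ => c) x = MvPowerSeries.C (δ [] * c) := by
  ext m
  rw [coeff_opSeries, MvPowerSeries.coeff_C]
  split_ifs with h
  · rw [h, wordsOf_zero, Finset.sum_singleton]
    rfl
  · refine Finset.sum_eq_zero fun w hw => ?_
    rcases w with _ | ⟨ℓ, w⟩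
    · exact absurd (mem_wordsOf.1 hw).symm (by simpa [content] using h)
    · rw [opWord_const, mul_zero]

theorem coeff_opSeries_mul (hf : ∀ ℓ, ContDiff ℂ (⊤ : ℕ∞) (f ℓ)) (δ : Coeff A)
    {F G : (Fin D → ℂ) → ℂ} (hF : ContDiff ℂ (⊤ : ℕ∞) F) (hG : ContDiff ℂ (⊤ : ℕ∞) G)
    (x : Fin D → ℂ) (m : A →₀ ℕ) :
    MvPowerSeries.coeff m (opSeries f δ (fun x => F x * G x) x) =
      ∑ ab ∈ Finset.HasAntidiagonal.antidiagonal m, ∑ u ∈ wordsOf ab.1, ∑ u' ∈ wordsOf ab.2,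
        coprod δ u u' * (opWord f u F x * opWord f u' G x) := by
  simp only [coeff_opSeries, opWord_mul hf _ hF hG]
  exact sum_mul_deshuffle δ m fun u u' => opWord f u F x * opWord f u' G x

theorem coeff_opSeries_mul_opSeries (α β : Coeff A) (F G : (Fin D → ℂ) → ℂ) (x : Fin D → ℂ)
    (m : A →₀ ℕ) : MvPowerSeries.coeff m (opSeries f α F x * opSeries f β G x) =
      ∑ ab ∈ Finset.HasAntidiagonal.antidiagonal m, ∑ u ∈ wordsOf ab.1, ∑ u' ∈ wordsOf ab.2,
        tens α β u u' * (opWord f u F x * opWord f u' G x) := by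
  rw [MvPowerSeries.coeff_mul]
  refine Finset.sum_congr rfl fun ab _ => ?_
  rw [coeff_opSeries, coeff_opSeries, Finset.sum_mul_sum]
  refine Finset.sum_congr rfl fun u _ => Finset.sum_congr rfl fun u' _ => ?_
  rw [tens]
  ring

/-- The operators attached to the elements of the group are homomorphisms. -/
theorem opSeries_mul_of_mem_groupG (hf : ∀ ℓ, ContDiff ℂ (⊤ : ℕ∞) (f ℓ)) {γ : Coeff A}
    (hγ : γ ∈ groupG A) {F G : (Fin D → ℂ) → ℂ} (hF : ContDiff ℂ (⊤ : ℕ∞) F)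
    (hG : ContDiff ℂ (⊤ : ℕ∞) G) (x : Fin D → ℂ) :
    opSeries f γ (fun x => F x * G x) x = opSeries f γ F x * opSeries f γ G x := by
  ext m
  rw [coeff_opSeries_mul hf γ hF hG, coeff_opSeries_mul_opSeries, (mem_groupG_iff.1 hγ).2]

theorem opSeries_one (F : (Fin D → ℂ) → ℂ) (x : Fin D → ℂ) :
    opSeries f 1 F x = MvPowerSeries.C (F x) := by
  ext m
  rw [coeff_opSeries, MvPowerSeries.coeff_C]
  split_ifs with h
  · rw [h, wordsOf_zero, Finset.sum_singleton, Coeff.one_nil, one_mul]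
    rfl
  · refine Finset.sum_eq_zero fun w hw => ?_
    rcases w with _ | ⟨ℓ, w⟩
    · exact absurd (mem_wordsOf.1 hw).symm (by simpa [content] using h)
    · rw [Coeff.one_cons, zero_mul]

/-- The operators attached to the elements of the Lie algebra are derivations. -/
theorem opSeries_mul_of_mem_lieG (hf : ∀ ℓ, ContDiff ℂ (⊤ : ℕ∞) (f ℓ)) {β : Coeff A}
    (hβ : β ∈ lieG A) {F G : (Fin D → ℂ) → ℂ} (hF : ContDiff ℂ (⊤ : ℕ∞) F)
    (hG : ContDiff ℂ (⊤ : ℕ∞) G) (x : Fin D → ℂ) :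
    opSeries f β (fun x => F x * G x) x =
      opSeries f β F x * MvPowerSeries.C (G x) + MvPowerSeries.C (F x) * opSeries f β G x := by
  rw [← opSeries_one (f := f) G x, ← opSeries_one (f := f) F x]
  ext m
  rw [map_add, coeff_opSeries_mul hf β hF hG, coeff_opSeries_mul_opSeries,
    coeff_opSeries_mul_opSeries, mem_lieG_iff.1 hβ]
  simp only [← Finset.sum_add_distrib]
  refine Finset.sum_congr rfl fun ab _ => Finset.sum_congr rfl fun u _ =>
    Finset.sum_congr rfl fun u' _ => ?_
  rw [← add_mul]
  rfl

/-- The value of a function at a word series of the group. -/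
theorem ev_wordSeries (hf : ∀ ℓ, ContDiff ℂ (⊤ : ℕ∞) (f ℓ)) {γ : Coeff A} (hγ : γ ∈ groupG A)
    {F : (Fin D → ℂ) → ℂ} (hF : ContDiff ℂ (⊤ : ℕ∞) F) (x : Fin D → ℂ) :
    ev (wordSeries f γ x) F = opSeries f γ F x := by
  symm
  refine eq_ev_of_hom (T := fun F => opSeries f γ F x) ?_ ?_ ?_ ?_ hF
  · intro c
    rw [opSeries_const, hγ.1, one_mul]
  · intro F G hF hG
    exact opSeries_add hf γ hF hG x
  · intro F G hF hG
    exact opSeries_mul_of_mem_groupG hf hγ hF hG x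
  · intro i
    exact (coordSeries_wordSeries hf γ x i).symm

/-- The operator attached to an element of the Lie algebra is the derivative along the
vector field given by its word series. -/
theorem opSeries_eq_sum_pd (hf : ∀ ℓ, ContDiff ℂ (⊤ : ℕ∞) (f ℓ)) {β : Coeff A} (hβ : β ∈ lieG A)
    {F : (Fin D → ℂ) → ℂ} (hF : ContDiff ℂ (⊤ : ℕ∞) F) (x : Fin D → ℂ) (m : A →₀ ℕ) :
    MvPowerSeries.coeff m (opSeries f β F x) = fderiv ℂ F x (wordSeries f β x m) := by
  rw [fderiv_eq_sum_pd]
  refine (eq_sum_pd_of_derivation (x := x)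
    (T := fun F => MvPowerSeries.coeff m (opSeries f β F x)) ?_ ?_ ?_ hF).trans ?_
  · intro F G hF hG
    simp only [opSeries_add hf β hF hG, map_add]
  · intro F G hF hG
    simp only [opSeries_mul_of_mem_lieG hf hβ hF hG, map_add, MvPowerSeries.coeff_mul_C,
      MvPowerSeries.coeff_C_mul]
  · intro c
    simp only [opSeries_const, hβ.1, zero_mul, map_zero]
  · refine Finset.sum_congr rfl fun i _ => ?_
    simp only [← coordSeries_wordSeries hf]
    rfl

/-- Composition of operators corresponds to `⋆`, because `E_{uw} = E_u E_w`. -/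
theorem coeff_opSeries_conv (hf : ∀ ℓ, ContDiff ℂ (⊤ : ℕ∞) (f ℓ)) (β δ : Coeff A)
    {F : (Fin D → ℂ) → ℂ} (hF : ContDiff ℂ (⊤ : ℕ∞) F) (x : Fin D → ℂ) (m : A →₀ ℕ) :
    MvPowerSeries.coeff m (opSeries f (β * δ) F x) =
      ∑ ab ∈ Finset.HasAntidiagonal.antidiagonal m, MvPowerSeries.coeff ab.2
        (opSeries f β (fun y => MvPowerSeries.coeff ab.1 (opSeries f δ F y)) x) := by
  have e1 : ∀ a b : A →₀ ℕ, MvPowerSeries.coeff b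
      (opSeries f β (fun y => MvPowerSeries.coeff a (opSeries f δ F y)) x) =
      ∑ u ∈ wordsOf b, ∑ w ∈ wordsOf a, β u * δ w * opWord f (u ++ w) F x := by
    intro a b
    simp only [coeff_opSeries]
    refine Finset.sum_congr rfl fun u _ => ?_
    rw [opWord_sum hf u (wordsOf a) (fun w => δ w) fun w => contDiff_opWord hf w hF,
      Finset.mul_sum]
    refine Finset.sum_congr rfl fun w _ => ?_
    rw [opWord_append]
    ring
  simp only [e1]
  -- The inner operator carries the right part of the word but the first degree, hence the swap
  -- before cutting words.
  rw [Finsupp.sum_antidiagonal_swap m fun a b =>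
    ∑ u ∈ wordsOf b, ∑ w ∈ wordsOf a, β u * δ w * opWord f (u ++ w) F x,
    ← sum_wordsOf_split m fun u w => β u * δ w * opWord f (u ++ w) F x, coeff_opSeries]
  refine Finset.sum_congr rfl fun w _ => ?_
  rw [Coeff.mul_apply, Finset.sum_mul]
  refine Finset.sum_congr rfl fun j _ => ?_
  rw [List.take_append_drop]

theorem evSeries_opSeries (hf : ∀ ℓ, ContDiff ℂ (⊤ : ℕ∞) (f ℓ)) {γ : Coeff A} (hγ : γ ∈ groupG A)
    (δ : Coeff A) {F : (Fin D → ℂ) → ℂ} (hF : ContDiff ℂ (⊤ : ℕ∞) F) (x : Fin D → ℂ) :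
    evSeries (wordSeries f γ x) (opSeries f δ F) = opSeries f (γ * δ) F x := by
  ext m
  rw [coeff_evSeries, coeff_opSeries_conv hf γ δ hF]
  refine Finset.sum_congr rfl fun ab _ => ?_
  rw [ev_wordSeries hf hγ (isSmoothScalar_opSeries hf δ hF _)]

/-- The composition of word series. -/
theorem subst_wordSeries (hf : ∀ ℓ, ContDiff ℂ (⊤ : ℕ∞) (f ℓ)) {γ : Coeff A} (hγ : γ ∈ groupG A)
    (δ : Coeff A) (x : Fin D → ℂ) :
    subst (wordSeries f δ) (wordSeries f γ x) = wordSeries f (γ * δ) x :=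
  formalPoint_ext fun i => by
    rw [coordSeries_subst (isSmooth_wordSeries hf δ), coordSeries_wordSeries hf]
    simp only [coordSeries_wordSeries hf]
    exact evSeries_opSeries hf hγ δ (contDiff_coord i) x

theorem wordSeries_one (hf : ∀ ℓ, ContDiff ℂ (⊤ : ℕ∞) (f ℓ)) :
    wordSeries f (1 : Coeff A) = pointSeries := by
  funext x
  refine formalPoint_ext fun i => ?_
  rw [coordSeries_wordSeries hf, opSeries_one, coordSeries_pointSeries]

/-- The derivative of a word series along the vector field given by a word series. -/
theorem jacobianMul_wordSeries (hf : ∀ ℓ, ContDiff ℂ (⊤ : ℕ∞) (f ℓ)) (δ : Coeff A) {β : Coeff A}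
    (hβ : β ∈ lieG A) :
    jacobianMul (wordSeries f δ) (wordSeries f β) = wordSeries f (β * δ) := by
  funext x
  refine formalPoint_ext fun i => ?_
  rw [coordSeries_wordSeries hf]
  ext m
  show jacobianMul (wordSeries f δ) (wordSeries f β) x m i = _
  rw [coeff_opSeries_conv hf β δ (contDiff_coord i), jacobianMul, Finset.sum_apply]
  refine Finset.sum_congr rfl fun ab _ => ?_
  rw [fderiv_apply_coord (isSmooth_wordSeries hf δ ab.1),
    opSeries_eq_sum_pd hf hβ (isSmoothScalar_opSeries hf δ (contDiff_coord i) _)]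
  simp only [← coordSeries_wordSeries hf]
  rfl

end WordOperators

end WordSeries

end

noncomputable section

namespace WordSeries

/-! ### Commutation with the fields `g^v` -/

section Brackets

variable {A : Type*} {d D : ℕ} {ν : Fin d → A → ℂ} {g : Fin d → (Fin D → ℂ) → (Fin D → ℂ)}
  {f : A → (Fin D → ℂ) → (Fin D → ℂ)}

theorem contDiff_gField (h : IsPerturbedSystem ν g f) (v : Fin d → ℂ) :
    ContDiff ℂ (⊤ : ℕ∞) (gField g v) :=
  ContDiff.sum fun j _ => (h.smooth_g j).const_smul (v j)

theorem contDiff_gField_coord (h : IsPerturbedSystem ν g f) (v : Fin d → ℂ) (i : Fin D) :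
    ContDiff ℂ (⊤ : ℕ∞) fun y => gField g v y i :=
  (contDiff_coord i).comp (contDiff_gField h v)

theorem lieBracket_gField (h : IsPerturbedSystem ν g f) (v : Fin d → ℂ) (ℓ : A)
    (x : Fin D → ℂ) :
    fderiv ℂ (f ℓ) x (gField g v x) - fderiv ℂ (gField g v) x (f ℓ x) =
      nuWord ν v [ℓ] • f ℓ x := by
  have e : fderiv ℂ (gField g v) x = ∑ j, v j • fderiv ℂ (g j) x := by
    have h1 : ∀ j, DifferentiableAt ℂ (g j) x := fun j => (h.smooth_g j).differentiable (by simp) x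
    have h2 : HasFDerivAt (gField g v) (∑ j, v j • fderiv ℂ (g j) x) x :=
      HasFDerivAt.fun_sum fun j _ => (h1 j).hasFDerivAt.const_smul (v j)
    exact h2.fderiv
  rw [e, gField, map_sum, sum_apply, ← Finset.sum_sub_distrib]
  simp only [nuWord, List.map_cons, List.map_nil, List.sum_cons, List.sum_nil, add_zero,
    Finset.sum_smul]
  refine Finset.sum_congr rfl fun j _ => ?_
  rw [map_smul, smul_apply, ← smul_sub, mul_smul, ← h.eigen j ℓ x]
  rfl

/-- The derivative along the field `g^v`. -/
def gDeriv (g : Fin d → (Fin D → ℂ) → (Fin D → ℂ)) (v : Fin d → ℂ) (F : (Fin D → ℂ) → ℂ) :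
    (Fin D → ℂ) → ℂ := fun x => fderiv ℂ F x (gField g v x)

theorem contDiff_gDeriv (h : IsPerturbedSystem ν g f) (v : Fin d → ℂ) {F : (Fin D → ℂ) → ℂ}
    (hF : ContDiff ℂ (⊤ : ℕ∞) F) : ContDiff ℂ (⊤ : ℕ∞) (gDeriv g v F) :=
  (hF.fderiv_right (m := (⊤ : ℕ∞)) (by simp)).clm_apply (contDiff_gField h v)

theorem fderiv_fderiv_field {F : (Fin D → ℂ) → ℂ} (hF : ContDiff ℂ (⊤ : ℕ∞) F)
    {V : (Fin D → ℂ) → (Fin D → ℂ)} (hV : ContDiff ℂ (⊤ : ℕ∞) V) (x u : Fin D → ℂ) :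
    fderiv ℂ (fun y => fderiv ℂ F y (V y)) x u =
      fderiv ℂ (fderiv ℂ F) x u (V x) + fderiv ℂ F x (fderiv ℂ V x u) := by
  have h : DifferentiableAt ℂ (fderiv ℂ F) x :=
    ((hF.fderiv_right (m := (⊤ : ℕ∞)) (by simp)).differentiable (by simp)) x
  rw [fderiv_clm_apply h (hV.differentiable (by simp) x)]
  simp [add_comm]

/-- In the commutator of the two directional derivatives the second derivatives of `F` cancel by
symmetry, leaving the derivative along `[g^v, f_ℓ] = ν f_ℓ`. -/
theorem gDeriv_opWord_singleton (h : IsPerturbedSystem ν g f) (v : Fin d → ℂ) (ℓ : A)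
    {F : (Fin D → ℂ) → ℂ} (hF : ContDiff ℂ (⊤ : ℕ∞) F) (x : Fin D → ℂ) :
    gDeriv g v (opWord f [ℓ] F) x =
      opWord f [ℓ] (gDeriv g v F) x + nuWord ν v [ℓ] * opWord f [ℓ] F x := by
  show fderiv ℂ (fun y => fderiv ℂ F y (f ℓ y)) x (gField g v x) =
    fderiv ℂ (fun y => fderiv ℂ F y (gField g v y)) x (f ℓ x) +
      nuWord ν v [ℓ] * fderiv ℂ F x (f ℓ x)
  rw [fderiv_fderiv_field hF (h.smooth_f ℓ), fderiv_fderiv_field hF (contDiff_gField h v),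
    ← fderiv_fderiv_apply hF, ← fderiv_fderiv_apply hF, fderiv_fderiv_comm hF, ← smul_eq_mul,
    ← map_smul, ← lieBracket_gField h, map_sub]
  ring

theorem gDeriv_opWord (h : IsPerturbedSystem ν g f) (v : Fin d → ℂ) (w : List A)
    {F : (Fin D → ℂ) → ℂ} (hF : ContDiff ℂ (⊤ : ℕ∞) F) (x : Fin D → ℂ) :
    gDeriv g v (opWord f w F) x =
      opWord f w (gDeriv g v F) x + nuWord ν v w * opWord f w F x := by
  induction w generalizing x with
  | nil => simp [opWord, nuWord]
  | cons ℓ w ih =>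
    have hw := contDiff_opWord h.smooth_f w hF
    have hw' := contDiff_opWord h.smooth_f w (contDiff_gDeriv h v hF)
    rw [show ℓ :: w = [ℓ] ++ w from rfl, opWord_append, opWord_append,
      gDeriv_opWord_singleton h v ℓ hw, funext ih,
      opWord_add h.smooth_f _ hw' (contDiff_const.mul hw), opWord_const_mul h.smooth_f _ _ hw,
      nuWord_append]
    ring

variable [DecidableEq A]

theorem opSeries_add_left (α β : Coeff A) (F : (Fin D → ℂ) → ℂ) (x : Fin D → ℂ) :
    opSeries f (α + β) F x = opSeries f α F x + opSeries f β F x := by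
  ext m
  simp only [map_add, coeff_opSeries, Coeff.add_apply, add_mul, Finset.sum_add_distrib]

theorem jacobianMul_mapSeries_right (Φ : FormalMap A D) (V : (Fin D → ℂ) → (Fin D → ℂ))
    (x : Fin D → ℂ) (m : A →₀ ℕ) :
    jacobianMul Φ (mapSeries V) x m = fderiv ℂ (fun y => Φ y m) x (V x) := by
  rw [jacobianMul, Finset.sum_eq_single (m, 0)]
  · simp [mapSeries, pointSeries]
  · rintro ⟨a, b⟩ h hne
    rw [Finset.HasAntidiagonal.mem_antidiagonal] at h
    have hb : b ≠ 0 := by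
      rintro rfl
      exact hne (by simpa using h)
    simp [mapSeries, pointSeries, hb]
  · intro h
    exact absurd (Finset.HasAntidiagonal.mem_antidiagonal.2 (add_zero m)) h

theorem jacobianMul_mapSeries_left (V : (Fin D → ℂ) → (Fin D → ℂ)) (Φ : FormalMap A D)
    (x : Fin D → ℂ) (m : A →₀ ℕ) :
    jacobianMul (mapSeries V) Φ x m = fderiv ℂ V x (Φ x m) := by
  rw [jacobianMul, Finset.sum_eq_single (0, m)]
  · simp [mapSeries, pointSeries]
  · rintro ⟨a, b⟩ h hne
    rw [Finset.HasAntidiagonal.mem_antidiagonal] at h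
    have ha : a ≠ 0 := by
      rintro rfl
      exact hne (by simpa using h)
    simp [mapSeries, pointSeries, ha]
  · intro h
    exact absurd (Finset.HasAntidiagonal.mem_antidiagonal.2 (zero_add m)) h

theorem jacobianMul_add_right (Φ V W : FormalMap A D) :
    jacobianMul Φ (V + W) = jacobianMul Φ V + jacobianMul Φ W := by
  funext x m
  simp only [jacobianMul, Pi.add_apply, map_add, Finset.sum_add_distrib]

theorem gDeriv_coord (v : Fin d → ℂ) (i : Fin D) :
    gDeriv g v (fun x => x i) = fun x => gField g v x i := by
  funext x
  have : fderiv ℂ (fun y : Fin D → ℂ => y i) x = ContinuousLinearMap.proj i :=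
    (ContinuousLinearMap.proj (R := ℂ) (φ := fun _ : Fin D => ℂ) i).fderiv
  rw [gDeriv, this]
  rfl

/-- Moving the `g^v`-derivative through every `E_w` leaves it acting on the coordinate, which gives
a component of `g^v`, and the commutators add up to the series of `ξ_v δ`. -/
theorem coordSeries_jacobianMul_gField (h : IsPerturbedSystem ν g f) (v : Fin d → ℂ)
    (δ : Coeff A) (x : Fin D → ℂ) (i : Fin D) :
    coordSeries (jacobianMul (wordSeries f δ) (mapSeries (gField g v)) x) i =
      opSeries f δ (fun y => gField g v y i) x + opSeries f (xi ν v δ) (fun y => y i) x := by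
  ext m
  show jacobianMul (wordSeries f δ) (mapSeries (gField g v)) x m i = _
  rw [jacobianMul_mapSeries_right, fderiv_apply_coord (isSmooth_wordSeries h.smooth_f δ m)]
  have e : (fun y => wordSeries f δ y m i) =
      fun y => ∑ w ∈ wordsOf m, δ w * opWord f w (fun y => y i) y := by
    funext y
    exact congrFun (coordSeries_wordSeries h.smooth_f δ y i) m
  have hw : ∀ w, ContDiff ℂ (⊤ : ℕ∞) (opWord f w fun y => y i) := fun w =>
    contDiff_opWord h.smooth_f w (contDiff_coord (D := D) i)
  rw [e, fderiv_fun_sum (A := fun w y => δ w * opWord f w (fun y => y i) y) fun w _ =>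
    (contDiff_const.mul (hw w)).differentiable (by simp) x, sum_apply, map_add, coeff_opSeries,
    coeff_opSeries, ← Finset.sum_add_distrib]
  refine Finset.sum_congr rfl fun w _ => ?_
  rw [fderiv_const_mul ((hw w).differentiable (by simp) x), ← gDeriv_coord]
  show δ w * gDeriv g v (opWord f w fun y => y i) x = _
  rw [gDeriv_opWord h v w (contDiff_coord i), xi]
  ring

theorem formalBracket_gField (h : IsPerturbedSystem ν g f) (u : Fin d → ℂ) {β : Coeff A}
    (hβ : β ∈ lieG A) (hu : xi ν u β = 0) :
    formalBracket (mapSeries (gField g u)) (wordSeries f β) = 0 := by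
  rw [formalBracket, sub_eq_zero]
  funext x
  refine formalPoint_ext fun i => ?_
  rw [coordSeries_jacobianMul_gField h, hu]
  have h0 : opSeries f (0 : Coeff A) (fun y => y i) x = 0 := by
    ext m
    simp [coeff_opSeries]
  rw [h0, add_zero]
  ext m
  rw [opSeries_eq_sum_pd h.smooth_f hβ (contDiff_gField_coord h u i)]
  show _ = jacobianMul (mapSeries (gField g u)) (wordSeries f β) x m i
  rw [jacobianMul_mapSeries_left, fderiv_apply_coord (contDiff_gField h u)]

theorem subst_extField (h : IsPerturbedSystem ν g f) (v : Fin d → ℂ) (β : Coeff A)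
    (p : FormalPoint A D) : subst (extField g f (v, β)) p =
      subst (mapSeries (gField g v)) p + subst (wordSeries f β) p :=
  subst_add (isSmooth_mapSeries (contDiff_gField h v)) (isSmooth_wordSeries h.smooth_f β) p

theorem transformsInto_normalForm (h : IsPerturbedSystem ν g f) (v : Fin d → ℂ)
    {κ : (Coeff A)ˣ} {β βh : Coeff A} (hκ : (κ : Coeff A) ∈ groupG A) (hβh : βh ∈ lieG A)
    (e : βh = gaugeAction ν v κ β) :
    TransformsInto (wordSeries f κ) (extField g f (v, β)) (extField g f (v, βh)) := by
  have hf := h.smooth_f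
  have hcomp : ∀ (γ γ' : Coeff A), γ ∈ groupG A → γ * γ' = 1 → ∀ p : FormalPoint A D,
      subst (wordSeries f γ') (subst (wordSeries f γ) p) = p := by
    intro γ γ' hγ e p
    rw [subst_subst (isSmooth_wordSeries hf γ) (isSmooth_wordSeries hf γ')]
    simp only [subst_wordSeries hf hγ, e, wordSeries_one hf]
    exact subst_pointSeries_left p
  refine ⟨⟨isSmooth_wordSeries hf _, wordSeries f (κ⁻¹ : (Coeff A)ˣ), isSmooth_wordSeries hf _,
    fun p => ⟨hcomp _ _ hκ κ.mul_inv p, hcomp _ _ (inv_mem_groupG hκ) κ.inv_mul p⟩⟩, fun x => ?_⟩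
  rw [subst_extField h, subst_wordSeries hf hκ, extField, jacobianMul_add_right,
    jacobianMul_wordSeries hf _ hβh]
  -- The definition of the gauge action multiplied by `κ` from the right; this identity of families
  -- is the whole conjugacy equation, once the terms with `g^v` are seen to agree.
  have e' : xi ν v κ + βh * κ = κ * β := by
    rw [e, gaugeAction, ← sub_mul, mul_assoc, κ.inv_mul, mul_one, add_sub_cancel]
  refine formalPoint_ext fun i => ?_
  show coordSeries (jacobianMul (wordSeries f κ) (mapSeries (gField g v)) x) i +
      coordSeries (wordSeries f (βh * κ) x) i =
    coordSeries (subst (mapSeries (gField g v)) (wordSeries f κ x)) i +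
      coordSeries (wordSeries f (κ * β) x) i
  rw [coordSeries_jacobianMul_gField h, coordSeries_subst_mapSeries (contDiff_gField h v),
    ev_wordSeries hf hκ (contDiff_gField_coord h v i),
    coordSeries_wordSeries hf, coordSeries_wordSeries hf, ← e', opSeries_add_left, add_assoc]

end Brackets

end WordSeries

end

noncomputable section

namespace WordSeries

/-! ### The flows of the fields `g^v` -/

section Flows

theorem solution_unique {E : Type*} [NormedAddCommGroup E] [NormedSpace ℂ E] {G : E → E}
    (hG : ContDiff ℂ (⊤ : ℕ∞) G) {a b : ℝ → E} (ha : ∀ t, HasDerivAt a (G (a t)) t)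
    (hb : ∀ t, HasDerivAt b (G (b t)) t) (h0 : a 0 = b 0) : a = b := by
  funext t
  have hac : Continuous a := continuous_iff_continuousAt.2 fun t => (ha t).continuousAt
  have hbc : Continuous b := continuous_iff_continuousAt.2 fun t => (hb t).continuousAt
  set I := Set.Icc (-(|t| + 1)) (|t| + 1) with hI
  -- Both trajectories over a bounded time interval lie in one compact set, on which the smooth
  -- field is Lipschitz.
  have hK : IsCompact (a '' I ∪ b '' I) :=
    (isCompact_Icc.image hac).union (isCompact_Icc.image hbc)
  have hl : LocallyLipschitz G := (hG.of_le (by exact_mod_cast le_top)).locallyLipschitz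
  obtain ⟨C, hC⟩ := hl.locallyLipschitzOn.exists_lipschitzOnWith_of_compact hK
  have hsub : Set.Ioo (-(|t| + 1)) (|t| + 1) ⊆ I := Set.Ioo_subset_Icc_self
  have hpos : (0 : ℝ) < |t| + 1 := by positivity
  have key := ODE_solution_unique_of_mem_Ioo (v := fun _ => G)
    (s := fun _ => a '' I ∪ b '' I) (t₀ := 0) (f := a) (g := b) (fun _ _ => hC)
    ⟨by linarith, hpos⟩
    (fun s hs => ⟨ha s, Or.inl ⟨s, hsub hs, rfl⟩⟩) (fun s hs => ⟨hb s, Or.inr ⟨s, hsub hs, rfl⟩⟩) h0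
  exact key ⟨by linarith [neg_abs_le t], by linarith [le_abs_self t]⟩

theorem hasDerivAt_comp_real {E : Type*} [NormedAddCommGroup E] [NormedSpace ℂ E] {K : E → ℂ}
    (hK : ContDiff ℂ (⊤ : ℕ∞) K) {c : ℝ → E} {c' : E} {t : ℝ} (hc : HasDerivAt c c' t) :
    HasDerivAt (fun s => K (c s)) (fderiv ℂ K (c t) c') t :=
  ((hK.differentiable (by simp) (c t)).hasFDerivAt.restrictScalars ℝ).comp_hasDerivAt t hc

theorem fderiv_slice {E : Type*} [NormedAddCommGroup E] [NormedSpace ℂ E] {K : ℂ × E → ℂ}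
    (hK : ContDiff ℂ (⊤ : ℕ∞) K) (c : ℂ) (x u : E) :
    fderiv ℂ (fun z => K (c, z)) x u = fderiv ℂ K (c, x) (0, u) := by
  have h1 : HasFDerivAt K (fderiv ℂ K (c, x)) (c, x) :=
    (hK.differentiable (by simp) _).hasFDerivAt
  have h2 : HasFDerivAt (fun z : E => (c, z)) (ContinuousLinearMap.inr ℂ ℂ E) x :=
    (hasFDerivAt_const c x).prodMk (hasFDerivAt_id x)
  have h3 : HasFDerivAt (fun z => K (c, z)) _ x := HasFDerivAt.comp x h1 h2
  rw [h3.fderiv]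
  simp

variable {A : Type*} {d D : ℕ} {ν : Fin d → A → ℂ} {g : Fin d → (Fin D → ℂ) → (Fin D → ℂ)}
  {f : A → (Fin D → ℂ) → (Fin D → ℂ)} {φ : (Fin d → ℂ) → (Fin D → ℂ) → (Fin D → ℂ)}

theorem contDiff_flow (hφ : IsFlow g φ) (v : Fin d → ℂ) : ContDiff ℂ (⊤ : ℕ∞) (φ v) :=
  hφ.smooth.comp (contDiff_const.prodMk contDiff_id)

theorem flow_flow (h : IsPerturbedSystem ν g f) (hφ : IsFlow g φ) (v : Fin d → ℂ) (s t : ℝ)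
    (x : Fin D → ℂ) :
    φ ((s : ℂ) • v) (φ ((t : ℂ) • v) x) = φ (((s + t : ℝ) : ℂ) • v) x := by
  have e := solution_unique (contDiff_gField h v)
    (a := fun s : ℝ => φ ((s : ℂ) • v) (φ ((t : ℂ) • v) x))
    (b := fun s : ℝ => φ (((s + t : ℝ) : ℂ) • v) x) (fun s => hφ.deriv v _ s)
    (fun s => by simpa using (hφ.deriv v x (s + t)).comp_add_const s t) (by simp [hφ.zero])
  exact congrFun e s

theorem flow_neg_flow (h : IsPerturbedSystem ν g f) (hφ : IsFlow g φ) (v : Fin d → ℂ) (t : ℝ)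
    (x : Fin D → ℂ) : φ (((-t : ℝ) : ℂ) • v) (φ ((t : ℂ) • v) x) = x := by
  rw [flow_flow h hφ]
  simp [hφ.zero]

theorem flow_flow_neg (h : IsPerturbedSystem ν g f) (hφ : IsFlow g φ) (v : Fin d → ℂ) (t : ℝ)
    (x : Fin D → ℂ) : φ ((t : ℂ) • v) (φ (((-t : ℝ) : ℂ) • v) x) = x := by
  rw [flow_flow h hφ]
  simp [hφ.zero]

/-- The curve `φ_{tv}(φ_{sv}(x)) = φ_{(t+s)v}(x)` is differentiated at `s = 0` in both forms. -/
theorem fderiv_flow_gField (h : IsPerturbedSystem ν g f) (hφ : IsFlow g φ) (v : Fin d → ℂ)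
    (t : ℝ) (x : Fin D → ℂ) :
    fderiv ℂ (φ ((t : ℂ) • v)) x (gField g v x) = gField g v (φ ((t : ℂ) • v) x) := by
  have h1 : HasDerivAt (fun s : ℝ => φ ((t : ℂ) • v) (φ ((s : ℂ) • v) x))
      (fderiv ℂ (φ ((t : ℂ) • v)) x (gField g v x)) 0 := by
    have hd := hφ.deriv v x 0
    have hz : φ (((0 : ℝ) : ℂ) • v) x = x := by simp [hφ.zero]
    rw [hz] at hd
    have hF : HasFDerivAt (φ ((t : ℂ) • v))
        ((fderiv ℂ (φ ((t : ℂ) • v)) x).restrictScalars ℝ) (φ (((0 : ℝ) : ℂ) • v) x) := by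
      rw [hz]
      exact ((contDiff_flow hφ _).differentiable (by simp) x).hasFDerivAt.restrictScalars ℝ
    exact hF.comp_hasDerivAt 0 hd
  have h2 : HasDerivAt (fun s : ℝ => φ ((t : ℂ) • v) (φ ((s : ℂ) • v) x))
      (gField g v (φ ((t : ℂ) • v) x)) 0 := by
    simp only [flow_flow h hφ]
    have := HasDerivAt.comp_const_add t 0 (f := fun s : ℝ => φ ((s : ℂ) • v) x)
      (by simpa using hφ.deriv v x t)
    simpa using this
  exact h1.unique h2

theorem gDeriv_comp_flow (h : IsPerturbedSystem ν g f) (hφ : IsFlow g φ) (v : Fin d → ℂ) (t : ℝ)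
    {F : (Fin D → ℂ) → ℂ} (hF : ContDiff ℂ (⊤ : ℕ∞) F) (x : Fin D → ℂ) :
    gDeriv g v (fun y => F (φ ((t : ℂ) • v) y)) x = gDeriv g v F (φ ((t : ℂ) • v) x) := by
  rw [gDeriv, fderiv_fun_comp x (hF.differentiable (by simp) _)
    ((contDiff_flow hφ _).differentiable (by simp) x)]
  show fderiv ℂ F _ (fderiv ℂ (φ ((t : ℂ) • v)) x (gField g v x)) = _
  rw [fderiv_flow_gField h hφ]
  rfl

theorem contDiff_comp_flow (hφ : IsFlow g φ) (v : Fin d → ℂ) {F : (Fin D → ℂ) → ℂ}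
    (hF : ContDiff ℂ (⊤ : ℕ∞) F) :
    ContDiff ℂ (⊤ : ℕ∞) fun z : ℂ × (Fin D → ℂ) => F (φ (z.1 • v) z.2) :=
  hF.comp (hφ.smooth.comp ((contDiff_fst.smul contDiff_const).prodMk contDiff_snd))

/-- The flow equation is assumed for real times only; the complex time derivative exists by
smoothness and is determined by its restriction to the real line. -/
theorem fderiv_comp_flow_time (hφ : IsFlow g φ) (v : Fin d → ℂ) {F : (Fin D → ℂ) → ℂ}
    (hF : ContDiff ℂ (⊤ : ℕ∞) F) (t : ℝ) (x : Fin D → ℂ) :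
    fderiv ℂ (fun z : ℂ × (Fin D → ℂ) => F (φ (z.1 • v) z.2)) ((t : ℂ), x) (1, 0) =
      gDeriv g v F (φ ((t : ℂ) • v) x) := by
  have h3 : HasDerivAt (fun s : ℝ => ((s : ℂ), x)) ((1 : ℂ), (0 : Fin D → ℂ)) t :=
    (Complex.ofRealCLM.hasDerivAt (x := t)).prodMk (hasDerivAt_const t x)
  exact (hasDerivAt_comp_real (contDiff_comp_flow hφ v hF) h3).unique
    (hasDerivAt_comp_real hF (hφ.deriv v x t))

/-- With `K(s, z) = E_ℓ(F ∘ φ_{sv})(z)` and `y = φ_{tv}(x)`, the quantity `exp(s ν) K(s,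
φ_{-sv}(y))` is constant in `s`; its values at `s = t` and `s = 0` are compared. -/
theorem opWord_singleton_comp_flow (h : IsPerturbedSystem ν g f) (hφ : IsFlow g φ)
    (v : Fin d → ℂ) (t : ℝ) (ℓ : A) {F : (Fin D → ℂ) → ℂ} (hF : ContDiff ℂ (⊤ : ℕ∞) F)
    (x : Fin D → ℂ) :
    opWord f [ℓ] (fun y => F (φ ((t : ℂ) • v) y)) x =
      Complex.exp (-((t : ℂ) * nuWord ν v [ℓ])) * opWord f [ℓ] F (φ ((t : ℂ) • v) x) := by
  set Q : ℂ × (Fin D → ℂ) → ℂ := fun z => F (φ (z.1 • v) z.2) with hQdef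
  have hQ : ContDiff ℂ (⊤ : ℕ∞) Q := contDiff_comp_flow hφ v hF
  -- Viewing `f_ℓ` as a field on time and space makes the joint smoothness of `K` evident.
  set V : ℂ × (Fin D → ℂ) → ℂ × (Fin D → ℂ) := fun z => (0, f ℓ z.2) with hVdef
  have hV : ContDiff ℂ (⊤ : ℕ∞) V := contDiff_const.prodMk ((h.smooth_f ℓ).comp contDiff_snd)
  set K : ℂ × (Fin D → ℂ) → ℂ := fun z => fderiv ℂ Q z (V z) with hKdef
  have hQ' : ContDiff ℂ (⊤ : ℕ∞) (fderiv ℂ Q) := hQ.fderiv_right (m := (⊤ : ℕ∞)) (by simp)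
  have hK : ContDiff ℂ (⊤ : ℕ∞) K := hQ'.clm_apply hV
  have hKs : ∀ (s : ℂ) (z : Fin D → ℂ), K (s, z) = opWord f [ℓ] (fun y => Q (s, y)) z :=
    fun s z => (fderiv_slice hQ s z (f ℓ z)).symm
  have hdt : ∀ (s : ℝ) (z : Fin D → ℂ), fderiv ℂ K ((s : ℂ), z) (1, 0) =
      opWord f [ℓ] (gDeriv g v fun y => Q ((s : ℂ), y)) z := by
    intro s z
    have e1 : fderiv ℂ K ((s : ℂ), z) (1, 0) =
        fderiv ℂ (fderiv ℂ Q) ((s : ℂ), z) (1, 0) (0, f ℓ z) := by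
      have hV' : fderiv ℂ V ((s : ℂ), z) (1, 0) = 0 := by
        have h1 : HasFDerivAt V _ ((s : ℂ), z) := (hasFDerivAt_const (0 : ℂ) ((s : ℂ), z)).prodMk
          (((h.smooth_f ℓ).differentiable (by simp) z).hasFDerivAt.comp ((s : ℂ), z)
            hasFDerivAt_snd)
        rw [h1.fderiv]
        simp
      rw [hKdef, fderiv_clm_apply (hQ'.differentiable (by simp) _)
        (hV.differentiable (by simp) _)]
      simp only [add_apply, ContinuousLinearMap.comp_apply, hV', map_zero, zero_add,
        ContinuousLinearMap.flip_apply]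
      rfl
    -- The time derivative of `F ∘ φ_{sv}` equals its derivative along `g^v`, because the flow
    -- preserves its own field.
    have e2 : (gDeriv g v fun y => Q ((s : ℂ), y)) = fun y => fderiv ℂ Q ((s : ℂ), y) (1, 0) := by
      funext y
      rw [fderiv_comp_flow_time hφ v hF]
      exact gDeriv_comp_flow h hφ v s hF y
    rw [e1, ← fderiv_fderiv_apply hQ, fderiv_fderiv_comm hQ, e2]
    exact (fderiv_slice (contDiff_fderiv_apply hQ _) (s : ℂ) z (f ℓ z)).symm
  set y := φ ((t : ℂ) • v) x with hy
  have hk : ∀ s : ℝ, HasDerivAt (fun s : ℝ => K ((s : ℂ), φ (((-s : ℝ) : ℂ) • v) y))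
      (-(nuWord ν v [ℓ] * K ((s : ℂ), φ (((-s : ℝ) : ℂ) • v) y))) s := by
    intro s
    set z := φ (((-s : ℝ) : ℂ) • v) y with hz
    have h2 : HasDerivAt (fun s : ℝ => φ (((-s : ℝ) : ℂ) • v) y) (-gField g v z) s := by
      have h5 : HasDerivAt (fun s : ℝ => φ (((-s : ℝ) : ℂ) • v) y)
        ((-1 : ℝ) • gField g v z) s := HasDerivAt.scomp s (hφ.deriv v y (-s)) (hasDerivAt_neg s)
      rwa [neg_one_smul] at h5
    have h3 : HasDerivAt (fun s : ℝ => ((s : ℂ), φ (((-s : ℝ) : ℂ) • v) y))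
        ((1 : ℂ), -gField g v z) s := (Complex.ofRealCLM.hasDerivAt (x := s)).prodMk h2
    refine (hasDerivAt_comp_real hK h3).congr_deriv ?_
    show fderiv ℂ K ((s : ℂ), z) (1, -gField g v z) = _
    -- The derivative along the curve is `E_ℓ g^v - g^v E_ℓ` applied to `F ∘ φ_{sv}`, which is the
    -- commutator relation with the factor `-ν`.
    have e3 : ((1 : ℂ), -gField g v z) = (1, 0) - (0, gField g v z) := by simp
    rw [e3, map_sub, hdt, ← fderiv_slice hK, hKs]
    simp only [hKs]
    have := gDeriv_opWord_singleton h v ℓ (contDiff_slice hQ s) z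
    rw [gDeriv] at this
    rw [this]
    ring
  have hc : ∀ s : ℝ, HasDerivAt (fun s : ℝ => Complex.exp ((s : ℂ) * nuWord ν v [ℓ]) *
      K ((s : ℂ), φ (((-s : ℝ) : ℂ) • v) y)) 0 s := by
    intro s
    have h1 : HasDerivAt (fun s : ℝ => Complex.exp ((s : ℂ) * nuWord ν v [ℓ]))
        (Complex.exp ((s : ℂ) * nuWord ν v [ℓ]) * (1 * nuWord ν v [ℓ])) s :=
      ((Complex.ofRealCLM.hasDerivAt (x := s)).mul_const _).cexp
    refine (h1.mul (hk s)).congr_deriv ?_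
    ring
  have hconst := is_const_of_deriv_eq_zero (fun s => (hc s).differentiableAt)
    (fun s => (hc s).deriv) t 0
  simp only [hKs, hy, flow_neg_flow h hφ] at hconst
  simp only [hQdef, Complex.ofReal_zero, zero_mul, Complex.exp_zero, one_mul, neg_zero, zero_smul,
    hφ.zero] at hconst
  rw [← hconst, ← mul_assoc, ← Complex.exp_add]
  simp

theorem opWord_comp_flow (h : IsPerturbedSystem ν g f) (hφ : IsFlow g φ) (v : Fin d → ℂ) (t : ℝ)
    (w : List A) {F : (Fin D → ℂ) → ℂ} (hF : ContDiff ℂ (⊤ : ℕ∞) F) (x : Fin D → ℂ) :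
    opWord f w (fun y => F (φ ((t : ℂ) • v) y)) x =
      Complex.exp (-((t : ℂ) * nuWord ν v w)) * opWord f w F (φ ((t : ℂ) • v) x) := by
  induction w generalizing x with
  | nil => simp [opWord, nuWord]
  | cons ℓ w ih =>
    have hw := contDiff_opWord h.smooth_f w hF
    have hw' : ContDiff ℂ (⊤ : ℕ∞) fun x => opWord f w F (φ ((t : ℂ) • v) x) :=
      hw.comp (contDiff_flow hφ _)
    rw [show ℓ :: w = [ℓ] ++ w from rfl, opWord_append, opWord_append, nuWord_append, funext ih,
      opWord_const_mul h.smooth_f _ _ hw']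
    beta_reduce
    rw [opWord_singleton_comp_flow h hφ v t ℓ hw, ← mul_assoc, ← Complex.exp_add]
    congr 2
    ring

/-- On the resonant words, the only ones in the support of `δ`, the exponential factor is `1`. -/
theorem opSeries_comp_flow [DecidableEq A] (h : IsPerturbedSystem ν g f) (hφ : IsFlow g φ)
    (v : Fin d → ℂ) (t : ℝ) {δ : Coeff A} (hδ : ∀ w, nuWord ν v w ≠ 0 → δ w = 0)
    {F : (Fin D → ℂ) → ℂ} (hF : ContDiff ℂ (⊤ : ℕ∞) F) (x : Fin D → ℂ) :
    opSeries f δ (fun y => F (φ ((t : ℂ) • v) y)) x = opSeries f δ F (φ ((t : ℂ) • v) x) := by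
  ext m
  simp only [coeff_opSeries, opWord_comp_flow h hφ v t _ hF]
  refine Finset.sum_congr rfl fun w _ => ?_
  by_cases hw : nuWord ν v w = 0
  · simp [hw]
  · simp [hδ w hw]

end Flows

end WordSeries

end

noncomputable section

namespace WordSeries

/-! ### Curves of formal points -/

section Curves

variable {A : Type*} [DecidableEq A] {d D : ℕ} {ν : Fin d → A → ℂ}
  {g : Fin d → (Fin D → ℂ) → (Fin D → ℂ)} {f : A → (Fin D → ℂ) → (Fin D → ℂ)}
  {φ : (Fin d → ℂ) → (Fin D → ℂ) → (Fin D → ℂ)}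

/-- The chain rule along `W_β` at a formal point. It transports `opSeries_eq_sum_pd` from points `x`
to `p`; the rest is a reordering of the three degrees involved. -/
theorem sum_ev_pd_mul_coordSeries_subst (hf : ∀ ℓ, ContDiff ℂ (⊤ : ℕ∞) (f ℓ)) {β : Coeff A}
    (hβ : β ∈ lieG A) {F : (Fin D → ℂ) → ℂ} (hF : ContDiff ℂ (⊤ : ℕ∞) F) (p : FormalPoint A D) :
    ∑ i, ev p (pd i F) * coordSeries (subst (wordSeries f β) p) i =
      evSeries p (opSeries f β F) := by
  ext m
  have hW := isSmooth_wordSeries hf β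
  have e1 : ∀ a : A →₀ ℕ, ev p (fun x => MvPowerSeries.coeff a (opSeries f β F x)) =
      ∑ i, ev p (pd i F) * ev p fun x => wordSeries f β x a i := by
    intro a
    simp only [opSeries_eq_sum_pd hf hβ hF, fderiv_eq_sum_pd]
    have hc : ∀ i, ContDiff ℂ (⊤ : ℕ∞) fun x => wordSeries f β x a i := fun i =>
      (contDiff_coord i).comp (hW a)
    rw [ev_sum p Finset.univ (F := fun i x => pd i F x * wordSeries f β x a i) fun i =>
      (contDiff_pd i hF).mul (hc i)]
    exact Finset.sum_congr rfl fun i _ => ev_mul p (contDiff_pd i hF) (hc i)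
  have e2 : ∀ i, coordSeries (subst (wordSeries f β) p) i =
      evSeries p fun x => coordSeries (wordSeries f β x) i := coordSeries_subst hW p
  rw [coeff_evSeries]
  simp only [e1, e2, map_sum, MvPowerSeries.coeff_mul, coeff_evSeries]
  refine Eq.trans ?_ Finset.sum_comm
  refine Finset.sum_congr rfl fun i _ => ?_
  simp only [Finset.mul_sum]
  rw [sum_antidiagonal_assoc m fun b a c => MvPowerSeries.coeff b (ev p (pd i F)) *
    MvPowerSeries.coeff c (ev p fun x => MvPowerSeries.coeff a (coordSeries (wordSeries f β x) i))]
  refine Eq.trans ?_ (sum_antidiagonal_assoc m fun a b c => MvPowerSeries.coeff b (ev p (pd i F)) *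
    MvPowerSeries.coeff c
      (ev p fun x => MvPowerSeries.coeff a (coordSeries (wordSeries f β x) i))).symm
  refine Finset.sum_congr rfl fun ab _ => ?_
  exact Finsupp.sum_antidiagonal_swap ab.1 fun b a => MvPowerSeries.coeff b (ev p (pd i F)) *
    MvPowerSeries.coeff ab.2
      (ev p fun x => MvPowerSeries.coeff a (coordSeries (wordSeries f β x) i))

theorem hasDerivAt_ev_const {X : ℝ → FormalPoint A D} {X' : FormalPoint A D} {t : ℝ}
    (hX : ∀ m, HasDerivAt (fun s => X s m) (X' m) t) {F : (Fin D → ℂ) → ℂ}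
    (hF : ContDiff ℂ (⊤ : ℕ∞) F) (b : A →₀ ℕ) :
    HasDerivAt (fun s : ℝ => MvPowerSeries.coeff b (ev (X s) F))
      (MvPowerSeries.coeff b (∑ i, ev (X t) (pd i F) * coordSeries X' i)) t := by
  have hH : ContDiff ℂ (⊤ : ℕ∞) fun z : ℂ × (Fin D → ℂ) => F z.2 := hF.comp contDiff_snd
  have h0 : ∀ x, paramDt (fun z : ℂ × (Fin D → ℂ) => F z.2) ((t : ℂ), x) = 0 := by
    intro x
    have h1 : HasFDerivAt (fun z : ℂ × (Fin D → ℂ) => F z.2) _ ((t : ℂ), x) :=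
      ((hF.differentiable (by simp) x).hasFDerivAt).comp ((t : ℂ), x) hasFDerivAt_snd
    rw [paramDt, h1.fderiv]
    simp
  refine (hasDerivAt_ev hX hH b).congr_deriv ?_
  simp only [evDeriv, ← pd_param hH, h0]
  rw [ev_const_zero, zero_add]

theorem coeff_evSeries_opSeries (hf : ∀ ℓ, ContDiff ℂ (⊤ : ℕ∞) (f ℓ)) (δ : Coeff A)
    {F : (Fin D → ℂ) → ℂ} (hF : ContDiff ℂ (⊤ : ℕ∞) F) (p : FormalPoint A D) (m : A →₀ ℕ) :
    MvPowerSeries.coeff m (evSeries p (opSeries f δ F)) =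
      ∑ ab ∈ Finset.HasAntidiagonal.antidiagonal m, ∑ w ∈ wordsOf ab.1,
        δ w * MvPowerSeries.coeff ab.2 (ev p (opWord f w F)) := by
  rw [coeff_evSeries]
  refine Finset.sum_congr rfl fun ab _ => ?_
  have hw : ∀ w, ContDiff ℂ (⊤ : ℕ∞) (opWord f w F) := fun w => contDiff_opWord hf w hF
  simp only [coeff_opSeries]
  rw [ev_sum p _ (F := fun w x => δ w * opWord f w F x) fun w => contDiff_const.mul (hw w), map_sum]
  refine Finset.sum_congr rfl fun w _ => ?_
  rw [ev_const_mul p _ (hw w), MvPowerSeries.coeff_C_mul]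

theorem coeff_evSeries_opSeries_mul (hf : ∀ ℓ, ContDiff ℂ (⊤ : ℕ∞) (f ℓ)) (β δ : Coeff A)
    {F : (Fin D → ℂ) → ℂ} (hF : ContDiff ℂ (⊤ : ℕ∞) F) (p : FormalPoint A D) (m : A →₀ ℕ) :
    MvPowerSeries.coeff m (evSeries p (opSeries f (β * δ) F)) =
      ∑ ab ∈ Finset.HasAntidiagonal.antidiagonal m, ∑ w ∈ wordsOf ab.1,
        δ w * MvPowerSeries.coeff ab.2 (evSeries p (opSeries f β (opWord f w F))) := by
  simp only [coeff_evSeries_opSeries hf β (contDiff_opWord hf _ hF), Finset.mul_sum,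
    ← opWord_append]
  have e1 : ∀ ab : (A →₀ ℕ) × (A →₀ ℕ), (∑ w ∈ wordsOf ab.1,
      ∑ cd ∈ Finset.HasAntidiagonal.antidiagonal ab.2, ∑ u ∈ wordsOf cd.1,
        δ w * (β u * MvPowerSeries.coeff cd.2 (ev p (opWord f (u ++ w) F)))) =
      ∑ cd ∈ Finset.HasAntidiagonal.antidiagonal ab.2, ∑ w ∈ wordsOf ab.1, ∑ u ∈ wordsOf cd.1,
        δ w * (β u * MvPowerSeries.coeff cd.2 (ev p (opWord f (u ++ w) F))) :=
    fun ab => Finset.sum_comm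
  simp only [e1]
  rw [sum_antidiagonal_assoc m fun a b c => ∑ w ∈ wordsOf a, ∑ u ∈ wordsOf b,
    δ w * (β u * MvPowerSeries.coeff c (ev p (opWord f (u ++ w) F))),
    coeff_evSeries_opSeries hf _ hF]
  refine Finset.sum_congr rfl fun ab _ => ?_
  rw [Finsupp.sum_antidiagonal_swap ab.1 fun a b => ∑ w ∈ wordsOf a, ∑ u ∈ wordsOf b,
    δ w * (β u * MvPowerSeries.coeff ab.2 (ev p (opWord f (u ++ w) F)))]
  have e2 : ∀ cd : (A →₀ ℕ) × (A →₀ ℕ), (∑ w ∈ wordsOf cd.2, ∑ u ∈ wordsOf cd.1,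
      δ w * (β u * MvPowerSeries.coeff ab.2 (ev p (opWord f (u ++ w) F)))) =
      ∑ u ∈ wordsOf cd.1, ∑ w ∈ wordsOf cd.2,
        δ w * (β u * MvPowerSeries.coeff ab.2 (ev p (opWord f (u ++ w) F))) :=
    fun cd => Finset.sum_comm
  simp only [e2]
  rw [← sum_wordsOf_split ab.1 fun u w =>
    δ w * (β u * MvPowerSeries.coeff ab.2 (ev p (opWord f (u ++ w) F)))]
  refine Finset.sum_congr rfl fun w _ => ?_
  rw [Coeff.mul_apply, Finset.sum_mul]
  refine Finset.sum_congr rfl fun j _ => ?_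
  rw [List.take_append_drop]
  ring

theorem subst_wordSeries_apply (hf : ∀ ℓ, ContDiff ℂ (⊤ : ℕ∞) (f ℓ)) (δ : Coeff A)
    (p : FormalPoint A D) (m : A →₀ ℕ) (i : Fin D) : subst (wordSeries f δ) p m i =
      MvPowerSeries.coeff m (evSeries p (opSeries f δ fun y => y i)) := by
  have h := coordSeries_subst (isSmooth_wordSeries hf δ) p i
  simp only [coordSeries_wordSeries hf] at h
  exact congrFun h m

theorem subst_wordSeries_zero (hf : ∀ ℓ, ContDiff ℂ (⊤ : ℕ∞) (f ℓ)) (p : FormalPoint A D) :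
    subst (wordSeries f 0) p = 0 := by
  funext m i
  rw [subst_wordSeries_apply hf, coeff_evSeries_opSeries hf _ (contDiff_coord i)]
  simp

/-- The derivative of `W_{e(t)}(Z(t))` along a solution of `dZ/dt = W_β(Z)`. -/
theorem hasDerivAt_subst_wordSeries (hf : ∀ ℓ, ContDiff ℂ (⊤ : ℕ∞) (f ℓ)) {β : Coeff A}
    (hβ : β ∈ lieG A) {Z : ℝ → FormalPoint A D} {t : ℝ}
    (hZ : ∀ m, HasDerivAt (fun s => Z s m) (subst (wordSeries f β) (Z t) m) t)
    {e : ℝ → Coeff A} {e' : Coeff A} (he : ∀ w, HasDerivAt (fun s => e s w) (e' w) t)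
    (m : A →₀ ℕ) :
    HasDerivAt (fun s => subst (wordSeries f (e s)) (Z s) m)
      (subst (wordSeries f (e' + β * e t)) (Z t) m) t := by
  rw [hasDerivAt_pi]
  intro i
  have hc : ContDiff ℂ (⊤ : ℕ∞) fun y : Fin D → ℂ => y i := contDiff_coord i
  have e2 : ∀ p : FormalPoint A D,
      evSeries p (opSeries f (e' + β * e t) fun y => y i) =
        evSeries p (opSeries f e' fun y => y i) +
          evSeries p (opSeries f (β * e t) fun y => y i) := by
    intro p
    rw [← evSeries_add p (isSmoothScalar_opSeries hf _ hc) (isSmoothScalar_opSeries hf _ hc)]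
    simp only [← opSeries_add_left]
  simp only [subst_wordSeries_apply hf]
  rw [e2, map_add, coeff_evSeries_opSeries_mul hf β _ hc, coeff_evSeries_opSeries hf e' hc]
  simp only [coeff_evSeries_opSeries hf _ hc, ← Finset.sum_add_distrib]
  refine HasDerivAt.fun_sum fun ab _ => HasDerivAt.fun_sum fun w _ => ?_
  have hw := contDiff_opWord hf w hc
  rw [← sum_ev_pd_mul_coordSeries_subst hf hβ hw]
  exact (he w).mul (hasDerivAt_ev_const hZ hw ab.2)

theorem subst_wordSeries_expStar_neg (hf : ∀ ℓ, ContDiff ℂ (⊤ : ℕ∞) (f ℓ)) {β : Coeff A}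
    (hβ : β ∈ lieG A) (t : ℝ) (p : FormalPoint A D) :
    subst (wordSeries f (expStar ((t : ℂ) • β)))
      (subst (wordSeries f (expStar (((-t : ℝ) : ℂ) • β))) p) = p := by
  rw [subst_subst (isSmooth_wordSeries hf _) (isSmooth_wordSeries hf _)]
  simp only [subst_wordSeries hf (expStar_mem_groupG (smul_mem_lieG _ hβ)),
    expStar_mul_expStar_neg hβ.1, wordSeries_one hf]
  exact subst_pointSeries_left p

/-- Uniqueness without any Lipschitz argument for formal systems: `W_{exp(-sβ)}(Z(s))` has
derivative zero, hence is constant on the interval, and `W_{exp(tβ)}` undoes it. -/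
theorem eq_subst_wordSeries_expStar (hf : ∀ ℓ, ContDiff ℂ (⊤ : ℕ∞) (f ℓ)) {β : Coeff A}
    (hβ : β ∈ lieG A) {J : Set ℝ} (hJ : IsOpen J) (hJc : J.OrdConnected) (h0 : (0 : ℝ) ∈ J)
    {Z : ℝ → FormalPoint A D} (hZ : IsFormalSolution (wordSeries f β) J Z) {t : ℝ} (ht : t ∈ J) :
    Z t = subst (wordSeries f (expStar ((t : ℂ) • β))) (Z 0) := by
  have hd : ∀ s ∈ J, ∀ m, HasDerivAt
      (fun s => subst (wordSeries f (expStar (((-s : ℝ) : ℂ) • β))) (Z s) m) 0 s := by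
    intro s hs m
    have h1 := hasDerivAt_subst_wordSeries hf hβ (hZ s hs)
      (e := fun s => expStar (((-s : ℝ) : ℂ) • β))
      (e' := -(β * expStar (((-s : ℝ) : ℂ) • β)))
      (fun w => hasDerivAt_expStar_neg hβ.1 w s) m
    refine h1.congr_deriv ?_
    rw [neg_add_cancel]
    rw [subst_wordSeries_zero hf]
    rfl
  have hc : ∀ m, subst (wordSeries f (expStar (((-t : ℝ) : ℂ) • β))) (Z t) m =
      subst (wordSeries f (expStar (((-(0 : ℝ) : ℝ) : ℂ) • β))) (Z 0) m := by
    intro m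
    exact hJ.is_const_of_deriv_eq_zero hJc.isPreconnected
      (fun s hs => (hd s hs m).differentiableAt.differentiableWithinAt)
      (fun s hs => (hd s hs m).deriv) ht h0
  have e0 : (expStar (((-(0 : ℝ) : ℝ) : ℂ) • β)) = 1 := by
    rw [neg_zero, Complex.ofReal_zero]
    exact expStar_zero_smul β
  conv_lhs => rw [← subst_wordSeries_expStar_neg hf hβ t (Z t), funext hc, e0]
  rw [wordSeries_one hf, subst_pointSeries_left]

theorem isFormalSolution_expStar (hf : ∀ ℓ, ContDiff ℂ (⊤ : ℕ∞) (f ℓ)) {β : Coeff A}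
    (hβ : β ∈ lieG A) (p : FormalPoint A D) :
    IsFormalSolution (wordSeries f β) Set.univ
      fun t => subst (wordSeries f (expStar ((t : ℂ) • β))) p := by
  intro t _ m
  -- The initial point stays fixed, so it is treated as a solution of the system with `β = 0`, and
  -- only the coefficients move.
  have h0 : (0 : Coeff A) ∈ lieG A := by simpa using smul_mem_lieG 0 hβ
  have hp : ∀ m, HasDerivAt (fun _ : ℝ => p m) (subst (wordSeries f 0) p m) t := by
    intro m
    rw [subst_wordSeries_zero hf]
    exact hasDerivAt_const t (p m)
  refine (hasDerivAt_subst_wordSeries hf h0 (Z := fun _ => p) hp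
    (fun w => hasDerivAt_expStar hβ.1 w t) m).congr_deriv ?_
  rw [zero_mul, add_zero, commute_expStar hβ.1,
    subst_subst (isSmooth_wordSeries hf _) (isSmooth_wordSeries hf _)]
  simp only [subst_wordSeries hf (expStar_mem_groupG (smul_mem_lieG _ hβ))]

/-- The derivative of `φ_{ctv}(X(t))`, if `dX/dt = a g^v(X) + W_β(X)` and `W_β` is invariant. -/
theorem hasDerivAt_subst_flow (h : IsPerturbedSystem ν g f) (hφ : IsFlow g φ) (v : Fin d → ℂ)
    {β : Coeff A} (hβ : β ∈ lieG A) (hν : ∀ w, nuWord ν v w ≠ 0 → β w = 0) (a c : ℝ)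
    {X : ℝ → FormalPoint A D} {t : ℝ}
    (hX : ∀ m, HasDerivAt (fun s => X s m) ((a : ℂ) • subst (mapSeries (gField g v)) (X t) m +
      subst (wordSeries f β) (X t) m) t) (m : A →₀ ℕ) :
    HasDerivAt (fun s => subst (mapSeries (φ (((c * s : ℝ) : ℂ) • v))) (X s) m)
      (((a + c : ℝ) : ℂ) •
        subst (mapSeries (gField g v)) (subst (mapSeries (φ (((c * t : ℝ) : ℂ) • v))) (X t)) m +
        subst (wordSeries f β) (subst (mapSeries (φ (((c * t : ℝ) : ℂ) • v))) (X t)) m) t := by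
  rw [hasDerivAt_pi]
  intro i
  have hf := h.smooth_f
  have hg := contDiff_gField h v
  have hc : ContDiff ℂ (⊤ : ℕ∞) fun y : Fin D → ℂ => y i := contDiff_coord i
  set P := φ (((c * t : ℝ) : ℂ) • v) with hP
  have hPs : ContDiff ℂ (⊤ : ℕ∞) P := contDiff_flow hφ _
  have hPc : ContDiff ℂ (⊤ : ℕ∞) fun x => P x i := (contDiff_coord i).comp hPs
  have hsmul : ∀ s : ℝ, ((c * s : ℝ) : ℂ) • v = (s : ℂ) • ((c : ℂ) • v) := fun s => by
    rw [smul_smul, Complex.ofReal_mul, mul_comm]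
  have hH := contDiff_comp_flow hφ ((c : ℂ) • v) hc
  set p := X t with hp
  have i1 : ev (subst (mapSeries P) p) (fun x => gField g v x i) =
      ev p fun x => gField g v (P x) i := by
    rw [ev_subst (isSmooth_mapSeries hPs) p (contDiff_gField_coord h v i)]
    simp only [mapSeries, ev_pointSeries _ (contDiff_gField_coord h v i)]
    exact evSeries_C p _
  -- The support of `β` on resonant words enters here: it lets `E_β` pass through composition with
  -- the flow.
  have i2 : evSeries (subst (mapSeries P) p) (opSeries f β fun y => y i) =
      evSeries p (opSeries f β fun x => P x i) := by
    rw [evSeries_subst (isSmooth_mapSeries hPs) p (isSmoothScalar_opSeries hf β hc)]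
    simp only [mapSeries, evSeries_pointSeries _ (isSmoothScalar_opSeries hf β hc)]
    exact congrArg (evSeries p) (funext fun x => (opSeries_comp_flow h hφ v (c * t) hν hc x).symm)
  have e1 : (fun s : ℝ => subst (mapSeries (φ (((c * s : ℝ) : ℂ) • v))) (X s) m i) =
      fun s : ℝ => ev (X s) (fun x => φ ((s : ℂ) • ((c : ℂ) • v)) x i) m := by
    funext s
    rw [hsmul]
    exact congrFun (coordSeries_subst_mapSeries (contDiff_flow hφ _) (X s) i) m
  rw [e1]
  refine (hasDerivAt_ev hX hH m).congr_deriv ?_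
  have e2 : (fun x =>
      paramDt (fun z : ℂ × (Fin D → ℂ) => φ (z.1 • (c : ℂ) • v) z.2 i) ((t : ℂ), x)) =
      fun x => (c : ℂ) * gField g v (P x) i := by
    funext x
    rw [paramDt, fderiv_comp_flow_time hφ ((c : ℂ) • v) hc, gDeriv_coord, ← hsmul]
    simp [gField, mul_smul, Finset.mul_sum, hP]
  -- Invariance of `g^v` under its flow makes the contribution `a g^v` of `X'` reappear at the
  -- transported point, where it adds to the `c g^v` coming from the moving flow.
  have e3 : (fun x => gField g v (P x) i) = gDeriv g v fun x => P x i := by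
    funext x
    rw [gDeriv_comp_flow h hφ v (c * t) hc, gDeriv_coord]
  have e4 : ∑ j, ev p (pd j fun x => P x i) * (ev p fun x => gField g v x j) =
      ev p fun x => gField g v (P x) i := by
    rw [e3]
    unfold gDeriv
    simp only [fderiv_eq_sum_pd]
    rw [ev_sum p Finset.univ (F := fun j x => pd j (fun x => P x i) x * gField g v x j) fun j =>
      (contDiff_pd j hPc).mul (contDiff_gField_coord h v j)]
    exact Finset.sum_congr rfl fun j _ =>
      (ev_mul p (contDiff_pd j hPc) (contDiff_gField_coord h v j)).symm
  have e5 : ∀ j, coordSeries (fun m => (a : ℂ) • subst (mapSeries (gField g v)) p m +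
      subst (wordSeries f β) p m) j = MvPowerSeries.C (a : ℂ) * (ev p fun x => gField g v x j) +
        coordSeries (subst (wordSeries f β) p) j := by
    intro j
    rw [← coordSeries_subst_mapSeries hg]
    ext m
    rw [map_add, MvPowerSeries.coeff_C_mul]
    rfl
  have hgP : ContDiff ℂ (⊤ : ℕ∞) fun x => gField g v (P x) i :=
    (contDiff_gField_coord h v i).comp hPs
  have e6 : evDeriv p (fun m => (a : ℂ) • subst (mapSeries (gField g v)) p m +
      subst (wordSeries f β) p m) (fun z : ℂ × (Fin D → ℂ) => φ (z.1 • (c : ℂ) • v) z.2 i) t =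
      MvPowerSeries.C ((a + c : ℝ) : ℂ) * (ev p fun x => gField g v (P x) i) +
        evSeries p (opSeries f β fun x => P x i) := by
    rw [evDeriv, e2, ev_const_mul p _ hgP, ← sum_ev_pd_mul_coordSeries_subst hf hβ hPc]
    simp only [← pd_param hH, e5, mul_add, Finset.sum_add_distrib, ← hsmul]
    rw [← hP]
    simp only [mul_left_comm _ (MvPowerSeries.C (a : ℂ)), ← Finset.mul_sum]
    rw [e4, Complex.ofReal_add, map_add]
    ring
  rw [e6, ← i1, ← i2, map_add, MvPowerSeries.coeff_C_mul]
  rw [← coordSeries_subst_mapSeries hg]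
  show _ = ((a + c : ℝ) : ℂ) * _ + subst (wordSeries f β) (subst (mapSeries P) p) m i
  rw [subst_wordSeries_apply hf]
  rfl

end Curves

end WordSeries

end

noncomputable section

namespace WordSeries

/-! ### Solutions of the normal form -/

section NormalForm

variable {A : Type*} {d D : ℕ} {ν : Fin d → A → ℂ}

theorem nuWord_smul (c : ℂ) (v : Fin d → ℂ) (w : List A) :
    nuWord ν (c • v) w = c * nuWord ν v w := by
  rw [nuWord, nuWord, ← List.sum_map_mul_left]
  refine congrArg List.sum (List.map_congr_left fun ℓ _ => ?_)
  simp [Finset.mul_sum, mul_assoc]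

theorem eq_zero_of_xi_eq_zero {v : Fin d → ℂ} {β : Coeff A} (h : xi ν v β = 0) (w : List A)
    (hw : nuWord ν v w ≠ 0) : β w = 0 :=
  (mul_eq_zero.1 (congrFun h w)).resolve_left hw

theorem xi_eq_zero_of_mem_resonanceSpace {u v : Fin d → ℂ} (hu : u ∈ resonanceSpace ν v)
    {β : Coeff A} (h : xi ν v β = 0) : xi ν u β = 0 := by
  ext w
  show nuWord ν u w * β w = 0
  by_cases hw : nuWord ν v w = 0
  · rw [hu w hw, zero_mul]
  · rw [eq_zero_of_xi_eq_zero h w hw, mul_zero]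

theorem xi_zero_right (v : Fin d → ℂ) : xi ν v (0 : Coeff A) = 0 := by
  ext w
  exact mul_zero _

theorem xi_zero_left (β : Coeff A) : xi ν 0 β = 0 := by
  ext w
  simp [xi, nuWord]

theorem xi_smul_expStar {v : Fin d → ℂ} {β : Coeff A} (h : xi ν v β = 0) (c : ℂ) :
    xi ν v (expStar (c • β)) = 0 := by
  refine xi_expStar ν ?_
  ext w
  show nuWord ν v w * (c * β w) = 0
  rw [mul_left_comm, show nuWord ν v w * β w = 0 from congrFun h w, mul_zero]

theorem bigXi_smul_of_xi_eq_zero {v : Fin d → ℂ} {β : Coeff A} (h : xi ν v β = 0) (c : ℂ) :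
    bigXi ν (c • v) β = β := by
  ext w
  rw [bigXi, nuWord_smul]
  by_cases hw : nuWord ν v w = 0
  · simp [hw]
  · simp [eq_zero_of_xi_eq_zero h w hw]

theorem bigXi_zero_left (β : Coeff A) : bigXi ν 0 β = β := by
  ext w
  simp [bigXi, nuWord]

variable [DecidableEq A] {g : Fin d → (Fin D → ℂ) → (Fin D → ℂ)}
  {f : A → (Fin D → ℂ) → (Fin D → ℂ)} {φ : (Fin d → ℂ) → (Fin D → ℂ) → (Fin D → ℂ)}

theorem wordSeries_comp_flow (h : IsPerturbedSystem ν g f) (hφ : IsFlow g φ) (v : Fin d → ℂ)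
    (t : ℝ) {γ : Coeff A} (hγ : γ ∈ groupG A) (hν : ∀ w, nuWord ν v w ≠ 0 → γ w = 0)
    (p : FormalPoint A D) :
    subst (wordSeries f γ) (subst (mapSeries (φ ((t : ℂ) • v))) p) =
      subst (mapSeries (φ ((t : ℂ) • v))) (subst (wordSeries f γ) p) := by
  have hP := contDiff_flow hφ ((t : ℂ) • v)
  have hW : IsSmooth (wordSeries f γ : FormalMap A D) := isSmooth_wordSeries h.smooth_f γ
  rw [subst_subst (isSmooth_mapSeries hP) hW, subst_subst hW (isSmooth_mapSeries hP)]
  congr 1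
  funext x
  refine formalPoint_ext fun i => ?_
  have hc : ContDiff ℂ (⊤ : ℕ∞) fun y : Fin D → ℂ => y i := contDiff_coord i
  have hPc : ContDiff ℂ (⊤ : ℕ∞) fun y => φ ((t : ℂ) • v) y i := hc.comp hP
  rw [mapSeries, subst_pointSeries_right hW, coordSeries_wordSeries h.smooth_f,
    coordSeries_subst_mapSeries hP, ev_wordSeries h.smooth_f hγ hPc,
    ← opSeries_comp_flow h hφ v t hν hc]

theorem subst_flow_neg_flow (h : IsPerturbedSystem ν g f) (hφ : IsFlow g φ) (v : Fin d → ℂ)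
    (t : ℝ) (p : FormalPoint A D) :
    subst (mapSeries (φ ((t : ℂ) • v))) (subst (mapSeries (φ (((-t : ℝ) : ℂ) • v))) p) = p := by
  rw [subst_subst (isSmooth_mapSeries (contDiff_flow hφ _))
    (isSmooth_mapSeries (contDiff_flow hφ _))]
  have e : (fun x => subst (mapSeries (φ ((t : ℂ) • v)))
      (mapSeries (φ (((-t : ℝ) : ℂ) • v)) x)) = (pointSeries : FormalMap A D) := by
    funext x
    rw [mapSeries, subst_pointSeries_right (isSmooth_mapSeries (contDiff_flow hφ _)), mapSeries,
      flow_flow_neg h hφ]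
  rw [e, subst_pointSeries_left]

theorem subst_mapSeries_flow_zero (hφ : IsFlow g φ) (v : Fin d → ℂ) (p : FormalPoint A D) :
    subst (mapSeries (φ (((0 : ℝ) : ℂ) • v))) p = p := by
  have e : (mapSeries (φ (((0 : ℝ) : ℂ) • v)) : FormalMap A D) = pointSeries := by
    funext x
    rw [mapSeries, Complex.ofReal_zero, zero_smul, hφ.zero]
  rw [e, subst_pointSeries_left]

/-- The solutions of the normal form, in terms of the two flows. -/
theorem isFormalSolution_extField_iff (h : IsPerturbedSystem ν g f) (hφ : IsFlow g φ)
    {v : Fin d → ℂ} {β : Coeff A} (hβ : β ∈ lieG A) (hxi : xi ν v β = 0) {J : Set ℝ}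
    (hJ : IsOpen J) (hJc : J.OrdConnected) (h0 : (0 : ℝ) ∈ J) (X : ℝ → FormalPoint A D) :
    IsFormalSolution (extField g f (v, β)) J X ↔ ∀ t ∈ J, X t =
      subst (mapSeries (φ ((t : ℂ) • v)))
        (subst (wordSeries f (expStar ((t : ℂ) • β))) (X 0)) := by
  have hf := h.smooth_f
  have hν := eq_zero_of_xi_eq_zero hxi
  constructor
  · intro hX t ht
    have hZ : IsFormalSolution (wordSeries f β) J
        fun s => subst (mapSeries (φ (((-s : ℝ) : ℂ) • v))) (X s) := by
      intro s hs m
      have h1 : ∀ m, HasDerivAt (fun s => X s m)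
          (((1 : ℝ) : ℂ) • subst (mapSeries (gField g v)) (X s) m +
            subst (wordSeries f β) (X s) m) s := by
        intro m
        refine (hX s hs m).congr_deriv ?_
        rw [subst_extField h, Complex.ofReal_one, one_smul]
        rfl
      -- With `a = 1` and `c = -1` the field `g^v` cancels, and the transported curve solves the
      -- system of `W_β` alone.
      have h2 := hasDerivAt_subst_flow h hφ v hβ hν 1 (-1) h1 m
      simpa only [neg_mul, one_mul, add_neg_cancel, Complex.ofReal_zero, zero_smul, zero_add]
        using h2
    have h3 := eq_subst_wordSeries_expStar hf hβ hJ hJc h0 hZ ht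
    simp only [neg_zero, subst_mapSeries_flow_zero hφ] at h3
    rw [← h3, subst_flow_neg_flow h hφ]
  · intro hX t ht m
    have h1 : ∀ m, HasDerivAt (fun s : ℝ => subst (wordSeries f (expStar ((s : ℂ) • β))) (X 0) m)
        (((0 : ℝ) : ℂ) • subst (mapSeries (gField g v))
            (subst (wordSeries f (expStar ((t : ℂ) • β))) (X 0)) m +
          subst (wordSeries f β) (subst (wordSeries f (expStar ((t : ℂ) • β))) (X 0)) m) t := by
      intro m
      rw [Complex.ofReal_zero, zero_smul, zero_add]
      exact isFormalSolution_expStar hf hβ (X 0) t trivial m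
    -- Conversely, `a = 0` and `c = 1` restores `g^v`.
    have h2 := hasDerivAt_subst_flow h hφ v hβ hν 0 1 h1 m
    simp only [one_mul, zero_add, Complex.ofReal_one, one_smul] at h2
    rw [← hX t ht] at h2
    rw [subst_extField h]
    refine h2.congr_of_eventuallyEq ?_
    filter_upwards [hJ.mem_nhds ht] with s hs
    rw [hX s hs]

theorem isFormalFlow_expStar (hf : ∀ ℓ, ContDiff ℂ (⊤ : ℕ∞) (f ℓ)) {β : Coeff A}
    (hβ : β ∈ lieG A) :
    IsFormalFlow (wordSeries f β : FormalMap A D)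
      fun t => wordSeries f (expStar ((t : ℂ) • β)) := by
  refine ⟨fun t => isSmooth_wordSeries hf _, fun x => ?_, fun x => ?_⟩
  · beta_reduce
    rw [Complex.ofReal_zero, expStar_zero_smul, wordSeries_one hf]
  · have := isFormalSolution_expStar hf hβ (pointSeries x)
    simpa only [subst_pointSeries_right (isSmooth_wordSeries hf _)] using this

/-- Formal flows are unique, so the decomposition of solutions proved for `W_{exp(tβ)}` holds for
every flow satisfying the definition. -/
theorem IsFormalFlow.eq_wordSeries (hf : ∀ ℓ, ContDiff ℂ (⊤ : ℕ∞) (f ℓ)) {β : Coeff A}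
    (hβ : β ∈ lieG A) {Φ : ℝ → FormalMap A D} (hΦ : IsFormalFlow (wordSeries f β) Φ) (t : ℝ) :
    Φ t = wordSeries f (expStar ((t : ℂ) • β)) := by
  funext x
  have := eq_subst_wordSeries_expStar hf hβ isOpen_univ Set.ordConnected_univ (Set.mem_univ 0)
    (hΦ.2.2 x) (Set.mem_univ t)
  rwa [hΦ.2.1, subst_pointSeries_right (isSmooth_wordSeries hf _)] at this

end NormalForm

end WordSeries

end

/-! ### The theorem -/

open WordSeries in
theorem theorem1 {A : Type*} [DecidableEq A] {d : ℕ} (ν : Fin d → A → ℂ)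
    (v : Fin d → ℂ) (β : Coeff A) (hβ : β ∈ lieG A) :
    ∃ (κ : (Coeff A)ˣ) (βh : Coeff A),
      (κ : Coeff A) ∈ groupG A ∧
      βh = κ * β * (κ⁻¹ : (Coeff A)ˣ) - xi ν v κ * (κ⁻¹ : (Coeff A)ˣ) ∧
      βh ∈ lieG A ∧
      extBracket ν (v, 0) (0, βh) = (0, xi ν v βh) ∧
      xi ν v βh = 0 ∧
      (∀ u ∈ resonanceSpace ν v, extBracket ν (0, βh) (u, 0) = 0) ∧
      (∀ t : ℝ,
        expStar ((t : ℂ) • βh) ∈ groupG A ∧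
        ((t : ℂ) • v, expStar ((t : ℂ) • βh)) =
          bigStar ν (0, expStar ((t : ℂ) • βh)) ((t : ℂ) • v, 1) ∧
        ((t : ℂ) • v, expStar ((t : ℂ) • βh)) =
          bigStar ν ((t : ℂ) • v, 1) (0, expStar ((t : ℂ) • βh))) ∧
      ∀ (D : ℕ) (g : Fin d → (Fin D → ℂ) → (Fin D → ℂ)) (f : A → (Fin D → ℂ) → (Fin D → ℂ))
        (φ : (Fin d → ℂ) → (Fin D → ℂ) → (Fin D → ℂ)),
        IsPerturbedSystem ν g f → IsFlow g φ →
        -- the change of variables gives the normal form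
        TransformsInto (wordSeries f κ) (extField g f (v, β)) (extField g f (v, βh)) ∧
        -- commutation of the vector fields
        formalBracket (mapSeries (gField g v)) (wordSeries f βh) = 0 ∧
        (∀ u ∈ resonanceSpace ν v,
          formalBracket (mapSeries (gField g u)) (wordSeries f βh) = 0) ∧
        -- decomposition of the solutions of the normal form by means of the two flows
        (∃ φh : ℝ → FormalMap A D, IsFormalFlow (wordSeries f βh) φh) ∧
        (∀ φh : ℝ → FormalMap A D, IsFormalFlow (wordSeries f βh) φh →
          ∀ (J : Set ℝ) (X : ℝ → FormalPoint A D), IsOpen J → J.OrdConnected → (0 : ℝ) ∈ J →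
            IsFormalSolution (extField g f (v, βh)) J X →
            ∀ t ∈ J,
              X t = subst (mapSeries (φ ((t : ℂ) • v))) (subst (φh t) (X 0)) ∧
              X t = subst (φh t) (subst (mapSeries (φ ((t : ℂ) • v))) (X 0))) ∧
        -- the solutions of the normal form are the curves given by the extended word series
        (∀ (J : Set ℝ) (X : ℝ → FormalPoint A D), IsOpen J → J.OrdConnected → (0 : ℝ) ∈ J →
          (IsFormalSolution (extField g f (v, βh)) J X ↔
            ∀ t ∈ J, X t =
              subst (extWordSeries f φ ((t : ℂ) • v, expStar ((t : ℂ) • βh))) (X 0))) := by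
  obtain ⟨κ, hκ, hxi⟩ := exists_gauge ν v hβ
  set βh := gaugeAction ν v κ β with hβh
  have hL : βh ∈ lieG A := gaugeAction_mem_lieG ν v hκ hβ
  have hE : ∀ t : ℝ, expStar ((t : ℂ) • βh) ∈ groupG A := fun t =>
    expStar_mem_groupG (smul_mem_lieG _ hL)
  have hxiE : ∀ t : ℝ, xi ν v (expStar ((t : ℂ) • βh)) = 0 := fun t => xi_smul_expStar hxi _
  refine ⟨κ, βh, hκ, rfl, hL, ?_, hxi, fun u hu => ?_, fun t => ⟨hE t, ?_, ?_⟩, ?_⟩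
  · simp [extBracket, xi_zero_left]
  · simp [extBracket, xi_zero_right, xi_eq_zero_of_mem_resonanceSpace hu hxi]
  · simp [bigStar, bigXi_zero_left]
  · refine Prod.ext ?_ ?_
    · show (t : ℂ) • v = 0 + expStar ((t : ℂ) • βh) [] • ((t : ℂ) • v)
      rw [(hE t).1, one_smul, zero_add]
    · show expStar ((t : ℂ) • βh) = 1 * bigXi ν ((t : ℂ) • v) (expStar ((t : ℂ) • βh))
      rw [bigXi_smul_of_xi_eq_zero (hxiE t), one_mul]
  intro D g f φ h hφ
  have hf := h.smooth_f
  -- The exponential of `t β̂` is again supported on resonant words, so its word series commutes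
  -- with `φ_{tv}`; this yields the second order of composition.
  have hcomm : ∀ (t : ℝ) (p : FormalPoint A D), _ := fun t p =>
    wordSeries_comp_flow h hφ v t (hE t) (eq_zero_of_xi_eq_zero (hxiE t)) p
  refine ⟨transformsInto_normalForm h v hκ hL rfl, formalBracket_gField h v hL hxi,
    fun u hu => formalBracket_gField h u hL (xi_eq_zero_of_mem_resonanceSpace hu hxi),
    ⟨_, isFormalFlow_expStar hf hL⟩, ?_, ?_⟩
  · intro φh hφh J X hJ hJc h0 hX t ht
    have e := (isFormalSolution_extField_iff h hφ hL hxi hJ hJc h0 X).1 hX t ht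
    rw [hφh.eq_wordSeries hf hL]
    exact ⟨e, e.trans (hcomm t (X 0)).symm⟩
  · intro J X hJ hJc h0
    rw [isFormalSolution_extField_iff h hφ hL hxi hJ hJc h0 X]
    refine forall₂_congr fun t _ => ?_
    -- By associativity of substitution the composition of the two flows is the substitution into a
    -- single extended word series.
    rw [subst_subst (isSmooth_wordSeries hf _) (isSmooth_mapSeries (contDiff_flow hφ _))]
    rfl
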